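/- Let $\mathfrak{o}$ be a complete discrete valuation ring (of any characteristic) with finite residue field, and let $\mathrm{SL}_2(\mathfrak{o})$ carry the topology induced by that of $\mathfrak{o}$, that is, by the topology defined by the powers of the maximal ideal. Let $\mathrm{Irr}(\mathrm{SL}_2(\mathfrak{o}))$ be the set of isomorphism classes of continuous irreducible finite-dimensional complex representations of $\mathrm{SL}_2(\mathfrak{o})$. Then for every $n$ only finitely many elements of $\mathrm{Irr}(\mathrm{SL}_2(\mathfrak{o}))$ have dimension $n$, and the abscissa of convergence of the representation zeta function $$\zeta_{\mathrm{SL}_2(\mathfrak{o})}(s)=\sum_{\rho\in\mathrm{Irr}(\mathrm{SL}_2(\mathfrak{o}))}\frac{1}{\dim(\rho)^{s}},$$ that is, the infimum of all $\alpha\in\mathbb{R}$ such that this series converges for every $s\in\mathbb{C}$ with $\mathrm{Re}(s)>\alpha$, is equal to $1$. -/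

import Mathlib

/-- A continuous irreducible complex representation of positive finite degree of a topological
group `G`, in coordinates: the representation space is `ℂⁿ` (with its usual topology), where
`n = dim`. (Positivity of `dim` is part of irreducibility.) -/
structure ContIrrRep (G : Type*) [Group G] [TopologicalSpace G] where
  /-- the dimension of the representation -/
  dim : ℕ
  /-- the action -/
  rep : Representation ℂ G (Fin dim → ℂ)
  irreducible : rep.IsIrreducible
  continuous_action : Continuous fun p : G × (Fin dim → ℂ) => rep p.1 p.2

/-- Isomorphism of continuous irreducible representations. (Linear maps between
finite-dimensional complex vector spaces are continuous.) -/
instance ContIrrRep.instSetoid (G : Type*) [Group G] [TopologicalSpace G] :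
    Setoid (ContIrrRep G) where
  r ρ σ := Nonempty (ρ.rep.Equiv σ.rep)
  iseqv :=
    { refl := fun ρ => ⟨Representation.Equiv.refl ρ.rep⟩
      symm := fun ⟨e⟩ => ⟨e.symm⟩
      trans := fun ⟨e⟩ ⟨f⟩ => ⟨e.trans f⟩ }

/-- `Irr(G)`: the set of isomorphism classes of continuous irreducible complex
representations of `G`. -/
def Irr (G : Type*) [Group G] [TopologicalSpace G] : Type _ :=
  Quotient (ContIrrRep.instSetoid G)

/-- The dimension of an isomorphism class of representations. -/
def Irr.dim {G : Type*} [Group G] [TopologicalSpace G] (ρ : Irr G) : ℕ :=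
  Quotient.lift (s := ContIrrRep.instSetoid G) ContIrrRep.dim
    (fun σ τ (h : Nonempty (σ.rep.Equiv τ.rep)) => by
      obtain ⟨e⟩ := h
      simpa using LinearEquiv.finrank_eq e.toLinearEquiv) ρ

/-- `G` is rigid: for every `n` there are finitely many isomorphism classes of continuous
irreducible complex representations of dimension `n`. -/
def IsRigid (G : Type*) [Group G] [TopologicalSpace G] : Prop :=
  ∀ n : ℕ, {ρ : Irr G | ρ.dim = n}.Finite

/-- The series `ζ_G(s) = ∑_{ρ ∈ Irr(G)} 1 / dim(ρ)^s` converges at `s`. The index set is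
unordered, so convergence means unconditional convergence. -/
def RepZetaConvergesAt (G : Type*) [Group G] [TopologicalSpace G] (s : ℂ) : Prop :=
  Summable fun ρ : Irr G => 1 / (ρ.dim : ℂ) ^ s

/-- The abscissa of convergence of `ζ_G`: the infimum, in `[-∞, ∞]`, of all real `a` such
that `ζ_G` converges on the half-plane `Re s > a`. -/
noncomputable def repZetaAbscissa (G : Type*) [Group G] [TopologicalSpace G] : EReal :=
  sInf (Real.toEReal '' {a : ℝ | ∀ s : ℂ, a < s.re → RepZetaConvergesAt G s})

/-!
The series is studied through the finite quotients `SL₂(𝔬 / 𝔪 ^ r)`. A continuous finite-dimensional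
representation of `SL₂(𝔬)` is trivial on some congruence subgroup, because a general linear group
over `ℂ` has no small subgroups (`ContIrrRep.exists_trivial_on_congruence`); so `Irr(SL₂(𝔬))` is the
increasing union over `r` of the finite sets of irreducible representations of these quotients,
read off from the Wedderburn decompositions of their group algebras.

Write `q` for the order of the residue field. Three facts about the representations of level at
most `r`, of dimensions `nᵢ`, suffice.

* A representation of exact level `r` has dimension at least `q ^ (r / 2) / 4`: it is nontrivial on
  the upper unipotent elements close to `1`, so a character of the unipotent subgroup of exact level
  occurs in it, together with all its twists by squares of units (`card_le_mul_dim_of_ne_one`).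
* `∑ 1 / nᵢ` grows at most polynomially in `r` (`sum_inv_size_le`).
* `∑ nᵢ` is at least of order `q ^ (2 * r)` (`le_sum_size`), whereas
  `∑ nᵢ ^ 2 = |SL₂(𝔬 / 𝔪 ^ r)|` is at most of order `q ^ (3 * r)`.

The first two give convergence for `Re s > 1` (`summable_rpow_neg_of_layers`). The third excludes
convergence at real `0 < s < 1` (`not_summable_rpow_neg_of_moments`). Finiteness of the number of
representations of each dimension follows from convergence at any real point.

The second and third facts rest on one multiplicity-one property, valid in every residue
characteristic. Let `τ` be conjugation by `diag(1, -1)`. The argument of Gelfand and Kazhdan, with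
the anti-involution `g ↦ (τ g)⁻¹`, which exchanges the diagonal entries, shows that a
nondegenerate character of the unipotent subgroup makes the twisted Frobenius–Schur indicator of
every irreducible representation equal to `1`; that is, `∑ z, ρ (z * τ z)` is the scalar `|G| / n`
(`sum_map_mul_twist`, `hasTrivialTwistedIndicators_levelRing`). Taking characters, `∑ nᵢ` is the
number of solutions of `z * τ z = 1`, and combining with commutators, `|G| ^ 2 * ∑ 1 / nᵢ` is the
number of solutions of `g * k⁻¹ * g⁻¹ * k * (z * τ z) = 1`
(`WedderburnDecomposition.sum_inv_size`). The last number is bounded by a direct point count over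
the finite chain ring `𝔬 / 𝔪 ^ r` (`card_solutions_le`): the substitution `w = z * diag(1, -1)`
turns the equation into the conjugacy of `k` and `k * w ^ 2`, and for `k = α + ϖ ^ i * B` with `B`
cyclic modulo `ϖ` both the centralizer of `k` and the set of possible `w` are controlled by the
values of the binary norm form attached to the characteristic polynomial of `B`.
-/

section
open Matrix

local notation "SL2" => Matrix.SpecialLinearGroup (Fin 2)

/-! ### Matrix representations of finite groups -/

section SpanningRepresentations

variable {Γ : Type*} [Group Γ]

/-- A matrix commuting with a spanning set of matrices is scalar. -/
lemma eq_smul_one_of_commute_of_span {n : ℕ} (hn : n ≠ 0)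
    {S : Set (Matrix (Fin n) (Fin n) ℂ)} (hS : Submodule.span ℂ S = ⊤)
    {X : Matrix (Fin n) (Fin n) ℂ} (hX : ∀ Y ∈ S, Y * X = X * Y) :
    X = (X.trace / n) • (1 : Matrix (Fin n) (Fin n) ℂ) := by
  have hall : ∀ Y : Matrix (Fin n) (Fin n) ℂ, Y * X = X * Y := by
    intro Y
    have hY : Y ∈ Submodule.span ℂ S := by rw [hS]; trivial
    induction hY using Submodule.span_induction with
    | mem x h => exact hX x h
    | zero => simp
    | add x y _ _ hx hy => rw [add_mul, mul_add, hx, hy]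
    | smul a x _ hx => rw [smul_mul_assoc, mul_smul_comm, hx]
  have hmem : X ∈ Set.range (Matrix.scalar (Fin n) : ℂ → _) := by
    rw [Matrix.mem_range_scalar_iff_commute_single']
    intro i j
    exact hall _
  obtain ⟨c, rfl⟩ := hmem
  have hn' : (n : ℂ) ≠ 0 := by exact_mod_cast hn
  simp only [Matrix.scalar_apply, Matrix.trace_diagonal, Finset.sum_const, Finset.card_univ,
    Fintype.card_fin, nsmul_eq_mul, mul_div_cancel_left₀ _ hn', Matrix.smul_one_eq_diagonal]

lemma eq_smul_one_of_commute {n : ℕ} (hn : n ≠ 0) (ρ : Γ →* Matrix (Fin n) (Fin n) ℂ)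
    (hρ : Submodule.span ℂ (Set.range ρ) = ⊤)
    {X : Matrix (Fin n) (Fin n) ℂ} (hX : ∀ g, ρ g * X = X * ρ g) :
    X = (X.trace / n) • (1 : Matrix (Fin n) (Fin n) ℂ) :=
  eq_smul_one_of_commute_of_span hn hρ (by rintro _ ⟨g, rfl⟩; exact hX g)

lemma map_mul_map_inv_eq_one {n : ℕ} (ρ : Γ →* Matrix (Fin n) (Fin n) ℂ) (g : Γ) :
    ρ g * ρ g⁻¹ = 1 := by
  rw [← map_mul]; simp

lemma map_inv_mul_map_eq_one {n : ℕ} (ρ : Γ →* Matrix (Fin n) (Fin n) ℂ) (g : Γ) :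
    ρ g⁻¹ * ρ g = 1 := by
  rw [← map_mul]; simp

variable [Fintype Γ]

lemma sum_conj_eq_smul_one {n : ℕ} (hn : n ≠ 0) (ρ : Γ →* Matrix (Fin n) (Fin n) ℂ)
    (hρ : Submodule.span ℂ (Set.range ρ) = ⊤)
    (B : Matrix (Fin n) (Fin n) ℂ) :
    ∑ g, ρ g * B * ρ g⁻¹ = (Fintype.card Γ * B.trace / n) • (1 : Matrix (Fin n) (Fin n) ℂ) := by
  have h := eq_smul_one_of_commute hn ρ hρ (X := ∑ g, ρ g * B * ρ g⁻¹) (by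
    intro h
    rw [Finset.mul_sum, Finset.sum_mul]
    refine Fintype.sum_equiv (Equiv.mulLeft h) _ _ fun g => ?_
    simp [mul_assoc, map_mul]
    rw [← map_mul]; simp)
  rw [h]
  congr 2
  rw [Matrix.trace_sum]
  rw [Finset.sum_congr rfl (g := fun _ => B.trace)]
  · simp
  · intro g _
    rw [Matrix.trace_mul_comm, ← mul_assoc, map_inv_mul_map_eq_one, one_mul]

/-- Schur's orthogonality relations for the matrix coefficients of one representation. -/
lemma sum_dotProduct_mul_dotProduct_inv {n : ℕ} (hn : n ≠ 0) (ρ : Γ →* Matrix (Fin n) (Fin n) ℂ)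
    (hρ : Submodule.span ℂ (Set.range ρ) = ⊤)
    (l v m w : Fin n → ℂ) :
    ∑ g, (l ⬝ᵥ (ρ g *ᵥ v)) * (m ⬝ᵥ (ρ g⁻¹ *ᵥ w)) =
      (Fintype.card Γ : ℂ) / n * (l ⬝ᵥ w) * (m ⬝ᵥ v) := by
  have h := congrArg (fun M => l ⬝ᵥ (M *ᵥ w)) (sum_conj_eq_smul_one hn ρ hρ (Matrix.vecMulVec v m))
  simp only [Matrix.sum_mulVec, dotProduct_sum] at h
  rw [Matrix.trace_vecMulVec, Matrix.smul_mulVec, Matrix.one_mulVec, dotProduct_smul] at h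
  calc _ = _ := Finset.sum_congr rfl fun g _ => ?_
    _ = _ := h
    _ = _ := by rw [smul_eq_mul, dotProduct_comm v m]; ring
  rw [← Matrix.mulVec_mulVec, ← Matrix.mulVec_mulVec, Matrix.vecMulVec_mulVec]
  simp [Matrix.mulVec_smul, mul_comm]

/-- Schur's orthogonality relations for the entries of one representation. -/
lemma sum_entry_mul_entry_inv {n : ℕ} (hn : n ≠ 0) (ρ : Γ →* Matrix (Fin n) (Fin n) ℂ)
    (hρ : Submodule.span ℂ (Set.range ρ) = ⊤)
    (a b c d : Fin n) :
    ∑ g, ρ g a b * ρ g⁻¹ c d = if a = d ∧ b = c then (Fintype.card Γ : ℂ) / n else 0 := by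
  have h := congrFun (congrFun (sum_conj_eq_smul_one hn ρ hρ (Matrix.single b c 1)) a) d
  rw [Matrix.sum_apply] at h
  have h2 : ∀ g, (ρ g * Matrix.single b c 1 * ρ g⁻¹ : Matrix _ _ ℂ) a d = ρ g a b * ρ g⁻¹ c d := by
    intro g
    rw [Matrix.mul_assoc, Matrix.mul_apply, Finset.sum_eq_single b]
    · simp
    · intro x _ hx
      rw [Matrix.single_mul_apply_of_ne]; simp; exact hx
    · simp
  simp only [h2] at h
  rw [h, Matrix.smul_apply, Matrix.one_apply]
  by_cases hbc : b = c
  · subst hbc; by_cases had : a = d <;> simp [had]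
  · simp [hbc, Matrix.trace_single_eq_of_ne]

/-- The element `∑ χ(g⁻¹) g` of the group algebra, where `χ` is the character of `ρ`, acts on `ρ`
itself by the scalar `|Γ| / n`. -/
lemma sum_trace_inv_smul {n : ℕ} (hn : n ≠ 0) (ρ : Γ →* Matrix (Fin n) (Fin n) ℂ)
    (hρ : Submodule.span ℂ (Set.range ρ) = ⊤) :
    ∑ g, (ρ g⁻¹).trace • ρ g = ((Fintype.card Γ : ℂ) / n) • (1 : Matrix (Fin n) (Fin n) ℂ) := by
  ext a b
  simp only [Matrix.sum_apply, Matrix.smul_apply, smul_eq_mul, Matrix.trace, Matrix.diag,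
    Finset.sum_mul]
  rw [Finset.sum_comm]
  have : ∀ i, ∑ g, ρ g⁻¹ i i * ρ g a b = if a = i ∧ b = i then (Fintype.card Γ : ℂ) / n else 0 := by
    intro i
    rw [← sum_entry_mul_entry_inv hn ρ hρ]
    exact Finset.sum_congr rfl fun _ _ => mul_comm _ _
  simp only [this, Matrix.one_apply]
  by_cases hab : a = b
  · subst hab; simp
  · simp only [hab, if_false, mul_zero]
    apply Finset.sum_eq_zero
    intro i _
    rw [if_neg]; rintro ⟨rfl, rfl⟩; exact hab rfl

/-- The average of a representation over all commutators. -/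
lemma sum_commutator_eq_smul_one {n : ℕ} (hn : n ≠ 0) (ρ : Γ →* Matrix (Fin n) (Fin n) ℂ)
    (hρ : Submodule.span ℂ (Set.range ρ) = ⊤) :
    ∑ g, ∑ k, ρ (g * k⁻¹ * g⁻¹ * k) =
      ((Fintype.card Γ : ℂ) ^ 2 / n ^ 2) • (1 : Matrix (Fin n) (Fin n) ℂ) := by
  rw [Finset.sum_comm]
  have : ∀ k, ∑ g, ρ (g * k⁻¹ * g⁻¹ * k) =
      ((Fintype.card Γ : ℂ) / n) • ((ρ k⁻¹).trace • ρ k) := by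
    intro k
    have := congrArg (· * ρ k) (sum_conj_eq_smul_one hn ρ hρ (ρ k⁻¹))
    simp only [Finset.sum_mul, ← map_mul] at this
    rw [this, smul_mul_assoc, one_mul, smul_smul]
    congr 1
    ring
  simp only [this]
  rw [← Finset.smul_sum, sum_trace_inv_smul hn ρ hρ, smul_smul]
  congr 1; ring

/-- The twisted Frobenius–Schur theorem: if the corner `e ρ(Γ) e` cut out by some nonzero idempotent
`e` does not see the anti-automorphism `g ↦ τ(g)⁻¹`, then `ρ` carries a symmetric twisted-invariant
bilinear form, and so its twisted Frobenius–Schur indicator is `1`. -/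
theorem sum_map_mul_twist {n : ℕ} (hn : n ≠ 0) (ρ : Γ →* Matrix (Fin n) (Fin n) ℂ)
    (hρ : Submodule.span ℂ (Set.range ρ) = ⊤)
    (τ : Γ →* Γ) (hτ : ∀ g, τ (τ g) = g)
    (e : Matrix (Fin n) (Fin n) ℂ) (he : e * e = e) (he0 : e ≠ 0)
    (h : ∀ g, e * ρ (τ g)⁻¹ * e = e * ρ g * e) :
    ∑ z, ρ (z * τ z) = ((Fintype.card Γ : ℂ) / n) • (1 : Matrix (Fin n) (Fin n) ℂ) := by
  classical
  have hcard : (Fintype.card Γ : ℂ) ≠ 0 := by exact_mod_cast Fintype.card_ne_zero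
  have hn' : (n : ℂ) ≠ 0 := by exact_mod_cast hn
  -- A vector `v` in the image of `e` and a functional `l` factoring through `e` with `l v = 1`.
  obtain ⟨w, hw⟩ : ∃ w, e *ᵥ w ≠ 0 := by
    by_contra! hcon
    exact he0 (Matrix.ext_of_mulVec_single fun i => by rw [hcon, Matrix.zero_mulVec])
  obtain ⟨v, hv⟩ : ∃ v, v = e *ᵥ w := ⟨_, rfl⟩
  rw [← hv] at hw
  have hev : e *ᵥ v = v := by rw [hv, Matrix.mulVec_mulVec, he]
  obtain ⟨i0, hi0⟩ : ∃ i, v i ≠ 0 := by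
    by_contra! hcon; exact hw (funext hcon)
  obtain ⟨m, hm⟩ : ∃ m : Fin n → ℂ, m = Pi.single i0 (v i0)⁻¹ := ⟨_, rfl⟩
  obtain ⟨l, hl⟩ : ∃ l, l = m ᵥ* e := ⟨_, rfl⟩
  have hlv : l ⬝ᵥ v = 1 := by
    rw [hl, ← Matrix.dotProduct_mulVec, hev, hm]; simp [hi0]
  obtain ⟨f, hf⟩ : ∃ f : Γ → ℂ, ∀ g, f g = l ⬝ᵥ (ρ g *ᵥ v) := ⟨_, fun _ => rfl⟩
  have hf' : ∀ g, f g = m ⬝ᵥ ((e * ρ g * e) *ᵥ v) := by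
    intro g
    rw [hf, hl, ← Matrix.mulVec_mulVec, hev, ← Matrix.mulVec_mulVec, ← Matrix.dotProduct_mulVec]
  have hfτ : ∀ g, f (τ g) = f g⁻¹ := by
    intro g
    rw [hf', ← h, hτ, ← hf']
  -- The twisted-invariant bilinear form.
  obtain ⟨J, hJ⟩ : ∃ J : Matrix (Fin n) (Fin n) ℂ,
    J = ∑ z, Matrix.vecMulVec (ρ z *ᵥ v) (ρ (τ z) *ᵥ v) := ⟨_, rfl⟩
  have hτbij : Function.Bijective τ := ⟨fun a b hab => by rw [← hτ a, hab, hτ], fun b => ⟨_, hτ b⟩⟩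
  have hJsymm : J.transpose = J := by
    rw [hJ, Matrix.transpose_sum]
    refine Fintype.sum_equiv (Equiv.ofBijective τ hτbij) _ _ fun z => ?_
    simp [hτ, Matrix.transpose_vecMulVec]
  have hJinv : ∀ g, ρ g * J * (ρ (τ g)).transpose = J := by
    intro g
    rw [hJ, Finset.mul_sum, Finset.sum_mul]
    refine Fintype.sum_equiv (Equiv.mulLeft g) _ _ fun z => ?_
    simp only [Equiv.coe_mulLeft, map_mul, ← Matrix.mulVec_mulVec]
    rw [Matrix.mul_vecMulVec, Matrix.vecMulVec_mul, Matrix.vecMul_transpose]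
  have hlJ : l ⬝ᵥ (J *ᵥ l) = (Fintype.card Γ : ℂ) / n := by
    have h1 : l ⬝ᵥ (J *ᵥ l) = ∑ z, f z * f z⁻¹ := by
      rw [hJ, Matrix.sum_mulVec, dotProduct_sum]
      refine Finset.sum_congr rfl fun z _ => ?_
      rw [← hfτ, hf, hf, Matrix.vecMulVec_mulVec]
      simp [dotProduct_comm l (ρ (τ z) *ᵥ v)]
      ring
    rw [h1]
    simp only [hf]
    rw [sum_dotProduct_mul_dotProduct_inv hn ρ hρ, hlv, mul_one, mul_one]
  -- The kernel of `J` is stable under the transposes of all matrices, so a degenerate `J` is `0`.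
  have hdet : J.det ≠ 0 := by
    intro hdet
    obtain ⟨x, hx, hJx⟩ := Matrix.exists_mulVec_eq_zero_iff.mpr hdet
    have key : ∀ A : Matrix (Fin n) (Fin n) ℂ, J *ᵥ (A.transpose *ᵥ x) = 0 := by
      intro A
      have hA : A ∈ Submodule.span ℂ (Set.range ρ) := by rw [hρ]; trivial
      induction hA using Submodule.span_induction with
      | mem y hy =>
        obtain ⟨g, rfl⟩ := hy
        have := hJinv (τ g)
        rw [hτ] at this
        have h3 := congrArg (fun M => ρ (τ g)⁻¹ *ᵥ (M *ᵥ x)) this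
        simp only [hJx, Matrix.mulVec_zero, Matrix.mulVec_mulVec, ← Matrix.mul_assoc,
          map_inv_mul_map_eq_one, one_mul] at h3
        rw [Matrix.mulVec_mulVec, h3]
      | zero => simp
      | add y z _ _ hy hz =>
        rw [Matrix.transpose_add, Matrix.add_mulVec, Matrix.mulVec_add, hy, hz, add_zero]
      | smul a y _ hy =>
        rw [Matrix.transpose_smul, Matrix.smul_mulVec, Matrix.mulVec_smul, hy, smul_zero]
    obtain ⟨i1, hi1⟩ : ∃ i, x i ≠ 0 := by
      by_contra! hcon; exact hx (funext hcon)
    have hJ0 : J = 0 := by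
      refine Matrix.ext_of_mulVec_single fun j => ?_
      have := key (Matrix.single i1 j (x i1)⁻¹)
      rw [Matrix.transpose_single, Matrix.single_mulVec] at this
      rw [Matrix.zero_mulVec, ← this]
      congr 1
      simp [hi1]; rfl
    rw [hJ0] at hlJ
    rw [Matrix.zero_mulVec, dotProduct_zero] at hlJ
    exact (div_ne_zero hcard hn') hlJ.symm
  have hJJ : J⁻¹ * J = 1 := Matrix.nonsing_inv_mul _ (isUnit_iff_ne_zero.mpr hdet)
  have htr : ∀ z, (ρ (τ z)).transpose = J⁻¹ * ρ z⁻¹ * J := by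
    intro z
    have : J⁻¹ * ρ z⁻¹ * (ρ z * J * (ρ (τ z)).transpose) = J⁻¹ * ρ z⁻¹ * J := by rw [hJinv]
    rw [← this]
    rw [Matrix.mul_assoc, ← Matrix.mul_assoc (ρ z⁻¹), ← Matrix.mul_assoc (ρ z⁻¹),
      map_inv_mul_map_eq_one, one_mul, ← Matrix.mul_assoc, hJJ, one_mul]
  rw [eq_smul_one_of_commute hn ρ hρ (X := ∑ z, ρ (z * τ z))]
  · congr 2
    have h1 : ∀ z, (ρ (z * τ z)).trace = ∑ i, ∑ j,
        (Pi.single i 1 ⬝ᵥ (ρ z *ᵥ Pi.single j 1)) * (J⁻¹ i ⬝ᵥ (ρ z⁻¹ *ᵥ fun k => J k j)) := by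
      intro z
      rw [map_mul, Matrix.trace]
      refine Finset.sum_congr rfl fun i _ => ?_
      rw [Matrix.diag, Matrix.mul_apply]
      refine Finset.sum_congr rfl fun j _ => ?_
      have h2 : ρ (τ z) j i = (J⁻¹ * (ρ z⁻¹ * J)) i j := by
        rw [← Matrix.mul_assoc, ← htr]; rfl
      rw [h2]
      simp
      left
      rfl
    rw [Matrix.trace_sum]
    simp only [h1]
    rw [Finset.sum_comm]
    have h3 : ∀ i, ∑ z, ∑ j, (Pi.single i 1 ⬝ᵥ (ρ z *ᵥ Pi.single j 1)) *
        (J⁻¹ i ⬝ᵥ (ρ z⁻¹ *ᵥ fun k => J k j)) = (Fintype.card Γ : ℂ) / n := by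
      intro i
      rw [Finset.sum_comm]
      simp only [sum_dotProduct_mul_dotProduct_inv hn ρ hρ]
      have h4 : ∑ j, J⁻¹ i j * J j i = 1 := by
        rw [← Matrix.mul_apply, hJJ, Matrix.one_apply_eq]
      refine Eq.trans ?_ ((congrArg ((Fintype.card Γ : ℂ) / n * ·) h4).trans (mul_one _))
      rw [Finset.mul_sum]
      refine Finset.sum_congr rfl fun j _ => ?_
      have h5 : J i j = J j i := congrFun (congrFun hJsymm j) i
      simp [h5]
      ring
    simp only [h3]
    simp
    field_simp
  · intro g
    rw [Finset.mul_sum, Finset.sum_mul]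
    refine Fintype.sum_equiv ((Equiv.mulLeft g).trans (Equiv.mulRight (τ g)⁻¹)) _ _ fun z => ?_
    simp only [Equiv.trans_apply, Equiv.coe_mulLeft, Equiv.coe_mulRight, ← map_mul ρ]
    simp [mul_assoc, hτ]

end SpanningRepresentations

/-! ### The Wedderburn decomposition of the complex group algebra -/

/-- A Wedderburn decomposition `ℂ[Γ] ≃ ∏ᵢ M_{dᵢ}(ℂ)` of the group algebra. -/
structure WedderburnDecomposition (Γ : Type*) [Group Γ] where
  /-- the number of blocks -/
  numBlocks : ℕ
  /-- the sizes of the blocks -/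
  size : Fin numBlocks → ℕ
  size_ne_zero : ∀ i, size i ≠ 0
  /-- the isomorphism -/
  equiv : MonoidAlgebra ℂ Γ ≃ₐ[ℂ] (∀ i, Matrix (Fin (size i)) (Fin (size i)) ℂ)

namespace WedderburnDecomposition

theorem nonempty (Γ : Type*) [Group Γ] [Finite Γ] : Nonempty (WedderburnDecomposition Γ) := by
  have : NeZero (Nat.card Γ : ℂ) := ⟨by exact_mod_cast Nat.card_pos.ne'⟩
  obtain ⟨n, d, hd, ⟨e⟩⟩ :=
    IsSemisimpleRing.exists_algEquiv_pi_matrix_of_isAlgClosed ℂ (MonoidAlgebra ℂ Γ)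
  exact ⟨⟨n, d, fun i => (hd i).ne, e⟩⟩

variable {Γ : Type*} [Group Γ] (W : WedderburnDecomposition Γ)

/-- The matrix representation of `Γ` on the `i`-th block. -/
noncomputable def rep (i : Fin W.numBlocks) : Γ →* Matrix (Fin (W.size i)) (Fin (W.size i)) ℂ where
  toFun g := W.equiv (MonoidAlgebra.of ℂ Γ g) i
  map_one' := by simp [MonoidAlgebra.one_def.symm]
  map_mul' g h := by rw [map_mul, map_mul]; rfl

lemma rep_apply (i : Fin W.numBlocks) (g : Γ) :
    W.rep i g = W.equiv (MonoidAlgebra.of ℂ Γ g) i := rfl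

lemma span_range_equiv_of :
    Submodule.span ℂ (Set.range fun g => W.equiv (MonoidAlgebra.of ℂ Γ g)) = ⊤ := by
  have h : Submodule.span ℂ (Set.range (MonoidAlgebra.of ℂ Γ)) = ⊤ := by
    rw [eq_top_iff]
    rintro x -
    induction x using MonoidAlgebra.induction_on with
    | of g => exact Submodule.subset_span ⟨g, rfl⟩
    | add x y hx hy => exact Submodule.add_mem _ hx hy
    | smul c x hx => exact Submodule.smul_mem _ _ hx
  have h2 := congrArg (Submodule.map W.equiv.toLinearMap) h
  rw [Submodule.map_span, ← Set.range_comp, Submodule.map_top] at h2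
  rw [eq_top_iff]
  calc ⊤ ≤ LinearMap.range W.equiv.toLinearMap :=
        (LinearMap.range_eq_top.mpr W.equiv.surjective).ge
    _ = _ := h2.symm
    _ ≤ _ := le_rfl

lemma span_range_rep (i : Fin W.numBlocks) : Submodule.span ℂ (Set.range (W.rep i)) = ⊤ := by
  have h := congrArg (Submodule.map (LinearMap.proj (R := ℂ)
    (φ := fun i => Matrix (Fin (W.size i)) (Fin (W.size i)) ℂ) i)) W.span_range_equiv_of
  rw [Submodule.map_span, ← Set.range_comp, Submodule.map_top] at h
  rw [eq_top_iff]
  calc ⊤ ≤ _ := (LinearMap.range_eq_top.mpr (LinearMap.proj_surjective i)).ge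
    _ = _ := h.symm
    _ ≤ _ := le_rfl

/-- Schur's lemma for two different blocks. -/
lemma eq_zero_of_intertwines {i j : Fin W.numBlocks} (hij : i ≠ j)
    {X : Matrix (Fin (W.size j)) (Fin (W.size i)) ℂ}
    (hX : ∀ g, W.rep j g * X = X * W.rep i g) : X = 0 := by
  have h : ∀ y : ∀ i, Matrix (Fin (W.size i)) (Fin (W.size i)) ℂ, y j * X = X * y i := by
    intro y
    have hy : y ∈ Submodule.span ℂ (Set.range fun g => W.equiv (MonoidAlgebra.of ℂ Γ g)) := by
      rw [span_range_equiv_of]; trivial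
    induction hy using Submodule.span_induction with
    | mem x h => obtain ⟨g, rfl⟩ := h; exact hX g
    | zero => simp
    | add x y _ _ hx hy => rw [Pi.add_apply, Pi.add_apply, Matrix.add_mul, Matrix.mul_add, hx, hy]
    | smul a x _ hx => rw [Pi.smul_apply, Pi.smul_apply, smul_mul, Matrix.mul_smul, hx]
  have := h (Pi.single j 1)
  rwa [Pi.single_eq_same, Pi.single_eq_of_ne hij, Matrix.one_mul, Matrix.mul_zero] at this

section Finite
variable [Fintype Γ]

lemma sum_rep_mul_mul_rep_inv {i j : Fin W.numBlocks} (hij : i ≠ j)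
    (B : Matrix (Fin (W.size j)) (Fin (W.size i)) ℂ) :
    ∑ g, W.rep j g * B * W.rep i g⁻¹ = 0 := by
  refine W.eq_zero_of_intertwines hij fun h => ?_
  rw [Matrix.mul_sum, Matrix.sum_mul]
  refine Fintype.sum_equiv (Equiv.mulLeft h) _ _ fun g => ?_
  simp [Matrix.mul_assoc, map_mul, map_inv_mul_map_eq_one]

lemma sum_trace_inv_smul_rep_of_ne {i j : Fin W.numBlocks} (hij : i ≠ j) :
    ∑ g, (W.rep i g⁻¹).trace • W.rep j g = 0 := by
  ext a b
  simp only [Matrix.sum_apply, Matrix.smul_apply, smul_eq_mul, Matrix.trace, Matrix.diag,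
    Finset.sum_mul, Matrix.zero_apply]
  rw [Finset.sum_comm]
  refine Finset.sum_eq_zero fun k _ => ?_
  have h := congrFun (congrFun (W.sum_rep_mul_mul_rep_inv hij (Matrix.single b k 1)) a) k
  rw [Matrix.sum_apply, Matrix.zero_apply] at h
  rw [← h]
  refine Finset.sum_congr rfl fun g _ => ?_
  rw [Matrix.mul_assoc, Matrix.mul_apply, Finset.sum_eq_single b]
  · simp [mul_comm]
  · intro x _ hx
    rw [Matrix.single_mul_apply_of_ne]; simp; exact hx
  · simp

/-- The character of the regular representation. -/
lemma sum_size_mul_trace_rep [DecidableEq Γ] (g : Γ) :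
    ∑ i, (W.size i : ℂ) * (W.rep i g).trace = if g = 1 then (Fintype.card Γ : ℂ) else 0 := by
  -- The right side is the coefficient of `1 = ∑ᵢ eᵢ` in `ℂ[Γ]`, where the central idempotent `eᵢ`
  -- is `(dᵢ/|Γ|) ∑ₖ χᵢ(k⁻¹) k`.
  have hcard : (Fintype.card Γ : ℂ) ≠ 0 := by exact_mod_cast Fintype.card_ne_zero
  have hone : ∑ k, (∑ i, (W.size i : ℂ) * (W.rep i k⁻¹).trace) • MonoidAlgebra.of ℂ Γ k =
      (Fintype.card Γ : ℂ) • 1 := by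
    apply W.equiv.injective
    ext1 j
    rw [map_sum, map_smul, map_one, Finset.sum_apply]
    have h1 : ∀ k, W.equiv ((∑ i, (W.size i : ℂ) * (W.rep i k⁻¹).trace) • MonoidAlgebra.of ℂ Γ k) j =
        ∑ i, ((W.size i : ℂ) * (W.rep i k⁻¹).trace) • W.rep j k := by
      intro k
      rw [map_smul, Pi.smul_apply, ← rep_apply, Finset.sum_smul]
    simp only [h1, Pi.smul_apply, Pi.one_apply]
    rw [Finset.sum_comm, Finset.sum_eq_single j]
    · simp only [mul_smul]
      rw [← Finset.smul_sum, sum_trace_inv_smul (W.size_ne_zero j) _ (W.span_range_rep j), smul_smul,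
        mul_div_cancel₀]
      exact_mod_cast W.size_ne_zero j
    · intro i _ hij
      simp only [mul_smul]
      rw [← Finset.smul_sum, W.sum_trace_inv_smul_rep_of_ne hij, smul_zero]
    · simp
  have h := congrArg (fun x : MonoidAlgebra ℂ Γ => x.coeff g⁻¹) hone
  simp only [MonoidAlgebra.coeff_sum, MonoidAlgebra.coeff_smul, Finsupp.coe_finsetSum,
    Finset.sum_apply, Finsupp.smul_apply, MonoidAlgebra.of_apply, MonoidAlgebra.one_def,
    MonoidAlgebra.coeff_single, Finsupp.single_apply, smul_eq_mul, mul_ite, mul_one, mul_zero,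
    Finset.sum_ite_eq', Finset.mem_univ, if_true, inv_inv] at h
  rw [h]
  simp [eq_comm]

/-- Counting solutions of an equation in a group by means of characters. -/
lemma sum_size_mul_trace_sum {α : Type*} [Fintype α] (h : α → Γ) :
    ∑ i, (W.size i : ℂ) * (∑ a, W.rep i (h a)).trace =
      Fintype.card Γ * Nat.card {a // h a = 1} := by
  classical
  simp only [Matrix.trace_sum, Finset.mul_sum]
  rw [Finset.sum_comm]
  simp only [sum_size_mul_trace_rep]
  rw [Finset.sum_ite, Finset.sum_const_zero, add_zero, Finset.sum_const, nsmul_eq_mul, mul_comm,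
    Nat.card_eq_fintype_card, Fintype.card_subtype]

lemma sum_size_sq : ∑ i, (W.size i : ℝ) ^ 2 = Fintype.card Γ := by
  have h := W.sum_size_mul_trace_sum (fun _ : Unit => (1 : Γ))
  have h2 : ∑ i, (W.size i : ℂ) ^ 2 = Fintype.card Γ := by
    simpa [sq] using h
  exact_mod_cast h2

section Twist
variable {τ : Γ →* Γ} (hτ : ∀ i, ∑ z, W.rep i (z * τ z) =
    ((Fintype.card Γ : ℂ) / W.size i) • (1 : Matrix (Fin (W.size i)) (Fin (W.size i)) ℂ))
include hτ

/-- If all twisted Frobenius–Schur indicators are `1`, then the sum of the dimensions of the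
irreducible representations counts the twisted involutions. -/
lemma sum_size : ∑ i, (W.size i : ℝ) = Nat.card {z : Γ // z * τ z = 1} := by
  have hcard : (Fintype.card Γ : ℂ) ≠ 0 := by exact_mod_cast Fintype.card_ne_zero
  have h := W.sum_size_mul_trace_sum (fun z : Γ => z * τ z)
  have h2 : ∑ i, (W.size i : ℂ) = Nat.card {z : Γ // z * τ z = 1} := by
    apply mul_left_cancel₀ hcard
    rw [← h, Finset.mul_sum]
    refine Finset.sum_congr rfl fun i _ => ?_
    have : (W.size i : ℂ) ≠ 0 := by exact_mod_cast W.size_ne_zero i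
    rw [hτ, Matrix.trace_smul, Matrix.trace_one]
    simp
    field_simp
  exact_mod_cast h2

/-- If all twisted Frobenius–Schur indicators are `1`, then the sum of the inverse dimensions of
the irreducible representations counts the solutions of an equation. -/
lemma sum_inv_size : (Fintype.card Γ : ℝ) ^ 2 * ∑ i, (W.size i : ℝ)⁻¹ =
    Nat.card {p : (Γ × Γ) × Γ // p.1.1 * p.1.2⁻¹ * p.1.1⁻¹ * p.1.2 * (p.2 * τ p.2) = 1} := by
  have hcard : (Fintype.card Γ : ℂ) ≠ 0 := by exact_mod_cast Fintype.card_ne_zero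
  have h := W.sum_size_mul_trace_sum
    (fun p : (Γ × Γ) × Γ => p.1.1 * p.1.2⁻¹ * p.1.1⁻¹ * p.1.2 * (p.2 * τ p.2))
  have h2 : (Fintype.card Γ : ℂ) ^ 2 * ∑ i, (W.size i : ℂ)⁻¹ =
      Nat.card {p : (Γ × Γ) × Γ // p.1.1 * p.1.2⁻¹ * p.1.1⁻¹ * p.1.2 * (p.2 * τ p.2) = 1} := by
    apply mul_left_cancel₀ hcard
    rw [← h, Finset.mul_sum, Finset.mul_sum]
    refine Finset.sum_congr rfl fun i _ => ?_
    have hi : (W.size i : ℂ) ≠ 0 := by exact_mod_cast W.size_ne_zero i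
    simp only [Fintype.sum_prod_type, map_mul (W.rep i) (_ * _ * _ * _), ← Finset.mul_sum]
    simp only [hτ, ← Finset.sum_mul]
    rw [sum_commutator_eq_smul_one (W.size_ne_zero i) _ (W.span_range_rep i)]
    simp [Matrix.trace_smul]
    field_simp
  apply Complex.ofReal_injective
  push_cast
  exact h2

end Twist
end Finite

end WedderburnDecomposition

/-- A matrix representation, as a representation on `ℂⁿ`. -/
noncomputable def MonoidHom.toMatrixRep {Γ : Type*} [Group Γ] {n : ℕ}
    (ρ : Γ →* Matrix (Fin n) (Fin n) ℂ) : Representation ℂ Γ (Fin n → ℂ) :=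
  ((Matrix.toLinAlgEquiv' : Matrix (Fin n) (Fin n) ℂ ≃ₐ[ℂ] _) : _ →* _).comp ρ

lemma MonoidHom.toMatrixRep_apply {Γ : Type*} [Group Γ] {n : ℕ}
    (ρ : Γ →* Matrix (Fin n) (Fin n) ℂ) (g : Γ) (x : Fin n → ℂ) :
    ρ.toMatrixRep g x = ρ g *ᵥ x := rfl

/-- Burnside's criterion for irreducibility. -/
lemma MonoidHom.toMatrixRep_isIrreducible {Γ : Type*} [Group Γ] {n : ℕ} (hn : n ≠ 0)
    (ρ : Γ →* Matrix (Fin n) (Fin n) ℂ) (hρ : Submodule.span ℂ (Set.range ρ) = ⊤) :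
    ρ.toMatrixRep.IsIrreducible := by
  have hne : Nonempty (Fin n) := ⟨⟨0, Nat.pos_of_ne_zero hn⟩⟩
  have hnt : Nontrivial (Subrepresentation ρ.toMatrixRep) := by
    refine ⟨⊥, ⊤, fun h => ?_⟩
    have h1 : (fun _ => 1 : Fin n → ℂ) ∈ (⊥ : Subrepresentation ρ.toMatrixRep) := by
      rw [h]; trivial
    have h2 : (fun _ => 1 : Fin n → ℂ) = 0 := h1
    have := congrFun h2 hne.some
    simp at this
  refine { eq_bot_or_eq_top := fun U => ?_ }
  by_cases hU : ∀ x ∈ U.toSubmodule, x = 0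
  · left
    apply Subrepresentation.toSubmodule_injective
    exact (Submodule.eq_bot_iff _).mpr hU
  · right
    push Not at hU
    obtain ⟨x, hx, hx0⟩ := hU
    have hall : ∀ A : Matrix (Fin n) (Fin n) ℂ, A *ᵥ x ∈ U.toSubmodule := by
      intro A
      have hA : A ∈ Submodule.span ℂ (Set.range ρ) := by rw [hρ]; trivial
      induction hA using Submodule.span_induction with
      | mem y hy => obtain ⟨g, rfl⟩ := hy; exact U.apply_mem_toSubmodule g hx
      | zero => rw [Matrix.zero_mulVec]; exact Submodule.zero_mem _
      | add y z _ _ hy hz => rw [Matrix.add_mulVec]; exact Submodule.add_mem _ hy hz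
      | smul a y _ hy => rw [Matrix.smul_mulVec]; exact Submodule.smul_mem _ _ hy
    obtain ⟨i, hi⟩ : ∃ i, x i ≠ 0 := by
      by_contra! hcon; exact hx0 (funext hcon)
    apply Subrepresentation.toSubmodule_injective
    refine (Submodule.eq_top_iff'.mpr fun y => ?_)
    have := hall (Matrix.vecMulVec y (Pi.single i (x i)⁻¹))
    rw [Matrix.vecMulVec_mulVec] at this
    simpa [hi] using this

namespace WedderburnDecomposition
variable {Γ : Type*} [Group Γ] (W : WedderburnDecomposition Γ)

lemma rep_isIrreducible (i : Fin W.numBlocks) : (W.rep i).toMatrixRep.IsIrreducible :=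
  MonoidHom.toMatrixRep_isIrreducible (W.size_ne_zero i) _ (W.span_range_rep i)

lemma eq_of_equiv {i j : Fin W.numBlocks}
    (f : (W.rep i).toMatrixRep.Equiv (W.rep j).toMatrixRep) : i = j := by
  by_contra hij
  have hX : LinearMap.toMatrix'
      (f.toLinearEquiv : (Fin (W.size i) → ℂ) →ₗ[ℂ] (Fin (W.size j) → ℂ)) = 0 := by
    apply W.eq_zero_of_intertwines hij
    intro g
    apply Matrix.toLin'.injective
    rw [Matrix.toLin'_mul, Matrix.toLin'_mul, Matrix.toLin'_toMatrix']
    exact (f.toIntertwiningMap.isIntertwining' g).symm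
  have h0 : (f.toLinearEquiv : (Fin (W.size i) → ℂ) →ₗ[ℂ] (Fin (W.size j) → ℂ)) = 0 := by
    apply LinearMap.toMatrix'.injective
    rw [hX, map_zero]
  have hinj := f.toLinearEquiv.injective
    (a₁ := Pi.single ⟨0, Nat.pos_of_ne_zero (W.size_ne_zero i)⟩ (1 : ℂ)) (a₂ := 0)
    (by rw [map_zero]; exact LinearMap.congr_fun h0 _)
  have := congrFun hinj ⟨0, Nat.pos_of_ne_zero (W.size_ne_zero i)⟩
  simp at this

/-- Every irreducible representation occurs among the blocks. -/
theorem exists_equiv {V : Type*} [AddCommGroup V] [Module ℂ V] (σ : Representation ℂ Γ V)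
    (hσ : σ.IsIrreducible) : ∃ i, Nonempty ((W.rep i).toMatrixRep.Equiv σ) := by
  classical
  obtain ⟨φ, hφ⟩ : ∃ φ : (∀ i, Matrix (Fin (W.size i)) (Fin (W.size i)) ℂ) →ₐ[ℂ] Module.End ℂ V,
      ∀ g, φ (W.equiv (MonoidAlgebra.of ℂ Γ g)) = σ g :=
    ⟨σ.asAlgebraHom.comp W.equiv.symm.toAlgHom, fun g => by simp⟩
  obtain ⟨v, hv⟩ : ∃ v : V, v ≠ 0 := by
    by_contra! hcon
    have hnt : Nontrivial (Subrepresentation σ) := hσ.toNontrivial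
    obtain ⟨U, U', hUU⟩ := hnt
    apply hUU
    apply Subrepresentation.toSubmodule_injective
    ext x
    rw [hcon x]
    simp
  -- Some diagonal matrix unit does not kill `v`.
  obtain ⟨i, j, hij⟩ : ∃ i j, φ (Pi.single i (Matrix.single j j 1)) v ≠ 0 := by
    by_contra! hcon
    apply hv
    have h1 : (1 : ∀ i, Matrix (Fin (W.size i)) (Fin (W.size i)) ℂ) =
        ∑ i, ∑ j, Pi.single i (Matrix.single j j 1) := by
      have h2 : ∀ i, ∑ j, (Pi.single i (Matrix.single j j 1) :
          ∀ i, Matrix (Fin (W.size i)) (Fin (W.size i)) ℂ) = Pi.single i 1 := by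
        intro i
        rw [← Matrix.sum_single_one]
        exact (map_sum (AddMonoidHom.single
          (fun i => Matrix (Fin (W.size i)) (Fin (W.size i)) ℂ) i) _ _).symm
      simp only [h2]
      exact (Finset.univ_sum_single 1).symm
    have h3 := LinearMap.congr_fun (map_one φ) v
    rw [h1, map_sum, LinearMap.sum_apply] at h3
    rw [Module.End.one_apply] at h3
    rw [← h3]
    refine Finset.sum_eq_zero fun i _ => ?_
    rw [map_sum, LinearMap.sum_apply]
    exact Finset.sum_eq_zero fun j _ => hcon i j
  let f : (Fin (W.size i) → ℂ) →ₗ[ℂ] V :=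
    { toFun := fun x => φ (Pi.single i (Matrix.vecMulVec x (Pi.single j 1))) v
      map_add' := fun x y => by
        rw [Matrix.add_vecMulVec, Pi.single_add, map_add, LinearMap.add_apply]
      map_smul' := fun c x => by
        rw [Matrix.smul_vecMulVec, Pi.single_smul, map_smul, LinearMap.smul_apply]; rfl }
  have hf : ∀ g x, f ((W.rep i).toMatrixRep g x) = σ g (f x) := by
    intro g x
    change φ _ v = σ g (φ _ v)
    rw [← hφ, ← Module.End.mul_apply, ← map_mul]
    congr 2
    ext1 k
    by_cases hk : k = i
    · subst hk
      rw [Pi.mul_apply, Pi.single_eq_same, Pi.single_eq_same, MonoidHom.toMatrixRep_apply,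
        ← rep_apply, Matrix.mul_vecMulVec]
    · rw [Pi.mul_apply, Pi.single_eq_of_ne hk, Pi.single_eq_of_ne hk, Matrix.mul_zero]
  have := W.rep_isIrreducible i
  have hF := Representation.IsIrreducible.bijective_or_eq_zero
    (f.intertwiningMap_of_isIntertwiningMap _ _ hf)
  rcases hF with hF | hF
  · exact ⟨i, ⟨Representation.IntertwiningMap.ofBijective _ hF⟩⟩
  · exfalso
    apply hij
    have : f (Pi.single j 1) = 0 := congrArg (fun F => F (Pi.single j 1)) hF
    have h5 : Matrix.vecMulVec (Pi.single j 1) (Pi.single j 1) =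
        (Matrix.single j j 1 : Matrix (Fin (W.size i)) (Fin (W.size i)) ℂ) := by
      rw [Matrix.single_eq_single_vecMulVec_single]
    rw [← h5]
    exact this

end WedderburnDecomposition

/-! ### Finite chain rings -/

/-- `R` is a finite chain ring of length `r` with residue field of `q` elements and with `ϖ` as a
generator of its maximal ideal (the zero ring if `r = 0`). -/
structure IsChainRing (R : Type*) [CommRing R] (ϖ : R) (q r : ℕ) : Prop where
  exists_eq_pow_mul : ∀ x : R, ∃ j ≤ r, ∃ u : Rˣ, x = ϖ ^ j * u
  pow_eq_zero : ϖ ^ r = 0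
  card_dvd : ∀ j ≤ r, Nat.card {x : R // ϖ ^ j ∣ x} = q ^ (r - j)
  two_le : 2 ≤ q

namespace IsChainRing

variable {R : Type*} [CommRing R] {ϖ : R} {q r : ℕ} (h : IsChainRing R ϖ q r)

/-- The valuation of an element of a chain ring of length `r`; the valuation of `0` is `r`. -/
noncomputable def val (h : IsChainRing R ϖ q r) (x : R) : ℕ := (h.exists_eq_pow_mul x).choose

include h

lemma val_le (x : R) : h.val x ≤ r := (h.exists_eq_pow_mul x).choose_spec.1

lemma exists_eq_pow_val_mul (x : R) : ∃ u : Rˣ, x = ϖ ^ h.val x * u :=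
  (h.exists_eq_pow_mul x).choose_spec.2

lemma pow_dvd_iff {j : ℕ} (hj : j ≤ r) (x : R) : ϖ ^ j ∣ x ↔ j ≤ h.val x := by
  obtain ⟨u, hu⟩ := h.exists_eq_pow_val_mul x
  constructor
  · intro hx
    by_contra! hlt
    have h1 : ϖ ^ j ∣ ϖ ^ h.val x := by
      rw [hu] at hx
      exact (Units.dvd_mul_right).mp hx
    have h2 : ∀ y : R, ϖ ^ j ∣ y ↔ ϖ ^ h.val x ∣ y := fun y =>
      ⟨fun hy => (pow_dvd_pow ϖ hlt.le).trans hy, fun hy => h1.trans hy⟩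
    have h3 := h.card_dvd j hj
    rw [Nat.card_congr (Equiv.subtypeEquivRight h2), h.card_dvd _ (h.val_le x)] at h3
    have := Nat.pow_right_injective h.two_le h3
    have := h.val_le x
    omega
  · intro hx
    rw [hu]
    exact (pow_dvd_pow ϖ hx).mul_right _

lemma val_eq {j : ℕ} (hj : j ≤ r) (u : Rˣ) : h.val (ϖ ^ j * u) = j := by
  apply le_antisymm
  · obtain ⟨w, hw⟩ := h.exists_eq_pow_val_mul (ϖ ^ j * u)
    have : ϖ ^ h.val (ϖ ^ j * u) ∣ ϖ ^ j := by
      have : ϖ ^ h.val (ϖ ^ j * u) ∣ ϖ ^ j * u := ⟨w, hw⟩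
      exact (Units.dvd_mul_right).mp this
    by_contra! hlt
    have h2 : ∀ y : R, ϖ ^ j ∣ y ↔ ϖ ^ h.val (ϖ ^ j * u) ∣ y := fun y =>
      ⟨fun hy => this.trans hy, fun hy => (pow_dvd_pow ϖ hlt.le).trans hy⟩
    have h3 := h.card_dvd j hj
    rw [Nat.card_congr (Equiv.subtypeEquivRight h2), h.card_dvd _ (h.val_le _)] at h3
    have := Nat.pow_right_injective h.two_le h3
    have := h.val_le (ϖ ^ j * u)
    omega
  · rw [← h.pow_dvd_iff hj]
    exact dvd_mul_right _ _

lemma val_zero : h.val 0 = r := by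
  have := h.val_eq le_rfl 1
  rwa [h.pow_eq_zero, zero_mul] at this

lemma val_one : h.val 1 = 0 := by
  have := h.val_eq (Nat.zero_le r) 1
  simpa using this

lemma val_eq_r_iff (x : R) : h.val x = r ↔ x = 0 := by
  refine ⟨fun hx => ?_, fun hx => hx ▸ h.val_zero⟩
  obtain ⟨u, hu⟩ := h.exists_eq_pow_val_mul x
  rw [hu, hx, h.pow_eq_zero, zero_mul]

lemma val_eq_zero_iff (x : R) : h.val x = 0 ↔ IsUnit x := by
  constructor
  · intro hx
    obtain ⟨u, hu⟩ := h.exists_eq_pow_val_mul x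
    rw [hu, hx]; simp
  · rintro ⟨u, rfl⟩
    have := h.val_eq (Nat.zero_le r) u
    simpa using this

lemma val_mul (x y : R) : h.val (x * y) = min r (h.val x + h.val y) := by
  obtain ⟨u, hu⟩ := h.exists_eq_pow_val_mul x
  obtain ⟨w, hw⟩ := h.exists_eq_pow_val_mul y
  have hxy : x * y = ϖ ^ (h.val x + h.val y) * (u * w : Rˣ) := by
    conv_lhs => rw [hu, hw]
    push_cast; ring
  rcases le_total (h.val x + h.val y) r with hle | hle
  · rw [hxy, h.val_eq hle, min_eq_right hle]
  · rw [min_eq_left hle, h.val_eq_r_iff, hxy, pow_eq_zero_of_le hle h.pow_eq_zero, zero_mul]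

lemma val_pow (j : ℕ) : h.val (ϖ ^ j) = min r j := by
  rcases le_total j r with hle | hle
  · have := h.val_eq hle 1
    rw [Units.val_one, mul_one] at this
    omega
  · rw [pow_eq_zero_of_le hle h.pow_eq_zero, h.val_zero]
    omega

lemma le_val_add {j : ℕ} {x y : R} (hx : j ≤ h.val x) (hy : j ≤ h.val y) : j ≤ h.val (x + y) := by
  have hj := hx.trans (h.val_le x)
  rw [← h.pow_dvd_iff hj] at *
  exact dvd_add hx hy

lemma val_neg (x : R) : h.val (-x) = h.val x := by
  have := h.val_mul (-1) x
  rw [(h.val_eq_zero_iff (-1)).mpr isUnit_one.neg] at this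
  have h1 := h.val_le x
  rw [neg_one_mul] at this
  omega

lemma le_val_sub {j : ℕ} {x y : R} (hx : j ≤ h.val x) (hy : j ≤ h.val y) : j ≤ h.val (x - y) := by
  rw [sub_eq_add_neg]
  exact h.le_val_add hx (by rwa [h.val_neg])

lemma val_sub_comm (x y : R) : h.val (x - y) = h.val (y - x) := by
  rw [← neg_sub, h.val_neg]

lemma exists_eq_pow_mul_of_le {j : ℕ} {x : R} (hx : j ≤ h.val x) : ∃ y, x = ϖ ^ j * y :=
  (h.pow_dvd_iff (hx.trans (h.val_le x)) x).mpr hx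

lemma dvd_of_val_le {x y : R} (hxy : h.val x ≤ h.val y) : x ∣ y := by
  obtain ⟨u, hu⟩ := h.exists_eq_pow_val_mul x
  obtain ⟨w, hw⟩ := h.exists_eq_pow_mul_of_le hxy
  rw [hu, hw, Units.mul_right_dvd]
  exact dvd_mul_right _ _

section Card
open scoped Classical
variable [Fintype R]

lemma card_le_val {j : ℕ} (hj : j ≤ r) :
    (Finset.univ.filter fun x : R => j ≤ h.val x).card = q ^ (r - j) := by
  rw [← h.card_dvd j hj, Nat.card_eq_fintype_card, Fintype.card_subtype]
  congr 1
  ext x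
  simp [h.pow_dvd_iff hj]

lemma card_eq : Fintype.card R = q ^ r := by
  have := h.card_le_val (Nat.zero_le r)
  simpa using this

/-- The number of solutions of a linear congruence. -/
lemma card_linear_le {μ : ℕ} (hμ : μ ≤ r) (a b : R) :
    (Finset.univ.filter fun x : R => μ ≤ h.val (a * x - b)).card ≤
      q ^ (r - μ + min (h.val a) μ) := by
  by_cases hne : ∃ x0, μ ≤ h.val (a * x0 - b)
  · obtain ⟨x0, hx0⟩ := hne
    have h1 : r - μ + min (h.val a) μ = r - (μ - min (h.val a) μ) := by omega
    rw [h1, ← h.card_le_val (j := μ - min (h.val a) μ) (by omega)]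
    refine Finset.card_le_card_of_injOn (fun x => x - x0) ?_
      (fun x _ y _ hxy => by simpa using hxy)
    intro x hx
    simp only [Finset.coe_filter, Finset.mem_univ, true_and, Set.mem_ofPred_eq] at hx ⊢
    have h2 := h.le_val_sub hx hx0
    have h3 : a * x - b - (a * x0 - b) = a * (x - x0) := by ring
    rw [h3, h.val_mul] at h2
    omega
  · push Not at hne
    rw [Finset.filter_eq_empty_iff.mpr]
    · simp
    · intro x _ hx
      exact absurd hx (by have := hne x; omega)

/-- The number of square roots modulo `ϖ ^ f`. -/
lemma card_sq_le {f : ℕ} (hf : f ≤ r) (Δ : R) :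
    (Finset.univ.filter fun x : R => f ≤ h.val (x ^ 2 - Δ)).card ≤
      2 * q ^ (r - (f + 1) / 2) := by
  by_cases hne : ∃ x0, f ≤ h.val (x0 ^ 2 - Δ)
  · obtain ⟨x0, hx0⟩ := hne
    have h1 := h.card_le_val (j := (f + 1) / 2) (by omega)
    have hsub : (Finset.univ.filter fun x : R => f ≤ h.val (x ^ 2 - Δ)) ⊆
        ((Finset.univ.filter fun x : R => (f + 1) / 2 ≤ h.val x).image (fun x => x0 + x)) ∪
        ((Finset.univ.filter fun x : R => (f + 1) / 2 ≤ h.val x).image (fun x => -x0 + x)) := by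
      intro x hx
      simp only [Finset.mem_filter, Finset.mem_univ, true_and, Finset.mem_union,
        Finset.mem_image] at hx ⊢
      have h2 := h.le_val_sub hx hx0
      have h3 : x ^ 2 - Δ - (x0 ^ 2 - Δ) = (x - x0) * (x + x0) := by ring
      rw [h3, h.val_mul] at h2
      rcases le_or_gt ((f + 1) / 2) (h.val (x - x0)) with h4 | h4
      · left; exact ⟨x - x0, h4, by ring⟩
      · right; exact ⟨x + x0, by omega, by ring⟩
    refine (Finset.card_le_card hsub).trans ((Finset.card_union_le _ _).trans ?_)
    rw [two_mul, ← h1]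
    exact add_le_add Finset.card_image_le Finset.card_image_le
  · push Not at hne
    rw [Finset.filter_eq_empty_iff.mpr]
    · simp
    · intro x _ hx
      exact absurd hx (by have := hne x; omega)

/-- At least half of the elements are units. -/
lemma card_le_two_mul_card_units :
    q ^ r ≤ 2 * (Finset.univ.filter fun x : R => h.val x = 0).card := by
  have hq := h.two_le
  rcases Nat.eq_zero_or_pos r with hr | hr
  · subst hr
    rw [Finset.filter_true_of_mem, Finset.card_univ, h.card_eq]
    · omega
    · intro x _; have := h.val_le x; omega
  · have h1 := Finset.card_filter_add_card_filter_not (s := (Finset.univ : Finset R))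
      (fun x => h.val x = 0)
    have h2 : (Finset.univ.filter fun x : R => ¬ h.val x = 0).card = q ^ (r - 1) := by
      rw [← h.card_le_val hr]
      congr 1
      ext x
      simp
      omega
    rw [h2, Finset.card_univ, h.card_eq] at h1
    have h3 : q ^ r = q * q ^ (r - 1) := by
      rw [← pow_succ']; congr 1; omega
    have h4 : 2 * q ^ (r - 1) ≤ q * q ^ (r - 1) := Nat.mul_le_mul_right _ hq
    omega

end Card

end IsChainRing

/-! ### Isotypic projections for a finite abelian group -/

section IsotypicProjection

variable {A : Type*} [AddCommGroup A] [Fintype A] {M : Type*} [Ring M] [Algebra ℂ M]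

/-- The projection onto the `ψ`-isotypic part of a representation of a finite abelian group. -/
noncomputable def isotypicProj (π : Multiplicative A →* M) (ψ : AddChar A ℂ) : M :=
  (Fintype.card A : ℂ)⁻¹ • ∑ x : A, ψ (-x) • π (Multiplicative.ofAdd x)

variable (π : Multiplicative A →* M)

lemma map_mul_isotypicProj (ψ : AddChar A ℂ) (y : A) :
    π (Multiplicative.ofAdd y) * isotypicProj π ψ = ψ y • isotypicProj π ψ := by
  rw [isotypicProj, mul_smul_comm, smul_comm (ψ y)]
  congr 1
  rw [Finset.mul_sum, Finset.smul_sum]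
  refine Fintype.sum_equiv (Equiv.addLeft y) _ _ fun x => ?_
  rw [mul_smul_comm, ← map_mul, smul_smul, Equiv.coe_addLeft, neg_add, AddChar.map_add_eq_mul,
    ← mul_assoc, ← AddChar.map_add_eq_mul, add_neg_cancel, AddChar.map_zero_eq_one, one_mul]
  rfl

lemma isotypicProj_mul_map (ψ : AddChar A ℂ) (y : A) :
    isotypicProj π ψ * π (Multiplicative.ofAdd y) = ψ y • isotypicProj π ψ := by
  rw [← map_mul_isotypicProj, isotypicProj, mul_smul_comm, smul_mul_assoc]
  congr 1
  rw [Finset.mul_sum, Finset.sum_mul]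
  refine Finset.sum_congr rfl fun x _ => ?_
  rw [mul_smul_comm, smul_mul_assoc, ← map_mul π, ← map_mul π, mul_comm (Multiplicative.ofAdd x)]

lemma isotypicProj_mul_self (ψ : AddChar A ℂ) :
    isotypicProj π ψ * isotypicProj π ψ = isotypicProj π ψ := by
  conv_lhs => enter [1]; rw [isotypicProj]
  rw [smul_mul_assoc, Finset.sum_mul]
  have : ∀ x : A, ψ (-x) • π (Multiplicative.ofAdd x) * isotypicProj π ψ = isotypicProj π ψ := by
    intro x
    rw [smul_mul_assoc, map_mul_isotypicProj, smul_smul, ← AddChar.map_add_eq_mul, neg_add_cancel,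
      AddChar.map_zero_eq_one, one_smul]
  simp only [this]
  rw [Finset.sum_const, Finset.card_univ, ← Nat.cast_smul_eq_nsmul ℂ, smul_smul, inv_mul_cancel₀,
    one_smul]
  exact_mod_cast Fintype.card_ne_zero

lemma isotypicProj_mul_of_ne {ψ χ : AddChar A ℂ} (hne : ψ ≠ χ) :
    isotypicProj π ψ * isotypicProj π χ = 0 := by
  obtain ⟨y, hy⟩ : ∃ y, ψ y ≠ χ y := by
    by_contra! hcon
    exact hne (DFunLike.ext _ _ hcon)
  have h1 : isotypicProj π ψ * π (Multiplicative.ofAdd y) * isotypicProj π χ =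
      ψ y • (isotypicProj π ψ * isotypicProj π χ) := by
    rw [isotypicProj_mul_map, smul_mul_assoc]
  rw [mul_assoc, map_mul_isotypicProj, mul_smul_comm, eq_comm, ← sub_eq_zero, ← sub_smul] at h1
  exact (smul_eq_zero.mp h1).resolve_left (sub_ne_zero.mpr hy)

lemma sum_isotypicProj : ∑ ψ : AddChar A ℂ, isotypicProj π ψ = 1 := by
  classical
  simp only [isotypicProj]
  rw [← Finset.smul_sum, Finset.sum_comm]
  simp only [← Finset.sum_smul, AddChar.sum_apply_eq_ite, neg_eq_zero]
  rw [Finset.sum_eq_single 0]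
  · rw [if_pos rfl, smul_smul, inv_mul_cancel₀, one_smul, ofAdd_zero, map_one]
    exact_mod_cast Fintype.card_ne_zero
  · intro b _ hb
    rw [if_neg hb, zero_smul]
  · simp

lemma exists_isotypicProj_ne_zero {x : A} (hx : π (Multiplicative.ofAdd x) ≠ 1) :
    ∃ ψ : AddChar A ℂ, ψ x ≠ 1 ∧ isotypicProj π ψ ≠ 0 := by
  by_contra! hcon
  apply hx
  rw [← mul_one (π _)]
  conv_lhs => rw [← sum_isotypicProj π, Finset.mul_sum]
  conv_rhs => rw [← sum_isotypicProj π]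
  refine Finset.sum_congr rfl fun ψ _ => ?_
  rw [map_mul_isotypicProj]
  by_cases h : ψ x = 1
  · rw [h, one_smul]
  · rw [hcon ψ h, smul_zero]

end IsotypicProjection

/-- Nonzero orthogonal idempotent `n × n` matrices are at most `n` in number. -/
lemma card_le_of_orthogonal_idempotents {n : ℕ} {ι : Type*} [Fintype ι]
    (e : ι → Matrix (Fin n) (Fin n) ℂ) (h0 : ∀ i, e i ≠ 0) (hid : ∀ i, e i * e i = e i)
    (hort : ∀ i j, i ≠ j → e i * e j = 0) : Fintype.card ι ≤ n := by
  have hv : ∀ i, ∃ w, e i *ᵥ w ≠ 0 := by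
    intro i
    by_contra! hcon
    exact h0 i (Matrix.ext_of_mulVec_single fun i => by rw [hcon, Matrix.zero_mulVec])
  choose w hw using hv
  have hli : LinearIndependent ℂ fun i => e i *ᵥ w i := by
    rw [Fintype.linearIndependent_iff]
    intro g hg i
    have := congrArg (e i *ᵥ ·) hg
    simp only [Matrix.mulVec_sum, Matrix.mulVec_smul, Matrix.mulVec_mulVec, Matrix.mulVec_zero]
      at this
    rw [Finset.sum_eq_single i] at this
    · rw [hid] at this
      exact (smul_eq_zero.mp this).resolve_right (hw i)
    · intro j _ hj
      rw [hort i j hj.symm, Matrix.zero_mulVec, smul_zero]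
    · simp
  simpa using hli.fintype_card_le_finrank

/-! ### The group `SL₂` over a finite chain ring and its twisted Frobenius–Schur indicators -/

section SLTwo

variable {R : Type*} [CommRing R]

lemma sl_ext {g h : SL2 R} (h00 : g 0 0 = h 0 0) (h01 : g 0 1 = h 0 1) (h10 : g 1 0 = h 1 0)
    (h11 : g 1 1 = h 1 1) : g = h := by
  apply Subtype.ext
  ext i j
  fin_cases i <;> fin_cases j <;> assumption

lemma sl_mul_apply (g h : SL2 R) (i j : Fin 2) :
    (g * h) i j = g i 0 * h 0 j + g i 1 * h 1 j := by
  rw [Matrix.SpecialLinearGroup.coe_mul, Matrix.mul_apply, Fin.sum_univ_two]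

lemma sl_det (g : SL2 R) : g 0 0 * g 1 1 - g 0 1 * g 1 0 = 1 := by
  have := g.det_coe
  rwa [Matrix.det_fin_two] at this

/-- The element `(a, b; c, d)` of `SL₂`. -/
def slMk (a b c d : R) (h : a * d - b * c = 1) : SL2 R :=
  ⟨!![a, b; c, d], by rw [Matrix.det_fin_two_of, h]⟩

section
variable (a b c d : R) (h : a * d - b * c = 1)
lemma slMk_00 : slMk a b c d h 0 0 = a := rfl
lemma slMk_01 : slMk a b c d h 0 1 = b := rfl
lemma slMk_10 : slMk a b c d h 1 0 = c := rfl
lemma slMk_11 : slMk a b c d h 1 1 = d := rfl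
end

lemma sl_one_00 : (1 : SL2 R) 0 0 = 1 := rfl
lemma sl_one_01 : (1 : SL2 R) 0 1 = 0 := rfl
lemma sl_one_10 : (1 : SL2 R) 1 0 = 0 := rfl
lemma sl_one_11 : (1 : SL2 R) 1 1 = 1 := rfl

/-- The unipotent upper triangular matrices. -/
def slUpper : Multiplicative R →* SL2 R where
  toFun x := slMk 1 x.toAdd 0 1 (by ring)
  map_one' := by apply sl_ext <;> rfl
  map_mul' x y := by
    apply sl_ext <;> simp only [sl_mul_apply, slMk_00, slMk_01, slMk_10, slMk_11, toAdd_mul] <;> ring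

section
variable (x : R)
lemma slUpper_00 : slUpper (.ofAdd x) 0 0 = 1 := rfl
lemma slUpper_01 : slUpper (.ofAdd x) 0 1 = x := rfl
lemma slUpper_10 : slUpper (.ofAdd x) 1 0 = 0 := rfl
lemma slUpper_11 : slUpper (.ofAdd x) 1 1 = 1 := rfl
end

/-- The automorphism of `SL₂` given by conjugation with `diag(1, -1)`. -/
def slTwist : SL2 R →* SL2 R where
  toFun g := slMk (g 0 0) (-g 0 1) (-g 1 0) (g 1 1) (by linear_combination sl_det g)
  map_one' := by
    apply sl_ext <;> simp only [slMk_00, slMk_01, slMk_10, slMk_11, sl_one_00, sl_one_01,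
      sl_one_10, sl_one_11, neg_zero]
  map_mul' x y := by
    apply sl_ext <;> simp only [sl_mul_apply, slMk_00, slMk_01, slMk_10, slMk_11] <;> ring

section
variable (g : SL2 R)
lemma slTwist_00 : slTwist g 0 0 = g 0 0 := rfl
lemma slTwist_01 : slTwist g 0 1 = -g 0 1 := rfl
lemma slTwist_10 : slTwist g 1 0 = -g 1 0 := rfl
lemma slTwist_11 : slTwist g 1 1 = g 1 1 := rfl
end

lemma slTwist_slTwist (g : SL2 R) : slTwist (slTwist g) = g := by
  apply sl_ext <;> simp only [slTwist_00, slTwist_01, slTwist_10, slTwist_11, neg_neg]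

/-- The anti-automorphism `(a, b; c, d) ↦ (d, b; c, a)` is `g ↦ (slTwist g)⁻¹`. -/
lemma slTwist_inv (g : SL2 R) : (slTwist g)⁻¹ = slMk (g 1 1) (g 0 1) (g 1 0) (g 0 0)
    (by linear_combination sl_det g) := by
  rw [inv_eq_iff_mul_eq_one]
  have := sl_det g
  apply sl_ext <;> simp only [sl_mul_apply, slMk_00, slMk_01, slMk_10, slMk_11, slTwist_00,
    slTwist_01, slTwist_10, slTwist_11, sl_one_00, sl_one_01, sl_one_10, sl_one_11] <;>
    first | ring1 | linear_combination this

/-- The diagonal matrix `diag(u, u⁻¹)`. -/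
def slDiag (u : Rˣ) : SL2 R := slMk u 0 0 ((u⁻¹ : Rˣ) : R) (by simp)

section
variable (u : Rˣ)
lemma slDiag_00 : slDiag u 0 0 = u := rfl
lemma slDiag_01 : slDiag u 0 1 = 0 := rfl
lemma slDiag_10 : slDiag u 1 0 = 0 := rfl
lemma slDiag_11 : slDiag u 1 1 = ((u⁻¹ : Rˣ) : R) := rfl
end

lemma slDiag_mul_slUpper (u : Rˣ) (x : R) :
    slDiag u * slUpper (.ofAdd x) = slUpper (.ofAdd ((u : R) ^ 2 * x)) * slDiag u := by
  have hu := u.mul_inv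
  apply sl_ext <;> simp only [sl_mul_apply, slDiag_00, slDiag_01, slDiag_10, slDiag_11,
    slUpper_00, slUpper_01, slUpper_10, slUpper_11] <;>
    first | ring1 | linear_combination (-(u : R) * x) * hu

/-- If `c ∣ d - a`, then a unipotent matrix conjugates `(a, b; c, d)` to `(d, b; c, a)`. -/
lemma slUpper_mul_mul_slUpper {g : SL2 R} {x : R} (hx : g 1 1 - g 0 0 = g 1 0 * x) :
    slUpper (.ofAdd x) * g * slUpper (.ofAdd (-x)) = (slTwist g)⁻¹ := by
  rw [slTwist_inv]
  apply sl_ext <;> simp only [sl_mul_apply, slMk_00, slMk_01, slMk_10, slMk_11,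
    slUpper_00, slUpper_01, slUpper_10, slUpper_11]
  · linear_combination -hx
  · linear_combination x * hx
  · ring
  · linear_combination hx

/-- Unipotent matrices that fix `g` on both sides. -/
lemma slUpper_mul_mul_slUpper_eq_self {g : SL2 R} {y : R} (hy : y * g 1 0 = 0) :
    slUpper (.ofAdd (-(y * g 0 0 ^ 2))) * g * slUpper (.ofAdd y) = g := by
  have hd := sl_det g
  apply sl_ext <;> simp only [sl_mul_apply,
    slUpper_00, slUpper_01, slUpper_10, slUpper_11]
  · linear_combination (-g 0 0 ^ 2) * hy
  · linear_combination (-g 0 0 * y) * hd + (-g 0 0 * g 0 1 - g 0 0 ^ 2 * y) * hy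
  · ring
  · linear_combination hy

end SLTwo

section SLTwo

variable {R : Type*} [CommRing R]

/-- All spanning matrix representations of `SL₂(R)` have twisted Frobenius–Schur indicator `1`. -/
def HasTrivialTwistedIndicators (R : Type*) [CommRing R] [Fintype (SL2 R)] : Prop :=
  ∀ (n : ℕ) (ρ : SL2 R →* Matrix (Fin n) (Fin n) ℂ), n ≠ 0 →
    Submodule.span ℂ (Set.range ρ) = ⊤ →
    ∑ z, ρ (z * slTwist z) =
      ((Fintype.card (SL2 R) : ℂ) / n) • (1 : Matrix (Fin n) (Fin n) ℂ)

section Whittaker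
variable {n : ℕ} (ρ : SL2 R →* Matrix (Fin n) (Fin n) ℂ) [Fintype R]

local notation "proj" => isotypicProj (MonoidHom.comp ρ slUpper)

lemma map_slDiag_mul_proj (ψ : AddChar R ℂ) (u : Rˣ) :
    ρ (slDiag u) * proj (ψ.mulShift ((u : R) ^ 2)) = proj ψ * ρ (slDiag u) := by
  rw [isotypicProj, isotypicProj, mul_smul_comm, smul_mul_assoc, Finset.mul_sum, Finset.sum_mul]
  congr 1
  refine Fintype.sum_equiv (Units.mulLeft (u ^ 2)) _ _ fun x => ?_
  rw [mul_smul_comm, smul_mul_assoc, MonoidHom.comp_apply, MonoidHom.comp_apply, ← map_mul,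
    ← map_mul, slDiag_mul_slUpper, AddChar.mulShift_apply, Units.mulLeft_apply, mul_neg,
    Units.val_pow_eq_pow_val]

/-- The characters of the unipotent subgroup occurring in `ρ` are permuted by the squares of units,
by conjugation with diagonal matrices. -/
lemma proj_mulShift_ne_zero {ψ : AddChar R ℂ} (hψ : proj ψ ≠ 0) (u : Rˣ) :
    proj (ψ.mulShift ((u : R) ^ 2)) ≠ 0 := by
  intro h0
  have h := map_slDiag_mul_proj ρ ψ u
  rw [h0, mul_zero] at h
  apply hψ
  rw [← mul_one (proj ψ), ← map_mul_map_inv_eq_one ρ (slDiag u), ← mul_assoc, ← h, zero_mul]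

lemma proj_mul_map_mul_proj (ψ : AddChar R ℂ) (x y : R) (g : SL2 R) :
    proj ψ * ρ (slUpper (.ofAdd x) * g * slUpper (.ofAdd y)) * proj ψ =
      ψ (x + y) • (proj ψ * ρ g * proj ψ) := by
  have h1 := isotypicProj_mul_map (ρ.comp slUpper) ψ x
  have h2 := map_mul_isotypicProj (ρ.comp slUpper) ψ y
  rw [MonoidHom.comp_apply] at h1 h2
  rw [map_mul, map_mul, ← mul_assoc, ← mul_assoc, h1, mul_assoc, h2, AddChar.map_add_eq_mul,
    mul_smul_comm, smul_mul_assoc, smul_mul_assoc, smul_smul, mul_comm]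

/-- The Gelfand–Kazhdan argument: the corner of `ρ` cut out by a primitive character of the
unipotent subgroup does not see the anti-automorphism `(a, b; c, d) ↦ (d, b; c, a)`. -/
lemma proj_mul_map_twist_inv_mul_proj {ϖ : R} {q r : ℕ} (h : IsChainRing R ϖ q r)
    {ψ : AddChar R ℂ} {x0 : R} (hx0 : r ≤ h.val x0 + 1) (hψ : ψ x0 ≠ 1) (g : SL2 R) :
    proj ψ * ρ (slTwist g)⁻¹ * proj ψ = proj ψ * ρ g * proj ψ := by
  by_cases hc : g 1 0 ∣ g 1 1 - g 0 0
  · obtain ⟨x, hx⟩ := hc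
    rw [← slUpper_mul_mul_slUpper hx, proj_mul_map_mul_proj, add_neg_cancel,
      AddChar.map_zero_eq_one, one_smul]
  · -- A unipotent pair stabilises `g` but acts through a nontrivial scalar, so both sides vanish.
    have hzero : ∀ (k : SL2 R) (y : R), y * k 1 0 = 0 → ψ (y - y * k 0 0 ^ 2) ≠ 1 →
        proj ψ * ρ k * proj ψ = 0 := by
      intro k y hy hne
      have h1 := proj_mul_map_mul_proj ρ ψ (-(y * k 0 0 ^ 2)) y k
      rw [slUpper_mul_mul_slUpper_eq_self hy, neg_add_eq_sub] at h1
      have h2 : (ψ (y - y * k 0 0 ^ 2) - 1) • (proj ψ * ρ k * proj ψ) = 0 := by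
        rw [sub_smul, one_smul, ← h1, sub_self]
      exact (smul_eq_zero.mp h2).resolve_left (sub_ne_zero.mpr hne)
    have hdet := sl_det g
    have hlt : h.val (g 1 1 - g 0 0) < h.val (g 1 0) := by
      by_contra! hle
      exact hc (h.dvd_of_val_le hle)
    have hcr := h.val_le (g 1 0)
    have ha : h.val (g 0 0) = 0 := by
      have h1 : h.val (g 0 0 * g 1 1) = 0 := by
        by_contra hne
        have h2 := h.le_val_sub (j := 1) (x := g 0 0 * g 1 1) (y := g 0 1 * g 1 0) (by omega)
          (by rw [h.val_mul]; omega)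
        rw [hdet, h.val_one] at h2
        omega
      rw [h.val_mul] at h1
      omega
    -- An element of the annihilator of `c` that is mapped to `x0`.
    obtain ⟨y, hy1, hy2⟩ : ∃ y, y * g 1 0 = 0 ∧ y * (g 0 0 * (g 1 1 - g 0 0)) = x0 := by
      obtain ⟨a, ha'⟩ := (h.val_eq_zero_iff _).mp ha
      obtain ⟨D, hD⟩ : ∃ D, D = g 1 1 - g 0 0 := ⟨_, rfl⟩
      rw [← hD] at hlt ⊢
      obtain ⟨v, hv⟩ := h.exists_eq_pow_val_mul D
      obtain ⟨z, hz⟩ := h.exists_eq_pow_mul_of_le (x := x0) (j := r - 1) (by omega)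
      refine ⟨ϖ ^ (r - 1 - h.val D) * z * (a⁻¹ : Rˣ) * (v⁻¹ : Rˣ), ?_, ?_⟩
      · rw [← h.val_eq_r_iff, h.val_mul, h.val_mul, h.val_mul, h.val_mul, h.val_pow]
        omega
      · rw [← ha', hz]
        have h3 : ϖ ^ (r - 1) = ϖ ^ (r - 1 - h.val D) * ϖ ^ h.val D := by
          rw [← pow_add]; congr 1; omega
        rw [h3]
        generalize ϖ ^ (r - 1 - h.val D) = P
        generalize ϖ ^ h.val D = Q at hv
        rw [hv]
        have h4 := a.inv_mul
        have h5 := v.inv_mul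
        linear_combination (P * Q * z) * ((v⁻¹ : Rˣ) * v * h4 + h5)
    have hyad : y * (g 0 0 * g 1 1) = y := by linear_combination y * hdet + g 0 1 * hy1
    rw [hzero g y hy1, hzero _ (-(y * g 0 0 ^ 2))]
    · rw [slTwist_inv, slMk_10]
      linear_combination -(g 0 0 ^ 2) * hy1
    · rw [slTwist_inv, slMk_00]
      convert hψ using 2
      rw [← hy2]
      linear_combination (g 0 0 * g 1 1 + 1) * hyad - hyad
    · convert hψ using 2
      rw [← hy2]
      linear_combination - hyad

variable [Fintype (SL2 R)] (hn : n ≠ 0) (hρ : Submodule.span ℂ (Set.range ρ) = ⊤)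
  {ϖ : R} {q r : ℕ} (h : IsChainRing R ϖ q r) {x0 : R} (hx0 : r ≤ h.val x0 + 1)
  (hne : ρ (slUpper (.ofAdd x0)) ≠ 1)

include hn hρ hx0 hne in
/-- A representation that is nontrivial on the last step of the filtration of the unipotent
subgroup has twisted Frobenius–Schur indicator `1`. -/
theorem sum_map_mul_slTwist_of_ne_one :
    ∑ z, ρ (z * slTwist z) =
      ((Fintype.card (SL2 R) : ℂ) / n) • (1 : Matrix (Fin n) (Fin n) ℂ) := by
  obtain ⟨ψ, hψ, hψ0⟩ := exists_isotypicProj_ne_zero (ρ.comp slUpper) hne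
  exact sum_map_mul_twist hn ρ hρ slTwist slTwist_slTwist _ (isotypicProj_mul_self _ ψ) hψ0
    (proj_mul_map_twist_inv_mul_proj ρ h hx0 hψ)

omit [Fintype (SL2 R)] in
include hx0 hne in
open scoped Classical in
/-- A representation that is nontrivial on the last step of the filtration of the unipotent
subgroup is large: a character of the unipotent subgroup occurs with all its conjugates. -/
theorem card_le_mul_dim_of_ne_one : q ^ r ≤ 4 * n * q ^ (r - (r + 1) / 2) := by
  obtain ⟨ψ, hψ, hψ0⟩ := exists_isotypicProj_ne_zero (ρ.comp slUpper) hne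
  obtain ⟨U, hU⟩ : ∃ U, U = Finset.univ.filter fun x : R => h.val x = 0 := ⟨_, rfl⟩
  obtain ⟨S, hS⟩ : ∃ S, S = U.image (· ^ 2) := ⟨_, rfl⟩
  have h1 : U.card ≤ 2 * q ^ (r - (r + 1) / 2) * S.card := by
    refine Finset.card_le_mul_card_image_of_maps_to (f := (· ^ 2)) (fun x hx => ?_) _ ?_
    · rw [hS]; exact Finset.mem_image_of_mem _ hx
    · intro b _
      refine le_trans (Finset.card_le_card ?_) (h.card_sq_le le_rfl b)
      intro x hx
      simp only [Finset.mem_filter, Finset.mem_univ, true_and] at hx ⊢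
      rw [hx.2, sub_self, h.val_zero]
  have h2 : S.card ≤ n := by
    have := card_le_of_orthogonal_idempotents (ι := S) (fun a => proj (ψ.mulShift (a : R)))
      (by
        rintro ⟨a, ha⟩
        rw [hS, Finset.mem_image] at ha
        obtain ⟨u, hu, rfl⟩ := ha
        rw [hU, Finset.mem_filter, h.val_eq_zero_iff] at hu
        obtain ⟨u, rfl⟩ := hu.2
        exact proj_mulShift_ne_zero ρ hψ0 u)
      (fun a => isotypicProj_mul_self _ _)
      (by
        rintro ⟨a, ha⟩ ⟨b, hb⟩ hab
        apply isotypicProj_mul_of_ne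
        intro heq
        have hab' : a - b ≠ 0 := sub_ne_zero.mpr fun h => hab (Subtype.ext h)
        have hlt : h.val (a - b) ≠ r := fun h' => hab' ((h.val_eq_r_iff _).mp h')
        have hle := h.val_le (a - b)
        obtain ⟨w, hw⟩ := h.dvd_of_val_le (x := a - b) (y := x0) (by omega)
        apply hψ
        have h3 := DFunLike.congr_fun heq w
        rw [AddChar.mulShift_apply, AddChar.mulShift_apply] at h3
        rw [hw, sub_mul, AddChar.map_sub_eq_div, h3, div_self]
        exact (ψ.val_isUnit (b * w)).ne_zero)
    simpa using this
  have h3 := h.card_le_two_mul_card_units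
  rw [← hU] at h3
  calc q ^ r ≤ 2 * U.card := h3
    _ ≤ 2 * (2 * q ^ (r - (r + 1) / 2) * n) := by gcongr; exact h1.trans (by gcongr)
    _ = _ := by ring

end Whittaker

/-- The unipotent elements of the congruence subgroup of level `j` generate it as a normal
subgroup. -/
lemma mem_of_slUpper_mem {ϖ : R} {q r : ℕ} (h : IsChainRing R ϖ q r) (N : Subgroup (SL2 R))
    [N.Normal] {j : ℕ} (hN : ∀ x, j ≤ h.val x → slUpper (.ofAdd x) ∈ N) (g : SL2 R)
    (h00 : j ≤ h.val (g 0 0 - 1)) (h01 : j ≤ h.val (g 0 1)) (h10 : j ≤ h.val (g 1 0)) :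
    g ∈ N := by
  obtain ⟨lower, hlower⟩ : ∃ lower : R → SL2 R, ∀ x, lower x = slMk 1 0 x 1 (by ring) :=
    ⟨_, fun _ => rfl⟩
  have hlow : ∀ x, j ≤ h.val x → lower x ∈ N := by
    intro x hx
    have h1 := ‹N.Normal›.conj_mem _ (hN (-x) (by rwa [h.val_neg])) (slMk 0 1 (-1) 0 (by ring))
    convert h1 using 1
    rw [eq_mul_inv_iff_mul_eq, hlower]
    apply sl_ext <;> simp only [sl_mul_apply, slMk_00, slMk_01, slMk_10, slMk_11,
      slUpper_00, slUpper_01, slUpper_10, slUpper_11] <;> ring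
  -- A diagonal matrix is a product of unipotents and a conjugate of a unipotent.
  have hdiag : ∀ u : Rˣ, j ≤ h.val ((u : R) - 1) → slDiag u ∈ N := by
    intro u hu
    obtain ⟨y, hy⟩ : ∃ y, y = 1 - (u : R) := ⟨_, rfl⟩
    have hjy : j ≤ h.val y := by rwa [hy, h.val_sub_comm]
    have h1 := ‹N.Normal›.conj_mem _ (hN y hjy) (lower 1)
    have hmul : ∀ w : R, j ≤ h.val (w * y) := fun w => by
      rw [h.val_mul]; have := h.val_le y; omega
    have h2 := N.mul_mem (N.mul_mem (hlow ((u⁻¹ : Rˣ) * y) (hmul _)) h1)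
      (hN (-(u⁻¹ : Rˣ) * y) (hmul _))
    convert h2 using 1
    have h3 : lower 1 * slUpper (.ofAdd y) * (lower 1)⁻¹ = slMk (1 - y) y (-y) (1 + y)
        (by ring) := by
      rw [mul_inv_eq_iff_eq_mul, hlower]
      apply sl_ext <;> simp only [sl_mul_apply, slMk_00, slMk_01, slMk_10, slMk_11,
        slUpper_00, slUpper_01, slUpper_10, slUpper_11] <;> ring
    have hu := u.mul_inv
    rw [h3, hlower]
    apply sl_ext <;> simp only [sl_mul_apply, slMk_00, slMk_01, slMk_10, slMk_11,
      slUpper_00, slUpper_01, slUpper_10, slUpper_11, slDiag_00, slDiag_01, slDiag_10,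
      slDiag_11] <;> subst hy
    · ring
    · linear_combination (1 - (u : R)) * hu
    · linear_combination (-(1 - (u : R))) * hu
    · linear_combination ((u⁻¹ : Rˣ) * (1 - (u : R)) ^ 2 + 2 - u) * hu
  -- The factorization of the big cell into lower unipotent, diagonal and upper unipotent parts.
  have hunit : ∀ g : SL2 R, j ≤ h.val (g 0 0 - 1) → j ≤ h.val (g 0 1) → j ≤ h.val (g 1 0) →
      h.val (g 0 0) = 0 → g ∈ N := by
    intro g h00 h01 h10 hu
    obtain ⟨u, hu⟩ := (h.val_eq_zero_iff _).mp hu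
    have hmul : ∀ w x : R, j ≤ h.val x → j ≤ h.val (x * w) := fun w x hx => by
      rw [h.val_mul]; have := h.val_le x; omega
    have h2 := N.mul_mem (N.mul_mem (hlow _ (hmul (u⁻¹ : Rˣ) _ h10)) (hdiag u (by rwa [hu])))
      (hN _ (hmul (u⁻¹ : Rˣ) _ h01))
    convert h2 using 1
    have hu' := u.mul_inv
    have hdet := sl_det g
    rw [← hu] at hdet
    rw [hlower]
    apply sl_ext <;> simp only [sl_mul_apply, slMk_00, slMk_01, slMk_10, slMk_11,
      slUpper_00, slUpper_01, slUpper_10, slUpper_11, slDiag_00, slDiag_01, slDiag_10,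
      slDiag_11, ← hu]
    · ring
    · linear_combination (-g 0 1) * hu'
    · linear_combination (-g 1 0) * hu'
    · linear_combination (-g 1 1 - (u⁻¹ : Rˣ) * g 0 1 * g 1 0) * hu' + (u⁻¹ : Rˣ) * hdet
  by_cases hu : h.val (g 0 0) = 0
  · exact hunit g h00 h01 h10 hu
  · -- If `g₀₀` is not a unit, then `g₀₀ - 1` is, and `j = 0`.
    have hj : j = 0 := by
      by_contra hj
      have := h.le_val_sub (j := 1) (x := g 0 0) (y := g 0 0 - 1) (by omega) (by omega)
      rw [sub_sub_cancel, h.val_one] at this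
      omega
    subst hj
    have h1 : slUpper (.ofAdd (1 : R)) * g ∈ N := by
      apply hunit _ (by omega) (by omega) (by omega)
      rw [sl_mul_apply, slUpper_00, slUpper_01, one_mul, one_mul]
      by_contra hne
      have hc : 1 ≤ h.val (g 1 0) := by
        have := h.le_val_sub (j := 1) (x := g 0 0 + g 1 0) (y := g 0 0) (by omega) (by omega)
        rwa [add_sub_cancel_left] at this
      have h2 := h.le_val_sub (j := 1) (x := g 0 0 * g 1 1) (y := g 0 1 * g 1 0)
        (by rw [h.val_mul]; have := h.val_le (g 0 0); omega)
        (by rw [h.val_mul]; have := h.val_le (g 0 0); omega)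
      rw [sl_det, h.val_one] at h2
      omega
    exact (N.mul_mem_cancel_left (hN 1 (by omega))).mp h1

/-- A representation that factors through a smaller quotient inherits its indicator from there. -/
lemma sum_map_mul_slTwist_of_factor {R' : Type*} [CommRing R'] [Fintype (SL2 R)] [Fintype (SL2 R')]
    (f : R →+* R') (hf : Function.Surjective (Matrix.SpecialLinearGroup.map (n := Fin 2) f))
    (hR' : HasTrivialTwistedIndicators R') {n : ℕ} (hn : n ≠ 0)
    (ρ : SL2 R →* Matrix (Fin n) (Fin n) ℂ) (hρ : Submodule.span ℂ (Set.range ρ) = ⊤)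
    (hker : (Matrix.SpecialLinearGroup.map (n := Fin 2) f).ker ≤ ρ.ker) :
    ∑ z, ρ (z * slTwist z) =
      ((Fintype.card (SL2 R) : ℂ) / n) • (1 : Matrix (Fin n) (Fin n) ℂ) := by
  classical
  obtain ⟨F, hF⟩ : ∃ F, F = Matrix.SpecialLinearGroup.map (n := Fin 2) f := ⟨_, rfl⟩
  rw [← hF] at hf hker
  obtain ⟨ρ', hρ'⟩ : ∃ ρ' : SL2 R' →* Matrix (Fin n) (Fin n) ℂ, ∀ g, ρ' (F g) = ρ g := by
    refine ⟨(QuotientGroup.lift F.ker ρ hker).comp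
      (QuotientGroup.quotientKerEquivOfSurjective F hf).symm.toMonoidHom, fun g => ?_⟩
    have : (QuotientGroup.quotientKerEquivOfSurjective F hf).symm (F g) = QuotientGroup.mk g := by
      rw [MulEquiv.symm_apply_eq]; rfl
    simp only [MonoidHom.comp_apply, MulEquiv.toMonoidHom_eq_coe, MonoidHom.coe_coe]
    rw [this]
    rfl
  have hspan : Submodule.span ℂ (Set.range ρ') = ⊤ := by
    rw [← hρ]
    congr 1
    ext M
    constructor
    · rintro ⟨g, rfl⟩
      obtain ⟨g, rfl⟩ := hf g
      exact ⟨g, (hρ' g).symm⟩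
    · rintro ⟨g, rfl⟩
      exact ⟨F g, hρ' g⟩
  have htw : ∀ z, F (z * slTwist z) = F z * slTwist (F z) := by
    intro z
    rw [map_mul]
    congr 1
    rw [hF]
    apply sl_ext <;> simp [slTwist_00, slTwist_01, slTwist_10, slTwist_11,
      Matrix.SpecialLinearGroup.map_apply_coe]
  have hsum := hR' n ρ' hn hspan
  have hfib : ∀ y, (Finset.univ.filter fun z => F z = y).card =
      (Finset.univ.filter fun z => F z = 1).card := by
    intro y
    obtain ⟨x, rfl⟩ := hf y
    refine Finset.card_bij (fun z _ => x⁻¹ * z) ?_ ?_ ?_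
    · intro z hz; simp at hz ⊢; rw [hz]; simp
    · intro z _ w _ h; simpa using h
    · intro z hz; refine ⟨x * z, ?_, by simp⟩; simp at hz ⊢; exact hz
  have h1 : ∀ φ : SL2 R' → Matrix (Fin n) (Fin n) ℂ, ∑ z, φ (F z) =
      (Finset.univ.filter fun z => F z = 1).card • ∑ y, φ y := by
    intro φ
    rw [← Finset.sum_fiberwise_of_maps_to (s := Finset.univ) (t := Finset.univ) (g := F)
      (fun _ _ => Finset.mem_univ _), Finset.smul_sum]
    refine Finset.sum_congr rfl fun y _ => ?_
    rw [Finset.sum_congr rfl (g := fun _ => φ y), Finset.sum_const, hfib]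
    intro x hx
    rw [(Finset.mem_filter.mp hx).2]
  have h2 : Fintype.card (SL2 R) =
      (Finset.univ.filter fun z => F z = 1).card * Fintype.card (SL2 R') := by
    have h := Finset.card_eq_sum_card_fiberwise (s := Finset.univ) (t := Finset.univ) (f := F)
      (fun _ _ => Finset.mem_univ _)
    rw [Finset.card_univ] at h
    rw [h, Finset.sum_congr rfl (fun y _ => hfib y)]
    simp [mul_comm]
  have h3 : ∀ z, ρ (z * slTwist z) = ρ' (F z * slTwist (F z)) := by
    intro z; rw [← htw, hρ']
  simp only [h3]
  rw [h1 (fun y => ρ' (y * slTwist y)), hsum, h2, ← Nat.cast_smul_eq_nsmul ℂ, smul_smul]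
  push_cast
  congr 1
  ring

end SLTwo

/-! ### Counting points on binary quadratic forms over chain rings -/

namespace IsChainRing

section QuadraticCount
open scoped Classical

variable {R : Type*} [CommRing R] [Fintype R] {ϖ : R} {q r : ℕ} (h : IsChainRing R ϖ q r)

omit [Fintype R] in
lemma pow_le_pow_q (h : IsChainRing R ϖ q r) {a b : ℕ} (hab : a ≤ b) : q ^ a ≤ q ^ b :=
  Nat.pow_le_pow_right (by have := h.two_le; omega) hab

/-- The number of solutions of `x² + Txs + Δs² ≡ 1` modulo `ϖ ^ μ`. -/
noncomputable def normCount (h : IsChainRing R ϖ q r) (T Δ : R) (μ : ℕ) : ℕ :=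
  (Finset.univ.filter fun p : R × R =>
    μ ≤ h.val (p.1 ^ 2 + T * p.1 * p.2 + Δ * p.2 ^ 2 - 1)).card

variable {e0 : ℕ} (h2 : (2 : R) = 0 ∨ h.val 2 ≤ e0)
include h2

/-- The number of double roots `u` of `X² - TX + D` modulo `ϖ ^ f`. For `f ≤ v(T)` it is bounded by
the number of square roots of `D`; for `f > v(T)` the congruence `2u ≡ T` forces `v(2) ≤ v(T) < r`,
and then it has few solutions since `v(2) ≤ e0`. -/
lemma pow_mul_card_double_root_le {f : ℕ} (hf : f ≤ r) (T D : R) :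
    q ^ f * (Finset.univ.filter fun u : R =>
      f ≤ h.val (T - 2 * u) ∧ f ≤ h.val (u ^ 2 - D)).card ≤ 2 * q ^ (r + e0 + h.val T / 2) := by
  rcases le_or_gt f (h.val T) with hfT | hfT
  · calc _ ≤ q ^ f * (2 * q ^ (r - (f + 1) / 2)) := by
          gcongr
          refine le_trans (Finset.card_le_card ?_) (h.card_sq_le hf D)
          intro u hu
          simp only [Finset.mem_filter, Finset.mem_univ, true_and] at hu ⊢
          exact hu.2
      _ = 2 * q ^ (f + (r - (f + 1) / 2)) := by rw [pow_add]; ring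
      _ ≤ _ := by
          gcongr 2 * ?_
          exact h.pow_le_pow_q (by omega)
  · by_cases hne : ∃ u0, f ≤ h.val (T - 2 * u0)
    · obtain ⟨u0, hu0⟩ := hne
      have hval : h.val (2 * u0) ≤ h.val T := by
        by_contra! hlt
        have := h.le_val_add (j := h.val T + 1) (x := T - 2 * u0) (y := 2 * u0) (by omega) hlt
        rw [sub_add_cancel] at this
        omega
      have h2' : h.val 2 ≤ e0 := by
        refine h2.resolve_left fun h0 => ?_
        rw [h0, zero_mul, h.val_zero] at hval
        omega
      calc _ ≤ q ^ f * q ^ (r - f + min (h.val 2) f) := by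
            gcongr
            refine le_trans (Finset.card_le_card ?_) (h.card_linear_le hf 2 T)
            intro u hu
            simp only [Finset.mem_filter, Finset.mem_univ, true_and] at hu ⊢
            rw [h.val_sub_comm]
            exact hu.1
        _ = q ^ (f + (r - f + min (h.val 2) f)) := (pow_add _ _ _).symm
        _ ≤ q ^ (r + e0 + h.val T / 2) := h.pow_le_pow_q (by omega)
        _ ≤ _ := by omega
    · push Not at hne
      rw [Finset.filter_eq_empty_iff.mpr]
      · simp
      · intro u _ hu
        exact absurd hu.1 (by have := hne u; omega)

/-- The number of solutions `(u, x)` of `(T - 2u)x ≡ u² - D` modulo `ϖ ^ μ`. For fixed `u` the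
congruence is linear in `x`; with `f = min (v(T - 2u), μ)` its solvability makes `u` a double root
of `X² - TX + D` modulo `ϖ ^ f`. -/
lemma pow_mul_card_linearized_le {μ : ℕ} (hμ : μ ≤ r) (T D : R) :
    q ^ μ * (Finset.univ.filter fun p : R × R =>
      μ ≤ h.val ((T - 2 * p.1) * p.2 - (p.1 ^ 2 - D))).card ≤
        2 * (r + 1) * q ^ (2 * r + e0 + h.val T / 2) := by
  have h1 : (Finset.univ.filter fun p : R × R =>
      μ ≤ h.val ((T - 2 * p.1) * p.2 - (p.1 ^ 2 - D))).card =
      ∑ u : R, (Finset.univ.filter fun x : R =>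
        μ ≤ h.val ((T - 2 * u) * x - (u ^ 2 - D))).card := by
    simp only [Finset.card_filter]
    rw [Fintype.sum_prod_type]
  have h3 : ∀ u : R, (Finset.univ.filter fun x : R =>
        μ ≤ h.val ((T - 2 * u) * x - (u ^ 2 - D))).card ≤
      ∑ f ∈ Finset.range (μ + 1), if f ≤ h.val (T - 2 * u) ∧ f ≤ h.val (u ^ 2 - D) then
        q ^ (r - μ + f) else 0 := by
    intro u
    by_cases hne : ∃ x0, μ ≤ h.val ((T - 2 * u) * x0 - (u ^ 2 - D))
    · obtain ⟨x0, hx0⟩ := hne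
      refine (h.card_linear_le hμ _ _).trans ?_
      have hf : min (h.val (T - 2 * u)) μ ∈ Finset.range (μ + 1) := by
        rw [Finset.mem_range]; omega
      refine le_trans ?_ (Finset.single_le_sum (f := fun f =>
        if f ≤ h.val (T - 2 * u) ∧ f ≤ h.val (u ^ 2 - D) then q ^ (r - μ + f) else 0)
        (fun _ _ => Nat.zero_le _) hf)
      rw [if_pos]
      refine ⟨min_le_left _ _, ?_⟩
      have := h.le_val_sub (j := min (h.val (T - 2 * u)) μ) (x := (T - 2 * u) * x0)
        (y := (T - 2 * u) * x0 - (u ^ 2 - D)) (by rw [h.val_mul]; omega) (by omega)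
      rwa [sub_sub_cancel] at this
    · push Not at hne
      rw [Finset.filter_eq_empty_iff.mpr]
      · simp
      · intro u _ hu
        exact absurd hu (by have := hne u; omega)
  calc _ ≤ q ^ μ * ∑ u : R, ∑ f ∈ Finset.range (μ + 1),
        (if f ≤ h.val (T - 2 * u) ∧ f ≤ h.val (u ^ 2 - D) then q ^ (r - μ + f) else 0) := by
        rw [h1]
        gcongr with u
        exact h3 u
    _ = ∑ f ∈ Finset.range (μ + 1), q ^ r * (q ^ f * (Finset.univ.filter fun u : R =>
          f ≤ h.val (T - 2 * u) ∧ f ≤ h.val (u ^ 2 - D)).card) := by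
        rw [Finset.sum_comm, Finset.mul_sum]
        refine Finset.sum_congr rfl fun f _ => ?_
        rw [← Finset.sum_filter, Finset.sum_const, smul_eq_mul]
        have : q ^ r = q ^ μ * q ^ (r - μ) := by rw [← pow_add]; congr 1; omega
        rw [this, pow_add]; ring
    _ ≤ ∑ f ∈ Finset.range (μ + 1), q ^ r * (2 * q ^ (r + e0 + h.val T / 2)) := by
        refine Finset.sum_le_sum fun f hf => Nat.mul_le_mul_left _ ?_
        exact h.pow_mul_card_double_root_le h2 (by rw [Finset.mem_range] at hf; omega) T D
    _ = (μ + 1) * 2 * q ^ (2 * r + e0 + h.val T / 2) := by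
        rw [Finset.sum_const, smul_eq_mul, Finset.card_range]
        have : 2 * r + e0 + h.val T / 2 = r + (r + e0 + h.val T / 2) := by ring
        rw [this, pow_add q r]; ring
    _ ≤ _ := by
        gcongr ?_ * _
        omega

/-- Points on `x² + Txs + Δs² = 1` with `s` of given valuation `e`. -/
lemma pow_mul_card_norm_val_eq_le {μ : ℕ} (hμ : μ ≤ r) (T Δ : R) {e : ℕ} (he : e ≤ r) :
    q ^ μ * (Finset.univ.filter fun p : R × R => h.val p.2 = e ∧
      μ ≤ h.val (p.1 ^ 2 + T * p.1 * p.2 + Δ * p.2 ^ 2 - 1)).card ≤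
        4 * (r + 1) * q ^ (2 * r + e0 + h.val T / 2) := by
  obtain ⟨A, hA⟩ : ∃ A, A = Finset.univ.filter fun p : R × R => h.val p.2 = e ∧
      μ ≤ h.val (p.1 ^ 2 + T * p.1 * p.2 + Δ * p.2 ^ 2 - 1) := ⟨_, rfl⟩
  obtain ⟨B, hB⟩ : ∃ B, B = Finset.univ.filter fun p : R × R => h.val p.2 = 0 ∧
      μ ≤ h.val (p.1 ^ 2 + T * p.1 * (ϖ ^ e * p.2) + Δ * (ϖ ^ e * p.2) ^ 2 - 1) := ⟨_, rfl⟩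
  rw [← hA]
  -- Each `s` of valuation `e` can be written as `ϖ ^ e s'` with a unit `s'` in many ways.
  have hAB : q ^ e * A.card ≤ 2 * B.card := by
    have hmaps : ∀ p ∈ B, (p.1, ϖ ^ e * p.2) ∈ A := by
      intro p hp
      rw [hB, Finset.mem_filter] at hp
      rw [hA, Finset.mem_filter]
      refine ⟨Finset.mem_univ _, ?_, hp.2.2⟩
      simp only [h.val_mul, h.val_pow, hp.2.1]
      omega
    rw [Finset.card_eq_sum_card_fiberwise hmaps, Finset.mul_sum, mul_comm, ← smul_eq_mul,
      ← Finset.sum_const]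
    refine Finset.sum_le_sum fun p hp => ?_
    rw [hA, Finset.mem_filter] at hp
    obtain ⟨u, hu⟩ := h.exists_eq_pow_val_mul p.2
    rw [hp.2.1] at hu
    rcases Nat.lt_or_ge e r with her | her
    · have h4 : q ^ e = (Finset.univ.filter fun x : R => r - e ≤ h.val x).card := by
        rw [h.card_le_val (by omega)]; congr 1; omega
      rw [h4]
      refine le_trans ?_ (Nat.le_mul_of_pos_left _ two_pos)
      refine Finset.card_le_card_of_injOn (fun x => (p.1, (u : R) + x)) ?_ ?_
      · intro x hx
        simp only [Finset.coe_filter, Finset.mem_univ, true_and, Set.mem_ofPred_eq] at hx ⊢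
        have hzero : ϖ ^ e * ((u : R) + x) = p.2 := by
          have : ϖ ^ e * x = 0 := by rw [← h.val_eq_r_iff, h.val_mul, h.val_pow]; omega
          rw [mul_add, this, add_zero, ← hu]
        refine ⟨?_, ?_⟩
        · rw [hB, Finset.mem_filter]
          simp only [hzero]
          refine ⟨Finset.mem_univ _, ?_, hp.2.2⟩
          by_contra hne
          have := h.le_val_sub (j := 1) (x := (u : R) + x) (y := x) (by omega) (by omega)
          rw [add_sub_cancel_right, (h.val_eq_zero_iff _).mpr u.isUnit] at this
          omega
        · rw [hzero]
      · intro x _ y _ hxy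
        simpa using hxy
    · have her : e = r := by omega
      subst her
      have hp2 : p.2 = 0 := by rw [hu, h.pow_eq_zero, zero_mul]
      refine h.card_le_two_mul_card_units.trans ?_
      gcongr 2 * ?_
      refine Finset.card_le_card_of_injOn (fun x => (p.1, x)) ?_ ?_
      · intro x hx
        simp only [Finset.coe_filter, Finset.mem_univ, true_and, Set.mem_ofPred_eq] at hx ⊢
        have hzero : ϖ ^ e * x = p.2 := by rw [h.pow_eq_zero, zero_mul, hp2]
        refine ⟨?_, ?_⟩
        · rw [hB, Finset.mem_filter]
          simp only [hzero]
          exact ⟨Finset.mem_univ _, hx, hp.2.2⟩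
        · rw [hzero]
      · intro x _ y _ hxy
        simpa using hxy
  -- With `x' = x / s'` and `u = 1 / s' - x'` the equation becomes linear in `x'`.
  have hBD : B.card ≤ (Finset.univ.filter fun p : R × R =>
      μ ≤ h.val ((ϖ ^ e * T - 2 * p.1) * p.2 - (p.1 ^ 2 - ϖ ^ (2 * e) * Δ))).card := by
    refine Finset.card_le_card_of_injOn
      (fun p => (Ring.inverse p.2 - p.1 * Ring.inverse p.2, p.1 * Ring.inverse p.2)) ?_ ?_
    · rintro ⟨x, s⟩ hp
      simp only [hB, Finset.coe_filter, Finset.mem_univ, true_and, Set.mem_ofPred_eq] at hp ⊢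
      obtain ⟨u, rfl⟩ := (h.val_eq_zero_iff s).mp hp.1
      rw [Ring.inverse_unit]
      have hi := u.mul_inv
      generalize ((u⁻¹ : Rˣ) : R) = i at hi
      have hkey : (ϖ ^ e * T - 2 * (i - x * i)) * (x * i) -
          ((i - x * i) ^ 2 - ϖ ^ (2 * e) * Δ) =
          i ^ 2 * (x ^ 2 + T * x * (ϖ ^ e * u) + Δ * (ϖ ^ e * u) ^ 2 - 1) := by
        have h5 : (u : R) ^ 2 * i ^ 2 = 1 := by rw [← mul_pow, hi, one_pow]
        rw [pow_mul' ϖ 2 e]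
        linear_combination (-T * x * ϖ ^ e * i) * hi - (ϖ ^ e) ^ 2 * Δ * h5
      rw [hkey, h.val_mul]
      have := hp.2
      have := h.val_le (x ^ 2 + T * x * (ϖ ^ e * u) + Δ * (ϖ ^ e * u) ^ 2 - 1)
      omega
    · rintro ⟨x, s⟩ hp ⟨x', s'⟩ hp' heq
      simp only [hB, Finset.coe_filter, Finset.mem_univ, true_and, Set.mem_ofPred_eq] at hp hp'
      obtain ⟨u, rfl⟩ := (h.val_eq_zero_iff s).mp hp.1
      obtain ⟨u', rfl⟩ := (h.val_eq_zero_iff s').mp hp'.1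
      simp only [Ring.inverse_unit, Prod.mk.injEq] at heq
      have h6 : ((u⁻¹ : Rˣ) : R) = ((u'⁻¹ : Rˣ) : R) := by
        linear_combination heq.1 + heq.2
      have h7 : u = u' := inv_injective (Units.ext h6)
      subst h7
      have h8 := heq.2
      rw [Units.mul_left_inj] at h8
      rw [h8]
  have hD := h.pow_mul_card_linearized_le h2 hμ (ϖ ^ e * T) (ϖ ^ (2 * e) * Δ)
  have hq : 0 < q ^ e := Nat.pow_pos (by have := h.two_le; omega)
  refine Nat.le_of_mul_le_mul_left ?_ hq
  calc q ^ e * (q ^ μ * A.card) = q ^ μ * (q ^ e * A.card) := by ring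
    _ ≤ q ^ μ * (2 * B.card) := by gcongr
    _ = 2 * (q ^ μ * B.card) := by ring
    _ ≤ 2 * (2 * (r + 1) * q ^ (2 * r + e0 + h.val (ϖ ^ e * T) / 2)) := by
        gcongr 2 * ?_
        exact le_trans (by gcongr) hD
    _ ≤ 2 * (2 * (r + 1) * q ^ (e + (2 * r + e0 + h.val T / 2))) := by
        gcongr 2 * (2 * (r + 1) * ?_)
        apply h.pow_le_pow_q
        rw [h.val_mul, h.val_pow]
        omega
    _ = _ := by rw [pow_add q e]; ring

/-- The norm form `x² + Txs + Δs²` takes the value `1` modulo `ϖ ^ μ` at most about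
`q ^ (2 * r - μ)` times, up to a polynomial factor in `r` and a loss of `q ^ (v(T) / 2)` caused by
ramification. -/
theorem pow_mul_normCount_le {μ : ℕ} (hμ : μ ≤ r) (T Δ : R) :
    q ^ μ * h.normCount T Δ μ ≤ 4 * (r + 1) ^ 2 * q ^ (2 * r + e0 + h.val T / 2) := by
  have h1 : h.normCount T Δ μ = ∑ e ∈ Finset.range (r + 1),
      (Finset.univ.filter fun p : R × R => h.val p.2 = e ∧
        μ ≤ h.val (p.1 ^ 2 + T * p.1 * p.2 + Δ * p.2 ^ 2 - 1)).card := by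
    rw [normCount, Finset.card_eq_sum_card_fiberwise (t := Finset.range (r + 1))
      (f := fun p : R × R => h.val p.2)]
    · refine Finset.sum_congr rfl fun e _ => ?_
      rw [Finset.filter_filter]
      congr 1
      ext p
      simp [and_comm]
    · intro p _
      simpa using Nat.lt_succ_of_le (h.val_le p.2)
  calc _ = ∑ e ∈ Finset.range (r + 1), q ^ μ *
      (Finset.univ.filter fun p : R × R => h.val p.2 = e ∧
        μ ≤ h.val (p.1 ^ 2 + T * p.1 * p.2 + Δ * p.2 ^ 2 - 1)).card := by
        rw [h1, Finset.mul_sum]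
    _ ≤ ∑ e ∈ Finset.range (r + 1), 4 * (r + 1) * q ^ (2 * r + e0 + h.val T / 2) := by
        refine Finset.sum_le_sum fun e he => ?_
        exact h.pow_mul_card_norm_val_eq_le h2 hμ T Δ (by rw [Finset.mem_range] at he; omega)
    _ = _ := by rw [Finset.sum_const, Finset.card_range, smul_eq_mul]; ring

end QuadraticCount

end IsChainRing

/-! ### Centralizers and twisted squares in `SL₂` over a chain ring -/

namespace IsChainRing

section LinearEquation
open scoped Classical

variable {R : Type*} [CommRing R] [Fintype R] {ϖ : R} {q r : ℕ} (h : IsChainRing R ϖ q r)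
include h

lemma card_mul_eq_le {A : ℕ} (hA : A ≤ r) (s c : R) :
    (Finset.univ.filter fun x : R => A ≤ h.val x ∧ x * s = c).card ≤
      q ^ (min (h.val s) (r - A)) := by
  by_cases hne : ∃ x0, A ≤ h.val x0 ∧ x0 * s = c
  · obtain ⟨x0, hx0, hc⟩ := hne
    have hs := h.val_le s
    have h1 : min (h.val s) (r - A) = r - max A (r - h.val s) := by omega
    rw [h1, ← h.card_le_val (j := max A (r - h.val s)) (by omega)]
    refine Finset.card_le_card_of_injOn (fun x => x - x0) ?_
      (fun x _ y _ hxy => by simpa using hxy)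
    intro x hx
    simp only [Finset.coe_filter, Finset.mem_univ, true_and, Set.mem_ofPred_eq] at hx ⊢
    have h2 := h.le_val_sub hx.1 hx0
    have h3 : (x - x0) * s = 0 := by rw [sub_mul, hx.2, hc, sub_self]
    rw [← h.val_eq_r_iff, h.val_mul] at h3
    omega
  · push Not at hne
    rw [Finset.filter_eq_empty_iff.mpr]
    · simp
    · intro x _ hx
      exact hne x hx.1 hx.2

lemma card_linear_eq_le_aux {A B : ℕ} (hA : A ≤ r) (hB : B ≤ r) (s t c : R) :
    (Finset.univ.filter fun p : R × R =>
      A ≤ h.val p.1 ∧ B ≤ h.val p.2 ∧ p.1 * s + p.2 * t = c).card ≤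
      q ^ (r - B + min (h.val s) (r - A)) := by
  have h1 : (Finset.univ.filter fun p : R × R =>
      A ≤ h.val p.1 ∧ B ≤ h.val p.2 ∧ p.1 * s + p.2 * t = c).card =
      ∑ y ∈ Finset.univ.filter (fun y : R => B ≤ h.val y), (Finset.univ.filter fun x : R =>
        A ≤ h.val x ∧ x * s = c - y * t).card := by
    simp only [Finset.card_filter]
    rw [Fintype.sum_prod_type_right, Finset.sum_filter]
    refine Finset.sum_congr rfl fun y _ => ?_
    by_cases hy : B ≤ h.val y
    · simp [hy, eq_sub_iff_add_eq]
    · simp [hy]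
  rw [h1]
  calc _ ≤ ∑ y ∈ Finset.univ.filter (fun y : R => B ≤ h.val y), q ^ (min (h.val s) (r - A)) :=
        Finset.sum_le_sum fun y _ => h.card_mul_eq_le hA s _
    _ = _ := by rw [Finset.sum_const, smul_eq_mul, h.card_le_val hB, pow_add]

/-- The number of solutions of a linear equation in two variables taken from given ideals. -/
lemma card_linear_eq_le {A B : ℕ} (hAB : A + B ≤ r) (s t c : R) :
    (Finset.univ.filter fun p : R × R =>
      A ≤ h.val p.1 ∧ B ≤ h.val p.2 ∧ p.1 * s + p.2 * t = c).card ≤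
      q ^ (r - A - B + min r (min (A + h.val s) (B + h.val t))) := by
  rcases le_total (A + h.val s) (B + h.val t) with hle | hle
  · refine (h.card_linear_eq_le_aux (by omega) (by omega) s t c).trans (h.pow_le_pow_q ?_)
    omega
  · have h1 : (Finset.univ.filter fun p : R × R =>
        A ≤ h.val p.1 ∧ B ≤ h.val p.2 ∧ p.1 * s + p.2 * t = c).card =
        (Finset.univ.filter fun p : R × R =>
        B ≤ h.val p.1 ∧ A ≤ h.val p.2 ∧ p.1 * t + p.2 * s = c).card := by
      refine Finset.card_equiv (Equiv.prodComm R R) fun p => ?_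
      simp only [Finset.mem_filter, Finset.mem_univ, true_and, Equiv.prodComm_apply,
        Prod.fst_swap, Prod.snd_swap, add_comm (p.1 * s)]
      tauto
    rw [h1]
    refine (h.card_linear_eq_le_aux (by omega) (by omega) t s c).trans (h.pow_le_pow_q ?_)
    omega

/-- A count of pairs of vectors `(p, s)` and `(x, y)` with `ϖ ^ i * x * y = 0`. Once `v(x)` is known,
`y` lies in a known ideal, and for fixed `(p, s)` the second equation is linear in `(x, y)`. If the
values of this linear form are the multiples of `ϖ ^ μ`, there are about `q ^ (i + μ)` solutions, and
solvability makes the norm form at `(p, s)` equal to `1` modulo `ϖ ^ μ`. -/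
lemma card_auxiliary_le {i : ℕ} (hi : i ≤ r) (T Δ a : R) :
    (Finset.univ.filter fun p : (R × R) × (R × R) => ϖ ^ i * p.2.1 * p.2.2 = 0 ∧
      p.1.1 ^ 2 + T * p.1.1 * p.1.2 + Δ * p.1.2 ^ 2 - 1 =
        p.2.1 * p.1.2 + p.2.2 * (ϖ ^ i * p.1.1 - a * p.1.2)).card ≤
      ∑ _A ∈ Finset.range (r + 1), ∑ μ ∈ Finset.range (r + 1),
        q ^ (i + μ) * h.normCount T Δ μ := by
  have h1 : ∀ z : R × R, (Finset.univ.filter fun p : R × R => ϖ ^ i * p.1 * p.2 = 0 ∧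
      z.1 ^ 2 + T * z.1 * z.2 + Δ * z.2 ^ 2 - 1 =
        p.1 * z.2 + p.2 * (ϖ ^ i * z.1 - a * z.2)).card ≤
      ∑ _A ∈ Finset.range (r + 1), ∑ μ ∈ Finset.range (r + 1),
        if μ ≤ h.val (z.1 ^ 2 + T * z.1 * z.2 + Δ * z.2 ^ 2 - 1) then q ^ (i + μ) else 0 := by
    intro z
    generalize z.1 ^ 2 + T * z.1 * z.2 + Δ * z.2 ^ 2 - 1 = c
    generalize ϖ ^ i * z.1 - a * z.2 = t
    generalize z.2 = s
    have hsub : (Finset.univ.filter fun p : R × R => ϖ ^ i * p.1 * p.2 = 0 ∧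
        c = p.1 * s + p.2 * t) ⊆ (Finset.range (r - i + 1)).biUnion fun A =>
        Finset.univ.filter fun p : R × R =>
          A ≤ h.val p.1 ∧ r - i - A ≤ h.val p.2 ∧ p.1 * s + p.2 * t = c := by
      intro p hp
      simp only [Finset.mem_filter, Finset.mem_univ, true_and, Finset.mem_biUnion,
        Finset.mem_range] at hp ⊢
      have hp1 := hp.1
      rw [← h.val_eq_r_iff, h.val_mul, h.val_mul, h.val_pow] at hp1
      exact ⟨min (h.val p.1) (r - i), by omega, by omega, by omega, hp.2.symm⟩
    calc _ ≤ ∑ A ∈ Finset.range (r - i + 1), (Finset.univ.filter fun p : R × R =>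
          A ≤ h.val p.1 ∧ r - i - A ≤ h.val p.2 ∧ p.1 * s + p.2 * t = c).card :=
          (Finset.card_le_card hsub).trans Finset.card_biUnion_le
      _ ≤ ∑ A ∈ Finset.range (r - i + 1), ∑ μ ∈ Finset.range (r + 1),
            if μ ≤ h.val c then q ^ (i + μ) else 0 := by
          refine Finset.sum_le_sum fun A hA => ?_
          rw [Finset.mem_range] at hA
          by_cases hne : ∃ p : R × R,
            A ≤ h.val p.1 ∧ r - i - A ≤ h.val p.2 ∧ p.1 * s + p.2 * t = c
          · obtain ⟨p, hp1, hp2, hp3⟩ := hne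
            refine (h.card_linear_eq_le (by omega) s t c).trans ?_
            obtain ⟨μ, hμ⟩ : ∃ μ, μ = min r (min (A + h.val s) (r - i - A + h.val t)) := ⟨_, rfl⟩
            rw [← hμ]
            have hμc : μ ≤ h.val c := by
              rw [← hp3]
              apply h.le_val_add <;> rw [h.val_mul] <;> omega
            refine le_trans ?_ (Finset.single_le_sum
              (f := fun μ => if μ ≤ h.val c then q ^ (i + μ) else 0)
              (fun _ _ => Nat.zero_le _) (a := μ) (by rw [Finset.mem_range]; omega))
            rw [if_pos hμc]
            exact h.pow_le_pow_q (by omega)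
          · push Not at hne
            rw [Finset.filter_eq_empty_iff.mpr]
            · simp
            · intro p _ hp
              exact hne p hp.1 hp.2.1 hp.2.2
      _ ≤ _ := Finset.sum_le_sum_of_subset (Finset.range_subset_range.mpr (by omega))
  have h3 : (Finset.univ.filter fun p : (R × R) × (R × R) => ϖ ^ i * p.2.1 * p.2.2 = 0 ∧
      p.1.1 ^ 2 + T * p.1.1 * p.1.2 + Δ * p.1.2 ^ 2 - 1 =
        p.2.1 * p.1.2 + p.2.2 * (ϖ ^ i * p.1.1 - a * p.1.2)).card =
      ∑ z : R × R, (Finset.univ.filter fun p : R × R => ϖ ^ i * p.1 * p.2 = 0 ∧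
      z.1 ^ 2 + T * z.1 * z.2 + Δ * z.2 ^ 2 - 1 =
        p.1 * z.2 + p.2 * (ϖ ^ i * z.1 - a * z.2)).card := by
    simp only [Finset.card_filter]
    rw [Fintype.sum_prod_type]
  rw [h3]
  refine (Finset.sum_le_sum fun z _ => h1 z).trans (le_of_eq ?_)
  rw [Finset.sum_comm]
  refine Finset.sum_congr rfl fun A _ => ?_
  rw [Finset.sum_comm]
  refine Finset.sum_congr rfl fun μ _ => ?_
  rw [← Finset.sum_filter, Finset.sum_const, smul_eq_mul, mul_comm]
  rfl

end LinearEquation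

end IsChainRing

lemma natCard_le_card_of_injective {α β : Type*} (s : Finset β) (f : α → β) (hf : ∀ x, f x ∈ s)
    (hinj : Function.Injective f) : Nat.card α ≤ s.card := by
  have h := Nat.card_le_card_of_injective (fun x => (⟨f x, hf x⟩ : s))
    (fun x y hxy => hinj (congrArg Subtype.val hxy))
  simpa using h

section Counts
open scoped Classical

variable {R : Type*} [CommRing R]

/-- The order of the centralizer of `k` in `SL₂(R)`. -/
noncomputable def slCentralizerCount (k : SL2 R) : ℕ := Nat.card {g : SL2 R // g * k = k * g}

/-- The number of matrices `w` of determinant `-1` such that `k w²` is conjugate to `k`. -/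
noncomputable def slTwistedCount (k : SL2 R) : ℕ :=
  Nat.card {w : Matrix (Fin 2) (Fin 2) R //
    w.det = -1 ∧ ∃ g : SL2 R, (g * k : Matrix (Fin 2) (Fin 2) R) = k * (w * w) * g}

variable [Finite R]

/-- Both counts are invariant under conjugation in `GL₂(R)`. -/
lemma slCounts_mul_le_of_conj {k k' : SL2 R} {P Q : Matrix (Fin 2) (Fin 2) R} (hPQ : P * Q = 1)
    (hk : (k : Matrix (Fin 2) (Fin 2) R) * P = P * k') :
    slCentralizerCount k * slTwistedCount k ≤ slCentralizerCount k' * slTwistedCount k' := by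
  have hQP : Q * P = 1 := mul_eq_one_comm.mp hPQ
  have hdet : ∀ M : Matrix (Fin 2) (Fin 2) R, (Q * M * P).det = M.det := by
    intro M
    rw [Matrix.det_mul, Matrix.det_mul, mul_comm, ← mul_assoc, ← Matrix.det_mul, hPQ,
      Matrix.det_one, one_mul]
  have hmul : ∀ M N : Matrix (Fin 2) (Fin 2) R, Q * M * P * (Q * N * P) = Q * (M * N) * P := by
    intro M N
    calc _ = Q * M * (P * Q) * N * P := by simp only [Matrix.mul_assoc]
      _ = _ := by rw [hPQ]; simp only [Matrix.mul_assoc, Matrix.mul_one]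
  have hk' : (k' : Matrix (Fin 2) (Fin 2) R) = Q * k * P := by
    rw [Matrix.mul_assoc, hk, ← Matrix.mul_assoc, hQP, Matrix.one_mul]
  have hinj : ∀ M N : Matrix (Fin 2) (Fin 2) R, Q * M * P = Q * N * P → M = N := by
    intro M N hMN
    have := congrArg (fun X => P * X * Q) hMN
    simp only [Matrix.mul_assoc, hPQ, Matrix.mul_one] at this
    simpa only [← Matrix.mul_assoc, hPQ, Matrix.one_mul] using this
  let c : SL2 R → SL2 R := fun g => ⟨Q * g * P, by rw [hdet]; exact g.det_coe⟩
  have hc : ∀ g, (c g : Matrix (Fin 2) (Fin 2) R) = Q * g * P := fun g => rfl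
  apply Nat.mul_le_mul
  · refine Nat.card_le_card_of_injective (fun g => ⟨c g.1, ?_⟩) ?_
    · apply Subtype.ext
      rw [Matrix.SpecialLinearGroup.coe_mul, Matrix.SpecialLinearGroup.coe_mul, hc, hk', hmul, hmul,
        ← Matrix.SpecialLinearGroup.coe_mul, ← Matrix.SpecialLinearGroup.coe_mul, g.2]
    · intro g g' hgg
      apply Subtype.ext
      apply Subtype.ext
      apply hinj
      exact congrArg Subtype.val (congrArg Subtype.val hgg)
  · refine Nat.card_le_card_of_injective (fun w => ⟨Q * w.1 * P, ?_, ?_⟩) ?_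
    · rw [hdet]; exact w.2.1
    · obtain ⟨g, hg⟩ := w.2.2
      refine ⟨c g, ?_⟩
      rw [hc, hk', hmul, hg, hmul, hmul, hmul]
    · intro w w' hww
      apply Subtype.ext
      apply hinj
      exact congrArg Subtype.val hww

-- The element `k` is `a + ϖ ^ i B` with the companion matrix `B = (0, -Δ; 1, T)` of `X² - TX + Δ`.
variable {ϖ : R} {q r : ℕ} (h : IsChainRing R ϖ q r) {i : ℕ} (hi : i ≤ r) {T Δ a : R}
  {k : SL2 R} (k00 : k 0 0 = a) (k01 : k 0 1 = -(ϖ ^ i * Δ)) (k10 : k 1 0 = ϖ ^ i)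
  (k11 : k 1 1 = a + ϖ ^ i * T)

omit [Finite R] in
include hi in
lemma IsChainRing.le_val_of_pow_mul_eq_zero {z : R} (hz : ϖ ^ i * z = 0) : r - i ≤ h.val z := by
  rw [← h.val_eq_r_iff, h.val_mul, h.val_pow] at hz
  omega

omit [Finite R] in
include hi k00 k01 k10 k11 in
/-- The first column of an element commuting with `k` solves the norm equation modulo `ϖ ^ (r - i)`;
given the first column, the element is determined by one of the two other entries, which is known
modulo `ϖ ^ (r - i)`. -/
lemma slCentralizerCount_le [Fintype R] :
    slCentralizerCount k ≤ q ^ i * h.normCount T Δ (r - i) := by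
  have hcard : q ^ i * h.normCount T Δ (r - i) =
      ((Finset.univ.filter fun x : R => r - i ≤ h.val x) ×ˢ (Finset.univ.filter fun p : R × R =>
        r - i ≤ h.val (p.1 ^ 2 + T * p.1 * p.2 + Δ * p.2 ^ 2 - 1))).card := by
    rw [Finset.card_product, h.card_le_val (by omega)]
    congr 2; omega
  have hentry : ∀ g : SL2 R, g * k = k * g →
      r - i ≤ h.val (g 0 1 + Δ * g 1 0) ∧ r - i ≤ h.val (g 1 1 - g 0 0 - T * g 1 0) := by
    intro g hg
    have e00 : (g * k) 0 0 = (k * g) 0 0 := by rw [hg]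
    have e10 : (g * k) 1 0 = (k * g) 1 0 := by rw [hg]
    rw [sl_mul_apply, sl_mul_apply, k00, k10, k01] at e00
    rw [sl_mul_apply, sl_mul_apply, k00, k10, k11] at e10
    exact ⟨h.le_val_of_pow_mul_eq_zero hi (by linear_combination e00),
      h.le_val_of_pow_mul_eq_zero hi (by linear_combination e10)⟩
  rw [slCentralizerCount, hcard]
  refine natCard_le_card_of_injective _ (fun g => (if IsUnit (g.1 0 0) then
    g.1 0 1 + Δ * g.1 1 0 else g.1 1 1 - g.1 0 0 - T * g.1 1 0, (g.1 0 0, g.1 1 0))) ?_ ?_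
  · rintro ⟨g, hg⟩
    obtain ⟨h1, h2⟩ := hentry g hg
    have hdet := sl_det g
    simp only [Finset.mem_product, Finset.mem_filter, Finset.mem_univ, true_and]
    refine ⟨by split_ifs <;> assumption, ?_⟩
    have h3 : g 0 0 ^ 2 + T * g 0 0 * g 1 0 + Δ * g 1 0 ^ 2 - 1 =
        g 1 0 * (g 0 1 + Δ * g 1 0) - g 0 0 * (g 1 1 - g 0 0 - T * g 1 0) := by
      linear_combination hdet
    rw [h3]
    apply h.le_val_sub <;> rw [h.val_mul] <;> omega
  · rintro ⟨g, hg⟩ ⟨g', hg'⟩ heq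
    simp only [Prod.mk.injEq] at heq
    obtain ⟨heq1, heq2, heq3⟩ := heq
    have hdet := sl_det g
    have hdet' := sl_det g'
    apply Subtype.ext
    rw [← heq2, ← heq3] at heq1 hdet'
    split_ifs at heq1 with hu
    · have h01 : g 0 1 = g' 0 1 := by linear_combination heq1
      refine sl_ext heq2 h01 heq3 ?_
      apply hu.mul_left_cancel
      rw [← h01] at hdet'
      linear_combination hdet - hdet'
    · have h11 : g 1 1 = g' 1 1 := by linear_combination heq1
      refine sl_ext heq2 ?_ heq3 h11
      have hu' : IsUnit (g 1 0) := by
        rw [← h.val_eq_zero_iff] at hu ⊢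
        by_contra hne
        have h00 := h.val_le (g 0 0)
        have h1 := h.le_val_sub (j := 1) (x := g 0 0 * g 1 1) (y := g 0 1 * g 1 0)
          (by rw [h.val_mul]; omega) (by rw [h.val_mul]; omega)
        rw [hdet, h.val_one] at h1
        omega
      apply hu'.mul_left_cancel
      rw [← h11] at hdet'
      linear_combination hdet' - hdet

omit [Finite R] in
include k00 k01 k10 k11 in
/-- The equations satisfied by the entries of `k w` if `k w²` is conjugate to `k`. Since
`det w = -1`, one has `k w² = k + t k w` with `t = tr w`, so some conjugate `E` of `B` satisfies
`ϖ ^ i E = ϖ ^ i B + t k w`; the equations express that `det E = det B`. -/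
lemma slTwistedCount_aux {w : Matrix (Fin 2) (Fin 2) R} (hw : w.det = -1)
    (ha : IsUnit a) (hg : ∃ g : SL2 R, (g * k : Matrix (Fin 2) (Fin 2) R) = k * (w * w) * g)
    {p b s u : R} (hm : (k : Matrix (Fin 2) (Fin 2) R) * w = !![p, b; s, u]) :
    ∃ y, ϖ ^ i * y = p + u ∧ ϖ ^ i * (Δ * s - b + T * p + a * y) * y = 0 ∧
      p ^ 2 + T * p * s + Δ * s ^ 2 - 1 =
        (Δ * s - b + T * p + a * y) * s + y * (ϖ ^ i * p - a * s) := by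
  obtain ⟨g, hg⟩ := hg
  obtain ⟨t, ht⟩ : ∃ t, t = w 0 0 + w 1 1 := ⟨_, rfl⟩
  have hdetk := sl_det k
  rw [k00, k01, k10, k11] at hdetk
  rw [Matrix.det_fin_two] at hw
  have e (x y : Fin 2) := congrFun (congrFun hm x) y
  have e00 := e 0 0
  have e01 := e 0 1
  have e10 := e 1 0
  have e11 := e 1 1
  simp only [Matrix.mul_apply, Fin.sum_univ_two, k00, k01, k10, k11, Matrix.of_apply,
    Matrix.cons_val_zero, Matrix.cons_val_one, Matrix.cons_val', Matrix.cons_val_fin_one]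
    at e00 e01 e10 e11
  have hdetm : p * u - b * s = -1 := by
    rw [← e00, ← e01, ← e10, ← e11]
    linear_combination (w 0 0 * w 1 1 - w 0 1 * w 1 0) * hdetk + hw
  have htm : t = a * (p + u) + ϖ ^ i * (Δ * s - b + T * p) := by
    rw [ht, ← e00, ← e01, ← e10, ← e11]
    linear_combination (-w 0 0 - w 1 1) * hdetk
  -- The conjugate `E` of the companion matrix satisfies `ϖ ^ i (E - B) = t k w`.
  obtain ⟨E, hE⟩ : ∃ E : Matrix (Fin 2) (Fin 2) R, E = g * !![0, -Δ; 1, T] *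
    (g⁻¹ : SL2 R) := ⟨_, rfl⟩
  have hEdet : E 0 0 * E 1 1 - E 0 1 * E 1 0 = Δ := by
    rw [← Matrix.det_fin_two, hE, Matrix.det_mul, Matrix.det_mul, Matrix.SpecialLinearGroup.det_coe,
      Matrix.SpecialLinearGroup.det_coe, Matrix.det_fin_two_of]
    ring
  have hk : (k : Matrix (Fin 2) (Fin 2) R) = a • 1 + ϖ ^ i • !![0, -Δ; 1, T] := by
    ext x y
    fin_cases x <;> fin_cases y <;> simp [k00, k01, k10, k11]
  have hww : w * w = t • w + 1 := by
    ext x y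
    fin_cases x <;> fin_cases y <;> simp [Matrix.mul_apply, Fin.sum_univ_two, ht]
    · linear_combination -hw
    · ring
    · ring
    · linear_combination -hw
  have hgg : (g : Matrix (Fin 2) (Fin 2) R) * (g⁻¹ : SL2 R) = 1 := by
    rw [← Matrix.SpecialLinearGroup.coe_mul, mul_inv_cancel, Matrix.SpecialLinearGroup.coe_one]
  have hEm : ϖ ^ i • E = ϖ ^ i • !![0, -Δ; 1, T] + t • !![p, b; s, u] := by
    have h1 := congrArg (· * ((g⁻¹ : SL2 R) : Matrix (Fin 2) (Fin 2) R)) hg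
    rw [Matrix.mul_assoc (_ * _), hgg, Matrix.mul_one, hww, Matrix.mul_add, Matrix.mul_smul, hm,
      Matrix.mul_one, hk, Matrix.mul_add, Matrix.add_mul, Matrix.mul_smul, Matrix.mul_one,
      Matrix.smul_mul, hgg, Matrix.mul_smul, Matrix.smul_mul, ← hE] at h1
    have h2 := add_left_cancel (h1.trans (by rw [add_comm (t • _), add_assoc]))
    exact h2
  have f (x y : Fin 2) := congrFun (congrFun hEm x) y
  have f00 := f 0 0
  have f01 := f 0 1
  have f10 := f 1 0
  have f11 := f 1 1
  simp only [Matrix.add_apply, Matrix.smul_apply, smul_eq_mul, Matrix.of_apply,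
    Matrix.cons_val_zero, Matrix.cons_val_one, Matrix.cons_val', Matrix.cons_val_fin_one]
    at f00 f01 f10 f11
  -- Since `det (k w) = -1`, the trace `t` of `w` is divisible by `ϖ ^ i`.
  obtain ⟨t', ht'⟩ : ∃ t', t = ϖ ^ i * t' :=
    ⟨(E 0 1 + Δ) * s - E 0 0 * u, by linear_combination t * hdetm + f00 * u - f01 * s⟩
  have hkey : ϖ ^ i * (t' * (Δ * s - b + T * p - t')) = 0 := by
    rw [ht'] at f00 f01 f10 f11
    linear_combination ϖ ^ i * hEdet - ϖ ^ i * t' ^ 2 * hdetm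
      - f00 * (T + t' * u) - E 0 0 * f11 + f01 * (1 + t' * s) + E 0 1 * f10
  obtain ⟨a, rfl⟩ := ha
  have hai := a.mul_inv
  refine ⟨(a⁻¹ : Rˣ) * (t' - (Δ * s - b + T * p)), ?_, ?_, ?_⟩
  · rw [ht'] at htm
    linear_combination (a⁻¹ : Rˣ) * htm + (p + u) * hai
  · linear_combination (-(a⁻¹ : Rˣ) : R) * hkey + ϖ ^ i * (t' - (Δ * s - b + T * p)) ^ 2 *
      (a⁻¹ : Rˣ) * hai
  · rw [ht'] at htm
    linear_combination (-p * (a⁻¹ : Rˣ)) * htm - hdetm - (p * (p + u)) * hai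

omit [Finite R] in
include hi k00 k01 k10 k11 in
/-- The matrices `w` are parametrized by the solutions counted in `card_auxiliary_le`; the element
`y` of `slTwistedCount_aux` is determined by `w` only up to the annihilator of `ϖ ^ i`, which has
`q ^ i` elements. -/
lemma pow_mul_slTwistedCount_le [Fintype R] (ha : IsUnit a) :
    q ^ i * slTwistedCount k ≤ ∑ _A ∈ Finset.range (r + 1), ∑ μ ∈ Finset.range (r + 1),
        q ^ (i + μ) * h.normCount T Δ μ := by
  refine le_trans ?_ (h.card_auxiliary_le hi T Δ a)
  have hq : q ^ i = Nat.card {x : R // r - i ≤ h.val x} := by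
    rw [Nat.card_eq_fintype_card, Fintype.card_subtype, h.card_le_val (by omega)]
    congr 1; omega
  rw [slTwistedCount, hq, ← Nat.card_prod]
  have hex : ∀ w : Matrix (Fin 2) (Fin 2) R, ∃ y, (w.det = -1 ∧ ∃ g : SL2 R,
      (g * k : Matrix (Fin 2) (Fin 2) R) = k * (w * w) * g) →
      ϖ ^ i * y = (k.1 * w) 0 0 + (k.1 * w) 1 1 ∧
      ϖ ^ i * (Δ * (k.1 * w) 1 0 - (k.1 * w) 0 1 +
        T * (k.1 * w) 0 0 + a * y) * y = 0 ∧
      (k.1 * w) 0 0 ^ 2 + T * (k.1 * w) 0 0 * (k.1 * w) 1 0 +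
        Δ * (k.1 * w) 1 0 ^ 2 - 1 =
        (Δ * (k.1 * w) 1 0 - (k.1 * w) 0 1 +
        T * (k.1 * w) 0 0 + a * y) * (k.1 * w) 1 0 +
        y * (ϖ ^ i * (k.1 * w) 0 0 - a * (k.1 * w) 1 0) := by
    intro w
    by_cases hw : w.det = -1 ∧ ∃ g : SL2 R,
      (g * k : Matrix (Fin 2) (Fin 2) R) = k * (w * w) * g
    · obtain ⟨y, hy⟩ := slTwistedCount_aux k00 k01 k10 k11 hw.1 ha hw.2
        (Matrix.eta_fin_two (k.1 * w))
      exact ⟨y, fun _ => hy⟩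
    · exact ⟨0, fun h => absurd h hw⟩
  choose Y hY using hex
  refine natCard_le_card_of_injective _ (fun z =>
    (((k.1 * z.2.1) 0 0, (k.1 * z.2.1) 1 0),
     (Δ * (k.1 * z.2.1) 1 0 - (k.1 * z.2.1) 0 1 +
        T * (k.1 * z.2.1) 0 0 + a * (Y z.2.1 + z.1.1), Y z.2.1 + z.1.1))) ?_ ?_
  · rintro ⟨⟨d, hd⟩, ⟨w, hw⟩⟩
    obtain ⟨h1, h2, h3⟩ := hY w hw
    have hd0 : ϖ ^ i * d = 0 := by
      rw [← h.val_eq_r_iff, h.val_mul, h.val_pow]; omega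
    simp only [Finset.mem_filter, Finset.mem_univ, true_and]
    generalize (k.1 * w) 0 0 = p at *
    generalize (k.1 * w) 0 1 = b at *
    generalize (k.1 * w) 1 0 = s at *
    generalize (k.1 * w) 1 1 = u at *
    constructor
    · linear_combination h2 + ((Δ * s - b + T * p + a * Y w) + a * Y w + a * d) * hd0
    · linear_combination h3 - p * hd0
  · rintro ⟨⟨d, hd⟩, ⟨w, hw⟩⟩ ⟨⟨d', hd'⟩, ⟨w', hw'⟩⟩ heq
    simp only [Prod.mk.injEq] at heq
    obtain ⟨⟨hp, hs⟩, hx, hy⟩ := heq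
    obtain ⟨h1, -, -⟩ := hY w hw
    obtain ⟨h1', -, -⟩ := hY w' hw'
    have hd0 : ϖ ^ i * d = 0 := by
      rw [← h.val_eq_r_iff, h.val_mul, h.val_pow]; omega
    have hd0' : ϖ ^ i * d' = 0 := by
      rw [← h.val_eq_r_iff, h.val_mul, h.val_pow]; omega
    have hww : k.1 * w = k.1 * w' := by
      ext x y
      fin_cases x <;> fin_cases y
      · exact hp
      · rw [hy] at hx
        change (k.1 * w) 0 1 = (k.1 * w') 0 1
        linear_combination Δ * hs + T * hp - hx
      · exact hs
      · change (k.1 * w) 1 1 = (k.1 * w') 1 1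
        linear_combination h1' - h1 - hp + ϖ ^ i * hy - hd0 + hd0'
    have hkk : (k⁻¹).1 * k.1 = 1 := by
      rw [← Matrix.SpecialLinearGroup.coe_mul, inv_mul_cancel, Matrix.SpecialLinearGroup.coe_one]
    have hw2 : w = w' := by
      have := congrArg (fun X => (k⁻¹).1 * X) hww
      simpa only [← Matrix.mul_assoc, hkk, Matrix.one_mul] using this
    subst hw2
    have hd2 : d = d' := add_left_cancel hy
    subst hd2
    rfl

end Counts

/-! ### The number of solutions of the equation `[g, k] z τ(z) = 1` -/

section Bound
open scoped Classical

variable {R : Type*} [CommRing R] [Fintype R] {ϖ : R} {q r : ℕ} (h : IsChainRing R ϖ q r)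
  {e0 : ℕ} (h2 : (2 : R) = 0 ∨ h.val 2 ≤ e0)
include h2

/-- The contribution of an element `k` in companion form to the number of solutions. -/
lemma slCounts_mul_le_of_companion {i : ℕ} (hi : i ≤ r) {T Δ a : R} (ha : IsUnit a)
    {k : SL2 R} (k00 : k 0 0 = a) (k01 : k 0 1 = -(ϖ ^ i * Δ)) (k10 : k 1 0 = ϖ ^ i)
    (k11 : k 1 1 = a + ϖ ^ i * T) :
    slCentralizerCount k * slTwistedCount k ≤
      16 * (r + 1) ^ 6 * q ^ (3 * r + 2 * i + h.val T + 2 * e0) := by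
  obtain ⟨n, hn⟩ : ∃ n, n = q ^ (2 * r + e0 + h.val T / 2) := ⟨_, rfl⟩
  have hq : ∀ m, 0 < q ^ m := fun m => Nat.pow_pos (by have := h.two_le; omega)
  have h1 : q ^ (r - i) * slCentralizerCount k ≤ q ^ i * (4 * (r + 1) ^ 2 * n) := by
    calc _ ≤ q ^ (r - i) * (q ^ i * h.normCount T Δ (r - i)) := by
          gcongr; exact slCentralizerCount_le h hi k00 k01 k10 k11
      _ = q ^ i * (q ^ (r - i) * h.normCount T Δ (r - i)) := by ring
      _ ≤ _ := by
          rw [hn]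
          gcongr q ^ i * ?_
          exact h.pow_mul_normCount_le h2 (by omega) T Δ
  have h3 : slTwistedCount k ≤ (r + 1) * ((r + 1) * (4 * (r + 1) ^ 2 * n)) := by
    refine Nat.le_of_mul_le_mul_left ?_ (hq i)
    calc _ ≤ ∑ _A ∈ Finset.range (r + 1), ∑ μ ∈ Finset.range (r + 1),
          q ^ (i + μ) * h.normCount T Δ μ := pow_mul_slTwistedCount_le h hi k00 k01 k10 k11 ha
      _ ≤ ∑ _A ∈ Finset.range (r + 1), ∑ μ ∈ Finset.range (r + 1),
          q ^ i * (4 * (r + 1) ^ 2 * n) := by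
          refine Finset.sum_le_sum fun A _ => Finset.sum_le_sum fun μ hμ => ?_
          rw [pow_add, mul_assoc, hn]
          gcongr q ^ i * ?_
          exact h.pow_mul_normCount_le h2 (by rw [Finset.mem_range] at hμ; omega) T Δ
      _ = _ := by simp only [Finset.sum_const, Finset.card_range, smul_eq_mul]; ring
  refine Nat.le_of_mul_le_mul_left ?_ (hq (r - i))
  calc q ^ (r - i) * (slCentralizerCount k * slTwistedCount k)
      = (q ^ (r - i) * slCentralizerCount k) * slTwistedCount k := by ring
    _ ≤ (q ^ i * (4 * (r + 1) ^ 2 * n)) * ((r + 1) * ((r + 1) * (4 * (r + 1) ^ 2 * n))) :=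
        Nat.mul_le_mul h1 h3
    _ = 16 * (r + 1) ^ 6 * q ^ (i + (2 * r + e0 + h.val T / 2) + (2 * r + e0 + h.val T / 2)) := by
        rw [hn, pow_add q (i + _), pow_add q i]; ring
    _ ≤ 16 * (r + 1) ^ 6 * q ^ ((r - i) + (3 * r + 2 * i + h.val T + 2 * e0)) := by
        gcongr 16 * (r + 1) ^ 6 * ?_
        exact h.pow_le_pow_q (by omega)
    _ = _ := by rw [pow_add q (r - i)]; ring

/-- The contribution of an arbitrary `k`: up to conjugation in `GL₂` it is `a + ϖ ^ i B` with a
companion matrix `B`. -/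
lemma slCounts_mul_le {k : SL2 R} (hk : IsUnit (k 0 0)) :
    ∃ i j, i ≤ j ∧ j ≤ r ∧ i ≤ h.val (k 0 1) ∧ i ≤ h.val (k 1 0) ∧ j ≤ h.val (k 1 1 - k 0 0) ∧
    slCentralizerCount k * slTwistedCount k ≤
      16 * (r + 1) ^ 6 * q ^ (3 * r + i + j + 2 * e0) := by
  obtain ⟨ub, hb⟩ := h.exists_eq_pow_val_mul (k 0 1)
  obtain ⟨uc, hc⟩ := h.exists_eq_pow_val_mul (k 1 0)
  obtain ⟨ud, hd⟩ := h.exists_eq_pow_val_mul (k 1 1 - k 0 0)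
  have hbr := h.val_le (k 0 1)
  have hcr := h.val_le (k 1 0)
  have hdr := h.val_le (k 1 1 - k 0 0)
  obtain ⟨vb, hvb⟩ : ∃ v, v = h.val (k 0 1) := ⟨_, rfl⟩
  obtain ⟨vc, hvc⟩ : ∃ v, v = h.val (k 1 0) := ⟨_, rfl⟩
  obtain ⟨j, hj⟩ : ∃ v, v = h.val (k 1 1 - k 0 0) := ⟨_, rfl⟩
  rw [← hvb] at hb hbr
  rw [← hvc] at hc hcr
  rw [← hj] at hd hdr
  obtain ⟨i, hi⟩ : ∃ i, i = min (min vb vc) j := ⟨_, rfl⟩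
  refine ⟨i, j, by omega, by omega, by omega, by omega, by omega, ?_⟩
  obtain ⟨β, hβ⟩ : ∃ β : R, β = ϖ ^ (vb - i) * ub := ⟨_, rfl⟩
  obtain ⟨γ, hγ⟩ : ∃ γ : R, γ = ϖ ^ (vc - i) * uc := ⟨_, rfl⟩
  obtain ⟨e, he⟩ : ∃ e : R, e = ϖ ^ (j - i) * ud := ⟨_, rfl⟩
  have vβ : h.val β = vb - i := by rw [hβ]; exact h.val_eq (by omega) ub
  have vγ : h.val γ = vc - i := by rw [hγ]; exact h.val_eq (by omega) uc
  have ve : h.val e = j - i := by rw [he]; exact h.val_eq (by omega) ud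
  have hpow : ∀ m, i ≤ m → ϖ ^ m = ϖ ^ i * ϖ ^ (m - i) := fun m hm => by
    rw [← pow_add]; congr 1; omega
  have hb' : k 0 1 = ϖ ^ i * β := by rw [hb, hβ, hpow vb (by omega), mul_assoc]
  have hc' : k 1 0 = ϖ ^ i * γ := by rw [hc, hγ, hpow vc (by omega), mul_assoc]
  have hd' : k 1 1 = k 0 0 + ϖ ^ i * e := by
    have : k 1 1 - k 0 0 = ϖ ^ i * e := by rw [hd, he, hpow j (by omega), mul_assoc]
    linear_combination this
  -- A cyclic vector `(x, y)` for the matrix `B = (0, β; γ, e)`.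
  obtain ⟨x, y, hxy⟩ : ∃ x y : R, IsUnit (x * (γ * x + e * y) - β * y * y) := by
    by_cases h1 : h.val γ = 0
    · exact ⟨1, 0, by rw [h.val_eq_zero_iff] at h1; simpa using h1⟩
    by_cases h3 : h.val β = 0
    · exact ⟨0, 1, by rw [h.val_eq_zero_iff] at h3; simpa using h3⟩
    refine ⟨1, 1, ?_⟩
    have h4 : h.val e = 0 := by omega
    rw [← h.val_eq_zero_iff]
    by_contra hne
    have h5 := h.val_le β
    have h6 := h.le_val_add (j := 1)
      (x := 1 * (γ * 1 + e * 1) - β * 1 * 1) (y := β - γ) (by omega)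
      (h.le_val_sub (by omega) (by omega))
    have h7 : 1 * (γ * 1 + e * 1) - β * 1 * 1 + (β - γ) = e := by ring
    rw [h7] at h6
    omega
  have hdet := sl_det k
  rw [hb', hc', hd'] at hdet
  obtain ⟨k', hk'⟩ : ∃ k' : SL2 R, k' = slMk (k 0 0) (-(ϖ ^ i * (-(β * γ)))) (ϖ ^ i)
      (k 0 0 + ϖ ^ i * e) (by linear_combination hdet) := ⟨_, rfl⟩
  obtain ⟨P, hP⟩ : ∃ P : Matrix (Fin 2) (Fin 2) R, P = !![x, β * y; y, γ * x + e * y] := ⟨_, rfl⟩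
  have hPdet : IsUnit P.det := by
    rw [hP, Matrix.det_fin_two_of]; exact hxy
  have hconj : (k : Matrix (Fin 2) (Fin 2) R) * P = P * k' := by
    have hke : (k : Matrix (Fin 2) (Fin 2) R) =
        !![k 0 0, ϖ ^ i * β; ϖ ^ i * γ, k 0 0 + ϖ ^ i * e] := by
      rw [← hb', ← hc', ← hd']; exact Matrix.eta_fin_two _
    have hke' : (k' : Matrix (Fin 2) (Fin 2) R) =
        !![k 0 0, -(ϖ ^ i * (-(β * γ))); ϖ ^ i, k 0 0 + ϖ ^ i * e] := by
      rw [hk']; rfl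
    rw [hke, hke', hP, Matrix.mul_fin_two, Matrix.mul_fin_two]
    congr 1
    ext a b
    fin_cases a <;> fin_cases b <;> simp <;> ring
  refine (slCounts_mul_le_of_conj (Matrix.mul_nonsing_inv P hPdet) hconj).trans ?_
  refine (slCounts_mul_le_of_companion h h2 (i := i) (by omega) hk (T := e) (Δ := -(β * γ))
    (by rw [hk']; rfl) (by rw [hk']; rfl) (by rw [hk']; rfl) (by rw [hk']; rfl)).trans ?_
  gcongr 16 * (r + 1) ^ 6 * ?_
  exact h.pow_le_pow_q (by omega)

omit h2
include h

/-- The number of solutions of `x y ≡ c` modulo `ϖ ^ j` with both factors divisible by `ϖ ^ i`. -/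
lemma card_mul_congr_le {i j : ℕ} (hij : 2 * i ≤ j) (hj : j ≤ r) (c : R) :
    (Finset.univ.filter fun p : R × R =>
      i ≤ h.val p.1 ∧ i ≤ h.val p.2 ∧ j ≤ h.val (p.1 * p.2 - c)).card ≤
      (r + 1) * q ^ (2 * r - j) := by
  have hsub : (Finset.univ.filter fun p : R × R =>
      i ≤ h.val p.1 ∧ i ≤ h.val p.2 ∧ j ≤ h.val (p.1 * p.2 - c)) ⊆
      ((Finset.range (j - i)).biUnion fun b => Finset.univ.filter fun p : R × R =>
        h.val p.1 = b ∧ j ≤ h.val (p.1 * p.2 - c)) ∪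
      (Finset.univ.filter fun x : R => j - i ≤ h.val x) ×ˢ
        (Finset.univ.filter fun x : R => i ≤ h.val x) := by
    intro p hp
    simp only [Finset.mem_filter, Finset.mem_univ, true_and, Finset.mem_union, Finset.mem_biUnion,
      Finset.mem_range, Finset.mem_product] at hp ⊢
    by_cases hlt : h.val p.1 < j - i
    · exact Or.inl ⟨_, hlt, rfl, hp.2.2⟩
    · exact Or.inr ⟨by omega, hp.2.1⟩
  have h1 : ∀ b ∈ Finset.range (j - i), (Finset.univ.filter fun p : R × R =>
        h.val p.1 = b ∧ j ≤ h.val (p.1 * p.2 - c)).card ≤ q ^ (2 * r - j) := by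
    intro b hb
    rw [Finset.mem_range] at hb
    have h3 : (Finset.univ.filter fun p : R × R =>
        h.val p.1 = b ∧ j ≤ h.val (p.1 * p.2 - c)).card =
        ∑ x ∈ Finset.univ.filter (fun x : R => h.val x = b),
          (Finset.univ.filter fun y : R => j ≤ h.val (x * y - c)).card := by
      simp only [Finset.card_filter]
      rw [Fintype.sum_prod_type, Finset.sum_filter]
      refine Finset.sum_congr rfl fun x _ => ?_
      by_cases hx : h.val x = b
      · simp [hx]
      · simp [hx]
    rw [h3]
    calc _ ≤ ∑ x ∈ Finset.univ.filter (fun x : R => h.val x = b), q ^ (r - j + b) := by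
          refine Finset.sum_le_sum fun x hx => ?_
          rw [Finset.mem_filter] at hx
          refine (h.card_linear_le hj x c).trans (h.pow_le_pow_q ?_)
          omega
      _ ≤ q ^ (r - b) * q ^ (r - j + b) := by
          rw [Finset.sum_const, smul_eq_mul, ← h.card_le_val (j := b) (by omega)]
          gcongr
          rename_i x
          intro hx
          exact hx.ge
      _ = q ^ (2 * r - j) := by rw [← pow_add]; congr 1; omega
  calc _ ≤ _ := Finset.card_le_card hsub
    _ ≤ _ := Finset.card_union_le _ _
    _ ≤ (j - i) * q ^ (2 * r - j) + q ^ (2 * r - j) := by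
        apply add_le_add
        · refine Finset.card_biUnion_le.trans ((Finset.sum_le_sum h1).trans ?_)
          rw [Finset.sum_const, smul_eq_mul, Finset.card_range]
        · rw [Finset.card_product, h.card_le_val (by omega), h.card_le_val (by omega), ← pow_add]
          exact h.pow_le_pow_q (by omega)
    _ = (j - i + 1) * q ^ (2 * r - j) := by ring
    _ ≤ _ := by gcongr; omega

/-- The number of elements of `SL₂` in given congruence classes. -/
lemma pow_mul_card_sl_le {i j : ℕ} (hij : i ≤ j) (hj : j ≤ r) [Fintype (SL2 R)] :
    q ^ (i + j) * (Finset.univ.filter fun k : SL2 R => IsUnit (k 0 0) ∧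
      i ≤ h.val (k 0 1) ∧ i ≤ h.val (k 1 0) ∧ j ≤ h.val (k 1 1 - k 0 0)).card ≤
      2 * (r + 1) * q ^ (3 * r) := by
  obtain ⟨S, hS⟩ : ∃ S : Finset (R × (R × R)), S = Finset.univ.filter fun p : R × (R × R) =>
    i ≤ h.val p.2.1 ∧ i ≤ h.val p.2.2 ∧ j ≤ h.val (p.2.1 * p.2.2 - (p.1 ^ 2 - 1)) := ⟨_, rfl⟩
  have hle : (Finset.univ.filter fun k : SL2 R => IsUnit (k 0 0) ∧
      i ≤ h.val (k 0 1) ∧ i ≤ h.val (k 1 0) ∧ j ≤ h.val (k 1 1 - k 0 0)).card ≤ S.card := by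
    refine Finset.card_le_card_of_injOn (fun k => (k 0 0, (k 0 1, k 1 0))) ?_ ?_
    · intro k hk
      simp only [hS, Finset.coe_filter, Finset.mem_univ, true_and, Set.mem_ofPred_eq] at hk ⊢
      refine ⟨hk.2.1, hk.2.2.1, ?_⟩
      have h1 : k 0 1 * k 1 0 - (k 0 0 ^ 2 - 1) = k 0 0 * (k 1 1 - k 0 0) := by
        linear_combination -sl_det k
      rw [h1, h.val_mul]
      omega
    · intro k hk k' hk' heq
      simp only [Finset.coe_filter, Finset.mem_univ, true_and, Set.mem_ofPred_eq] at hk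
      simp only [Prod.mk.injEq] at heq
      obtain ⟨h00, h01, h10⟩ := heq
      refine sl_ext h00 h01 h10 (hk.1.mul_left_cancel ?_)
      have h1 := sl_det k
      have h3 := sl_det k'
      rw [← h00, ← h01, ← h10] at h3
      linear_combination h1 - h3
  refine (Nat.mul_le_mul_left _ hle).trans ?_
  rcases le_total j (2 * i) with hji | hji
  · have hsub : S ⊆ (Finset.univ.filter fun x : R => j ≤ h.val (x ^ 2 - 1)) ×ˢ
        ((Finset.univ.filter fun x : R => i ≤ h.val x) ×ˢ
        (Finset.univ.filter fun x : R => i ≤ h.val x)) := by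
      intro p hp
      simp only [hS, Finset.mem_filter, Finset.mem_univ, true_and, Finset.mem_product] at hp ⊢
      refine ⟨?_, hp.1, hp.2.1⟩
      have h1 := h.le_val_sub (j := j) (x := p.2.1 * p.2.2) (by rw [h.val_mul]; omega) hp.2.2
      rwa [sub_sub_cancel] at h1
    calc _ ≤ q ^ (i + j) * (2 * q ^ (r - (j + 1) / 2) * (q ^ (r - i) * q ^ (r - i))) := by
          refine Nat.mul_le_mul_left _ ((Finset.card_le_card hsub).trans ?_)
          rw [Finset.card_product, Finset.card_product, h.card_le_val (by omega)]
          gcongr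
          exact h.card_sq_le hj 1
      _ = 2 * q ^ (i + j + (r - (j + 1) / 2) + (r - i) + (r - i)) := by
          simp only [pow_add]; ring
      _ ≤ 2 * q ^ (3 * r) := by
          gcongr 2 * ?_
          exact h.pow_le_pow_q (by omega)
      _ ≤ _ := by gcongr; omega
  · have hcard : S.card = ∑ a : R, (Finset.univ.filter fun p : R × R =>
        i ≤ h.val p.1 ∧ i ≤ h.val p.2 ∧ j ≤ h.val (p.1 * p.2 - (a ^ 2 - 1))).card := by
      rw [hS]
      simp only [Finset.card_filter]
      rw [Fintype.sum_prod_type]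
    have hle2 : ∀ a : R, (Finset.univ.filter fun p : R × R =>
        i ≤ h.val p.1 ∧ i ≤ h.val p.2 ∧ j ≤ h.val (p.1 * p.2 - (a ^ 2 - 1))).card ≤
        if 2 * i ≤ h.val (a ^ 2 - 1) then (r + 1) * q ^ (2 * r - j) else 0 := by
      intro a
      split_ifs with hif
      · exact card_mul_congr_le h hji hj _
      · rw [Finset.filter_eq_empty_iff.mpr]
        · simp
        · intro p _ hp
          apply hif
          have h1 := h.le_val_sub (j := 2 * i) (x := p.1 * p.2)
            (y := p.1 * p.2 - (a ^ 2 - 1)) (by rw [h.val_mul]; omega) (by omega)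
          rwa [sub_sub_cancel] at h1
    calc _ ≤ q ^ (i + j) * (2 * q ^ (r - (2 * i + 1) / 2) * ((r + 1) * q ^ (2 * r - j))) := by
          refine Nat.mul_le_mul_left _ ?_
          rw [hcard]
          refine (Finset.sum_le_sum fun a _ => hle2 a).trans ?_
          rw [← Finset.sum_filter, Finset.sum_const, smul_eq_mul]
          exact Nat.mul_le_mul_right _ (h.card_sq_le (by omega) 1)
      _ = 2 * (r + 1) * q ^ (i + j + (r - (2 * i + 1) / 2) + (2 * r - j)) := by
          simp only [pow_add]; ring
      _ ≤ _ := by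
          gcongr 2 * (r + 1) * ?_
          exact h.pow_le_pow_q (by omega)

omit h in
/-- Grouping the solutions `(g, k, z)` by `k`. -/
lemma card_solutions_le_sum [Fintype (SL2 R)] :
    Nat.card {p : (SL2 R × SL2 R) × SL2 R //
      p.1.1 * p.1.2⁻¹ * p.1.1⁻¹ * p.1.2 * (p.2 * slTwist p.2) = 1} ≤
      ∑ k : SL2 R, slCentralizerCount k * slTwistedCount k := by
  have hiff : ∀ g k z : SL2 R, g * k⁻¹ * g⁻¹ * k * (z * slTwist z) = 1 →
      g * k = k * (z * slTwist z) * g := by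
    intro g k z hz
    have h1 : z * slTwist z = (g * k⁻¹ * g⁻¹ * k)⁻¹ := (inv_eq_of_mul_eq_one_right hz).symm
    rw [h1]
    group
  have hw : ∀ z : SL2 R, !![z 0 0, -z 0 1; z 1 0, -z 1 1] * !![z 0 0, -z 0 1; z 1 0, -z 1 1] =
      ((z * slTwist z : SL2 R) : Matrix (Fin 2) (Fin 2) R) := by
    intro z
    rw [Matrix.mul_fin_two]
    ext a b
    have := sl_mul_apply z (slTwist z) a b
    rw [this]
    fin_cases a <;> fin_cases b <;>
      simp [slTwist_00, slTwist_01, slTwist_10, slTwist_11]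
  -- For fixed `k` and `z` the solutions `g` are a coset of the centralizer of `k`, or none.
  have hchoice : ∀ k z : SL2 R, ∃ g0 : SL2 R, ∀ g, g * k = k * (z * slTwist z) * g →
      g0 * k = k * (z * slTwist z) * g0 := by
    intro k z
    by_cases hex : ∃ g, g * k = k * (z * slTwist z) * g
    · exact ⟨hex.choose, fun _ _ => hex.choose_spec⟩
    · exact ⟨1, fun g hg => absurd ⟨g, hg⟩ hex⟩
  choose G hG using hchoice
  have hsum : ∑ k : SL2 R, slCentralizerCount k * slTwistedCount k =
      Nat.card ((k : SL2 R) × ({g : SL2 R // g * k = k * g} ×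
        {w : Matrix (Fin 2) (Fin 2) R //
          w.det = -1 ∧ ∃ g : SL2 R, (g * k : Matrix (Fin 2) (Fin 2) R) = k * (w * w) * g})) := by
    rw [Nat.card_sigma]
    refine Finset.sum_congr rfl fun k _ => ?_
    rw [Nat.card_prod]
    rfl
  rw [hsum]
  refine Nat.card_le_card_of_injective (fun p => ⟨p.1.1.2,
    (⟨(G p.1.1.2 p.1.2)⁻¹ * p.1.1.1, ?_⟩,
      ⟨!![p.1.2 0 0, -p.1.2 0 1; p.1.2 1 0, -p.1.2 1 1], ?_, p.1.1.1, ?_⟩)⟩) ?_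
  · obtain ⟨⟨⟨g, k⟩, z⟩, hp⟩ := p
    have h1 := hiff g k z hp
    have h3 := hG k z g h1
    dsimp only
    have h4 : k * (z * slTwist z) = G k z * k * (G k z)⁻¹ := by rw [h3, mul_inv_cancel_right]
    rw [mul_assoc, h1, h4]
    group
  · have := sl_det p.1.2
    rw [Matrix.det_fin_two_of]
    linear_combination -this
  · rw [hw, ← Matrix.SpecialLinearGroup.coe_mul, ← Matrix.SpecialLinearGroup.coe_mul,
      ← Matrix.SpecialLinearGroup.coe_mul, hiff _ _ _ p.2]
  · rintro ⟨⟨⟨g, k⟩, z⟩, hp⟩ ⟨⟨⟨g', k'⟩, z'⟩, hp'⟩ heq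
    simp only [Sigma.mk.injEq] at heq
    obtain ⟨hk, heq⟩ := heq
    subst hk
    have heq := eq_of_heq heq
    simp only [Prod.mk.injEq, Subtype.mk.injEq] at heq
    have e (x y : Fin 2) := congrFun (congrFun heq.2 x) y
    have hz : z = z' := by
      have e00 := e 0 0
      have e01 := e 0 1
      have e10 := e 1 0
      have e11 := e 1 1
      simp at e00 e01 e10 e11
      exact sl_ext e00 e01 e10 e11
    subst hz
    have hg := mul_left_cancel heq.1
    subst hg
    rfl

include h2 in
/-- The number of solutions is, up to a polynomial factor in `r`, at most `q ^ (6 r)`. -/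
theorem card_solutions_le [Fintype (SL2 R)] :
    Nat.card {p : (SL2 R × SL2 R) × SL2 R //
      p.1.1 * p.1.2⁻¹ * p.1.1⁻¹ * p.1.2 * (p.2 * slTwist p.2) = 1} ≤
      64 * (r + 1) ^ 9 * q ^ (6 * r + 2 * e0) := by
  obtain ⟨F, hF⟩ : ∃ F : SL2 R → ℕ, F = fun k => slCentralizerCount k * slTwistedCount k :=
    ⟨_, rfl⟩
  obtain ⟨U, hU⟩ : ∃ U, U = Finset.univ.filter fun k : SL2 R => IsUnit (k 0 0) := ⟨_, rfl⟩
  -- Elements with a nonunit upper left entry are conjugate to elements of `U`.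
  have hnon : ∑ k ∈ Finset.univ.filter (fun k : SL2 R => ¬ IsUnit (k 0 0)), F k ≤ ∑ k ∈ U, F k := by
    obtain ⟨u, hu⟩ : ∃ u : SL2 R, u = slUpper (.ofAdd 1) := ⟨_, rfl⟩
    obtain ⟨c, hc⟩ : ∃ c : SL2 R → SL2 R, ∀ k, c k = u * k * u⁻¹ := ⟨_, fun _ => rfl⟩
    calc _ ≤ ∑ k ∈ Finset.univ.filter (fun k : SL2 R => ¬ IsUnit (k 0 0)), F (c k) := by
          refine Finset.sum_le_sum fun k _ => ?_
          rw [hF]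
          refine slCounts_mul_le_of_conj (P := ((u⁻¹ : SL2 R) : Matrix (Fin 2) (Fin 2) R))
            (Q := (u : Matrix (Fin 2) (Fin 2) R)) ?_ ?_
          · rw [← Matrix.SpecialLinearGroup.coe_mul, inv_mul_cancel,
              Matrix.SpecialLinearGroup.coe_one]
          · rw [← Matrix.SpecialLinearGroup.coe_mul, ← Matrix.SpecialLinearGroup.coe_mul, hc]
            rw [mul_assoc u, inv_mul_cancel_left]
      _ = ∑ k ∈ (Finset.univ.filter (fun k : SL2 R => ¬ IsUnit (k 0 0))).image c, F k := by
          rw [Finset.sum_image]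
          intro x _ y _ hxy
          rw [hc, hc] at hxy
          simpa using hxy
      _ ≤ ∑ k ∈ U, F k := by
          refine Finset.sum_le_sum_of_subset ?_
          intro k hk
          rw [Finset.mem_image] at hk
          obtain ⟨k, hk, rfl⟩ := hk
          rw [Finset.mem_filter] at hk
          rw [hU, Finset.mem_filter]
          refine ⟨Finset.mem_univ _, ?_⟩
          have h00 : (c k) 0 0 = k 0 0 + k 1 0 := by
            have h1 : c k * u = u * k := by rw [hc]; group
            have h3 : (c k * u) 0 0 = (u * k) 0 0 := by rw [h1]
            rw [sl_mul_apply, sl_mul_apply, hu, slUpper_00, slUpper_10, slUpper_01] at h3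
            linear_combination h3
          have hnu := hk.2
          rw [← h.val_eq_zero_iff] at hnu
          rw [h00, ← h.val_eq_zero_iff]
          by_contra hne
          have hr := h.val_le (k 0 0)
          have h10 := h.le_val_sub (j := 1) (x := k 0 0 + k 1 0) (y := k 0 0) (by omega) (by omega)
          rw [add_sub_cancel_left] at h10
          have h1 := h.le_val_sub (j := 1) (x := k 0 0 * k 1 1) (y := k 0 1 * k 1 0)
            (by rw [h.val_mul]; omega) (by rw [h.val_mul]; omega)
          rw [sl_det, h.val_one] at h1
          omega
  have hUsum : ∑ k ∈ U, F k ≤ 32 * (r + 1) ^ 9 * q ^ (6 * r + 2 * e0) := by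
    obtain ⟨C, hC⟩ : ∃ C, C = 16 * (r + 1) ^ 6 * q ^ (3 * r + 2 * e0) := ⟨_, rfl⟩
    calc _ ≤ ∑ k ∈ U, ∑ i ∈ Finset.range (r + 1), ∑ j ∈ Finset.range (r + 1),
          (if i ≤ j ∧ i ≤ h.val (k 0 1) ∧ i ≤ h.val (k 1 0) ∧ j ≤ h.val (k 1 1 - k 0 0) then
            C * q ^ (i + j) else 0) := by
          refine Finset.sum_le_sum fun k hk => ?_
          rw [hU, Finset.mem_filter] at hk
          obtain ⟨i, j, hij, hj, h01, h10, h11, hle⟩ := slCounts_mul_le h h2 hk.2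
          refine le_trans ?_ (Finset.single_le_sum (f := fun i => ∑ j ∈ Finset.range (r + 1),
            (if i ≤ j ∧ i ≤ h.val (k 0 1) ∧ i ≤ h.val (k 1 0) ∧ j ≤ h.val (k 1 1 - k 0 0) then
            C * q ^ (i + j) else 0)) (fun _ _ => Nat.zero_le _) (a := i)
            (by rw [Finset.mem_range]; omega))
          refine le_trans ?_ (Finset.single_le_sum (f := fun j =>
            (if i ≤ j ∧ i ≤ h.val (k 0 1) ∧ i ≤ h.val (k 1 0) ∧ j ≤ h.val (k 1 1 - k 0 0) then
            C * q ^ (i + j) else 0)) (fun _ _ => Nat.zero_le _) (a := j)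
            (by rw [Finset.mem_range]; omega))
          rw [if_pos ⟨hij, h01, h10, h11⟩, hF]
          refine hle.trans (le_of_eq ?_)
          rw [hC, mul_assoc (16 * _), ← pow_add]
          congr 2
          ring
      _ = ∑ i ∈ Finset.range (r + 1), ∑ j ∈ Finset.range (r + 1), ∑ k ∈ U,
          (if i ≤ j ∧ i ≤ h.val (k 0 1) ∧ i ≤ h.val (k 1 0) ∧ j ≤ h.val (k 1 1 - k 0 0) then
            C * q ^ (i + j) else 0) := by
          rw [Finset.sum_comm]
          exact Finset.sum_congr rfl fun i _ => Finset.sum_comm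
      _ ≤ ∑ i ∈ Finset.range (r + 1), ∑ j ∈ Finset.range (r + 1),
          C * (2 * (r + 1) * q ^ (3 * r)) := by
          refine Finset.sum_le_sum fun i _ => Finset.sum_le_sum fun j hj => ?_
          rw [Finset.mem_range] at hj
          by_cases hij : i ≤ j
          · rw [hU, ← Finset.sum_filter, Finset.filter_filter, Finset.sum_const, smul_eq_mul]
            simp only [hij, true_and]
            have := pow_mul_card_sl_le h hij (by omega)
            calc _ = C * (q ^ (i + j) * _) := by rw [mul_comm, mul_assoc]
              _ ≤ _ := Nat.mul_le_mul_left _ this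
          · rw [Finset.sum_eq_zero]
            · exact Nat.zero_le _
            · intro k _
              rw [if_neg (fun h => hij h.1)]
      _ = _ := by
          simp only [Finset.sum_const, Finset.card_range, smul_eq_mul]
          have : 6 * r + 2 * e0 = (3 * r + 2 * e0) + 3 * r := by ring
          rw [hC, this, pow_add q (3 * r + 2 * e0)]
          ring
  calc _ ≤ ∑ k, F k := by rw [hF]; exact card_solutions_le_sum
    _ = ∑ k ∈ U, F k + ∑ k ∈ Finset.univ.filter (fun k : SL2 R => ¬ IsUnit (k 0 0)), F k := by
        rw [hU, Finset.sum_filter_add_sum_filter_not]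
    _ ≤ ∑ k ∈ U, F k + ∑ k ∈ U, F k := by gcongr
    _ ≤ _ := by
        have := hUsum
        linarith

end Bound

/-! ### Orders of groups and sets of involutions -/

section Orders
open scoped Classical

variable {R : Type*} [CommRing R] [Fintype R] {ϖ : R} {q r : ℕ} (h : IsChainRing R ϖ q r)
include h

lemma card_sl_le [Fintype (SL2 R)] : Fintype.card (SL2 R) ≤ 2 * q ^ (3 * r) := by
  have hU : (Finset.univ.filter fun k : SL2 R => IsUnit (k 0 0)).card ≤ q ^ (3 * r) := by
    have h1 : q ^ (3 * r) = (Finset.univ : Finset (R × R × R)).card := by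
      rw [Finset.card_univ, Fintype.card_prod, Fintype.card_prod, h.card_eq, ← pow_add, ← pow_add]
      congr 1; ring
    rw [h1]
    refine Finset.card_le_card_of_injOn (fun k => (k 0 0, k 0 1, k 1 0))
      (fun _ _ => Finset.mem_coe.mpr (Finset.mem_univ _)) ?_
    intro k hk k' hk' heq
    simp only [Finset.coe_filter, Finset.mem_univ, true_and, Set.mem_ofPred_eq] at hk
    simp only [Prod.mk.injEq] at heq
    obtain ⟨h00, h01, h10⟩ := heq
    refine sl_ext h00 h01 h10 (hk.mul_left_cancel ?_)
    have h1 := sl_det k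
    have h3 := sl_det k'
    rw [← h00, ← h01, ← h10] at h3
    linear_combination h1 - h3
  have hV : (Finset.univ.filter fun k : SL2 R => ¬ IsUnit (k 0 0)).card ≤
      (Finset.univ.filter fun k : SL2 R => IsUnit (k 0 0)).card := by
    refine Finset.card_le_card_of_injOn (fun k => slUpper (.ofAdd 1) * k) ?_
      (fun x _ y _ hxy => by simpa using hxy)
    intro k hk
    simp only [Finset.coe_filter, Finset.mem_univ, true_and, Set.mem_ofPred_eq] at hk ⊢
    rw [sl_mul_apply, slUpper_00, slUpper_01, one_mul, one_mul, ← h.val_eq_zero_iff]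
    rw [← h.val_eq_zero_iff] at hk
    by_contra hne
    have hr := h.val_le (k 0 0)
    have h10 := h.le_val_sub (j := 1) (x := k 0 0 + k 1 0) (y := k 0 0) (by omega) (by omega)
    rw [add_sub_cancel_left] at h10
    have h1 := h.le_val_sub (j := 1) (x := k 0 0 * k 1 1) (y := k 0 1 * k 1 0)
      (by rw [h.val_mul]; omega) (by rw [h.val_mul]; omega)
    rw [sl_det, h.val_one] at h1
    omega
  have h1 := Finset.card_filter_add_card_filter_not (s := (Finset.univ : Finset (SL2 R)))
      (fun k => IsUnit (k 0 0))
  rw [Finset.card_univ] at h1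
  omega

lemma le_two_mul_card_sl [Fintype (SL2 R)] : q ^ (3 * r) ≤ 2 * Fintype.card (SL2 R) := by
  have h1 : ((Finset.univ.filter fun x : R => h.val x = 0) ×ˢ (Finset.univ : Finset (R × R))).card ≤
      (Finset.univ : Finset (SL2 R)).card := by
    refine Finset.card_le_card_of_injOn (fun p => if hp : IsUnit p.1 then
      slMk p.1 p.2.1 p.2.2 ((hp.unit⁻¹ : Rˣ) * (1 + p.2.1 * p.2.2))
        (by rw [← mul_assoc, IsUnit.mul_val_inv]; ring) else 1)
      (fun _ _ => Finset.mem_coe.mpr (Finset.mem_univ _)) ?_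
    rintro ⟨a, b, c⟩ hp ⟨a', b', c'⟩ hp' heq
    simp only [Finset.coe_product, Set.mem_prod, Finset.coe_filter, Finset.mem_univ, true_and,
      Set.mem_ofPred_eq, h.val_eq_zero_iff] at hp hp'
    simp only [hp.1, hp'.1, dif_pos] at heq
    have e00 := congrArg (fun g : SL2 R => g 0 0) heq
    have e01 := congrArg (fun g : SL2 R => g 0 1) heq
    have e10 := congrArg (fun g : SL2 R => g 1 0) heq
    simp only [slMk_00, slMk_01, slMk_10] at e00 e01 e10
    rw [e00, e01, e10]
  rw [Finset.card_product, Finset.card_univ, Finset.card_univ, Fintype.card_prod, h.card_eq] at h1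
  have h3 := h.card_le_two_mul_card_units
  calc q ^ (3 * r) = q ^ r * (q ^ r * q ^ r) := by rw [← pow_add, ← pow_add]; congr 1; ring
    _ ≤ 2 * (Finset.univ.filter fun x : R => h.val x = 0).card * (q ^ r * q ^ r) := by gcongr
    _ ≤ _ := by rw [mul_assoc]; gcongr

/-- All matrices `(a, b; c, a)` of determinant `1` are twisted involutions. -/
lemma le_two_mul_card_twisted_involutions :
    q ^ (2 * r) ≤ 2 * Nat.card {z : SL2 R // z * slTwist z = 1} := by
  have h1 : Nat.card ({x : R // IsUnit x} × R) ≤ Nat.card {z : SL2 R // z * slTwist z = 1} := by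
    refine Nat.card_le_card_of_injective (fun p => ⟨slMk p.2 p.1.1
      ((p.1.2.unit⁻¹ : Rˣ) * (p.2 ^ 2 - 1)) p.2
        (by rw [← mul_assoc, IsUnit.mul_val_inv]; ring), ?_⟩) ?_
    · have hu := p.1.2.mul_val_inv
      apply sl_ext <;> simp only [sl_mul_apply, slTwist_00, slTwist_01, slTwist_10, slTwist_11,
        slMk_00, slMk_01, slMk_10, slMk_11, sl_one_00, sl_one_01, sl_one_10, sl_one_11]
      · linear_combination (1 - p.2 ^ 2) * hu
      · ring
      · ring
      · linear_combination (1 - p.2 ^ 2) * hu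
    · rintro ⟨⟨b, hb⟩, a⟩ ⟨⟨b', hb'⟩, a'⟩ heq
      have heq := congrArg Subtype.val heq
      have e00 := congrArg (fun g : SL2 R => g 0 0) heq
      have e01 := congrArg (fun g : SL2 R => g 0 1) heq
      simp only [slMk_00, slMk_01] at e00 e01
      subst e00
      subst e01
      rfl
  have h3 : Nat.card {x : R // IsUnit x} = (Finset.univ.filter fun x : R => h.val x = 0).card := by
    rw [Nat.card_eq_fintype_card, Fintype.card_subtype]
    simp only [h.val_eq_zero_iff]
  rw [Nat.card_prod, h3, Nat.card_eq_fintype_card (α := R), h.card_eq] at h1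
  have h4 := h.card_le_two_mul_card_units
  calc q ^ (2 * r) = q ^ r * q ^ r := by rw [← pow_add]; congr 1; ring
    _ ≤ 2 * (Finset.univ.filter fun x : R => h.val x = 0).card * q ^ r := by gcongr
    _ ≤ _ := by rw [mul_assoc]; gcongr

/-- The sum of the inverse dimensions grows at most polynomially with the level. -/
theorem sum_inv_size_le [Fintype (SL2 R)] {e0 : ℕ} (h2 : (2 : R) = 0 ∨ h.val 2 ≤ e0)
    (hfs : HasTrivialTwistedIndicators R) (W : WedderburnDecomposition (SL2 R)) :
    ∑ i, (W.size i : ℝ)⁻¹ ≤ 256 * (r + 1) ^ 9 * (q : ℝ) ^ (2 * e0) := by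
  have h1 := W.sum_inv_size (τ := slTwist)
    (fun i => hfs _ (W.rep i) (W.size_ne_zero i) (W.span_range_rep i))
  have h3 : ((Nat.card {p : (SL2 R × SL2 R) × SL2 R //
      p.1.1 * p.1.2⁻¹ * p.1.1⁻¹ * p.1.2 * (p.2 * slTwist p.2) = 1} : ℕ) : ℝ) ≤
      64 * (r + 1) ^ 9 * (q : ℝ) ^ (6 * r + 2 * e0) := by
    exact_mod_cast card_solutions_le h h2
  rw [← h1] at h3
  have h4 : (q : ℝ) ^ (3 * r) ≤ 2 * Fintype.card (SL2 R) := by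
    exact_mod_cast le_two_mul_card_sl h
  have hq : (0 : ℝ) < (q : ℝ) ^ (3 * r) := by
    have := h.two_le
    have : (0 : ℝ) < q := by exact_mod_cast (by omega : 0 < q)
    positivity
  have hnn : 0 ≤ ∑ i, (W.size i : ℝ)⁻¹ := Finset.sum_nonneg fun i _ => by positivity
  have h5 : ((q : ℝ) ^ (3 * r)) ^ 2 * ∑ i, (W.size i : ℝ)⁻¹ ≤
      ((q : ℝ) ^ (3 * r)) ^ 2 * (256 * (r + 1) ^ 9 * (q : ℝ) ^ (2 * e0)) := by
    calc _ ≤ (2 * (Fintype.card (SL2 R) : ℝ)) ^ 2 * ∑ i, (W.size i : ℝ)⁻¹ := by gcongr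
      _ = 4 * ((Fintype.card (SL2 R) : ℝ) ^ 2 * ∑ i, (W.size i : ℝ)⁻¹) := by ring
      _ ≤ 4 * (64 * (r + 1) ^ 9 * (q : ℝ) ^ (6 * r + 2 * e0)) := by gcongr
      _ = _ := by
        rw [← pow_mul, pow_add, show 3 * r * 2 = 6 * r by ring]; ring
  exact le_of_mul_le_mul_left h5 (by positivity)

lemma le_sum_size [Fintype (SL2 R)] (hfs : HasTrivialTwistedIndicators R)
    (W : WedderburnDecomposition (SL2 R)) : (q : ℝ) ^ (2 * r) ≤ 2 * ∑ i, (W.size i : ℝ) := by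
  rw [W.sum_size (τ := slTwist)
    (fun i => hfs _ (W.rep i) (W.size_ne_zero i) (W.span_range_rep i))]
  exact_mod_cast le_two_mul_card_twisted_involutions h

lemma sum_size_sq_le [Fintype (SL2 R)] (W : WedderburnDecomposition (SL2 R)) :
    ∑ i, (W.size i : ℝ) ^ 2 ≤ 2 * (q : ℝ) ^ (3 * r) := by
  rw [W.sum_size_sq]
  exact_mod_cast card_sl_le h

end Orders

/-! ### The finite quotients of a complete discrete valuation ring -/

section Level

open IsLocalRing

/-- The quotient of `𝔬` by the `r`-th power of its maximal ideal. -/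
abbrev LevelRing (𝔬 : Type*) [CommRing 𝔬] [IsLocalRing 𝔬] (r : ℕ) : Type _ :=
  𝔬 ⧸ maximalIdeal 𝔬 ^ r

variable (𝔬 : Type*) [CommRing 𝔬] [IsDomain 𝔬] [IsDiscreteValuationRing 𝔬]
  [Finite (ResidueField 𝔬)]

omit [Finite (ResidueField 𝔬)] in
lemma natCard_levelRing (r : ℕ) : Nat.card (LevelRing 𝔬 r) = Nat.card (ResidueField 𝔬) ^ r := by
  have h := cardQuot_pow_of_prime (P := maximalIdeal 𝔬)
    (IsDiscreteValuationRing.not_a_field 𝔬) (i := r)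
  rwa [Submodule.cardQuot_apply, Submodule.cardQuot_apply] at h

instance finite_levelRing (r : ℕ) : Finite (LevelRing 𝔬 r) := by
  apply Nat.finite_of_card_ne_zero
  rw [natCard_levelRing]
  exact pow_ne_zero _ Nat.card_pos.ne'

omit [Finite (ResidueField 𝔬)] in
variable {𝔬} in
lemma mk_eq_zero_iff_pow_dvd {ϖ : 𝔬} (hϖ : Irreducible ϖ) (r : ℕ) (x : 𝔬) :
    Ideal.Quotient.mk (maximalIdeal 𝔬 ^ r) x = 0 ↔ ϖ ^ r ∣ x := by
  rw [Ideal.Quotient.eq_zero_iff_mem, hϖ.maximalIdeal_eq, Ideal.span_singleton_pow,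
    Ideal.mem_span_singleton]

variable {𝔬} in
theorem isChainRing_levelRing {ϖ : 𝔬} (hϖ : Irreducible ϖ) (r : ℕ) :
    IsChainRing (LevelRing 𝔬 r) (Ideal.Quotient.mk _ ϖ) (Nat.card (ResidueField 𝔬)) r := by
  have hzero := mk_eq_zero_iff_pow_dvd hϖ
  refine ⟨?_, ?_, ?_, ?_⟩
  · intro x
    obtain ⟨y, rfl⟩ := Ideal.Quotient.mk_surjective x
    by_cases hy : Ideal.Quotient.mk (maximalIdeal 𝔬 ^ r) y = 0
    · refine ⟨r, le_rfl, 1, ?_⟩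
      rw [hy, ← map_pow, (hzero r _).mpr dvd_rfl, zero_mul]
    · have hy0 : y ≠ 0 := by rintro rfl; exact hy (map_zero _)
      obtain ⟨n, u, rfl⟩ := IsDiscreteValuationRing.eq_unit_mul_pow_irreducible hy0 hϖ
      refine ⟨n, ?_, Units.map (Ideal.Quotient.mk (maximalIdeal 𝔬 ^ r)).toMonoidHom u, ?_⟩
      · by_contra! hlt
        apply hy
        rw [hzero]
        exact (pow_dvd_pow _ hlt.le).mul_left _
      · rw [map_mul, map_pow, mul_comm]
        rfl
  · rw [← map_pow, (hzero r _).mpr dvd_rfl]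
  · intro j hj
    obtain ⟨F, hF⟩ : ∃ F : LevelRing 𝔬 r →+* LevelRing 𝔬 j,
      F = Ideal.Quotient.factor (Ideal.pow_le_pow_right hj) := ⟨_, rfl⟩
    have hFs : Function.Surjective F := by rw [hF]; exact Ideal.Quotient.factor_surjective _
    have hker : ∀ x : LevelRing 𝔬 r, Ideal.Quotient.mk _ ϖ ^ j ∣ x ↔
        x ∈ F.toAddMonoidHom.ker := by
      intro x
      obtain ⟨y, rfl⟩ := Ideal.Quotient.mk_surjective x
      have h1 : Ideal.Quotient.mk (maximalIdeal 𝔬 ^ r) y ∈ F.toAddMonoidHom.ker ↔ ϖ ^ j ∣ y := by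
        rw [← hzero j, AddMonoidHom.mem_ker, hF]
        rfl
      rw [h1]
      constructor
      · rintro ⟨z, hz⟩
        obtain ⟨z, rfl⟩ := Ideal.Quotient.mk_surjective z
        rw [← map_pow, ← map_mul, ← sub_eq_zero, ← map_sub, hzero] at hz
        have h2 := (pow_dvd_pow ϖ hj).trans hz
        exact (dvd_sub_left (dvd_mul_right _ _)).mp h2
      · intro hy
        rw [← map_pow]
        exact map_dvd _ hy
    rw [Nat.card_congr (Equiv.subtypeEquivRight hker)]
    have h1 := F.toAddMonoidHom.ker.card_eq_card_quotient_mul_card_addSubgroup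
    rw [Nat.card_congr (QuotientAddGroup.quotientKerEquivOfSurjective F.toAddMonoidHom hFs).toEquiv,
      natCard_levelRing, natCard_levelRing] at h1
    have hq : 0 < Nat.card (ResidueField 𝔬) ^ j := pow_pos Nat.card_pos _
    apply Nat.eq_of_mul_eq_mul_left hq
    rw [← pow_add, Nat.add_sub_cancel' hj, h1]
  · exact Finite.one_lt_card

/-- The valuation of `2` is bounded independently of the level, unless `2` vanishes. -/
lemma exists_val_two_le {ϖ : 𝔬} (hϖ : Irreducible ϖ) : ∃ e0 : ℕ, ∀ r : ℕ,
    (2 : LevelRing 𝔬 r) = 0 ∨ (isChainRing_levelRing hϖ r).val 2 ≤ e0 := by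
  by_cases h2 : (2 : 𝔬) = 0
  · refine ⟨0, fun r => Or.inl ?_⟩
    have := congrArg (Ideal.Quotient.mk (maximalIdeal 𝔬 ^ r)) h2
    rwa [map_ofNat, map_zero] at this
  · obtain ⟨n, u, hu⟩ := IsDiscreteValuationRing.eq_unit_mul_pow_irreducible h2 hϖ
    refine ⟨n, fun r => Or.inr ?_⟩
    have h := isChainRing_levelRing hϖ r
    rcases le_total n r with hn | hn
    · have h3 := congrArg (Ideal.Quotient.mk (maximalIdeal 𝔬 ^ r)) hu
      rw [map_ofNat, map_mul, map_pow, mul_comm] at h3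
      rw [h3]
      exact (h.val_eq hn (Units.map (Ideal.Quotient.mk (maximalIdeal 𝔬 ^ r)).toMonoidHom u)).le
    · exact (h.val_le 2).trans hn

omit [IsDomain 𝔬] [IsDiscreteValuationRing 𝔬] [Finite (ResidueField 𝔬)] in
/-- Reduction `SL₂(𝔬) → SL₂(𝔬 / 𝔪 ^ r)` is surjective. -/
lemma map_mk_surjective [IsLocalRing 𝔬] (r : ℕ) : Function.Surjective
    (Matrix.SpecialLinearGroup.map (n := Fin 2) (Ideal.Quotient.mk (maximalIdeal 𝔬 ^ r))) := by
  rcases Nat.eq_zero_or_pos r with rfl | hr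
  · intro g
    refine ⟨1, ?_⟩
    have : Subsingleton (𝔬 ⧸ maximalIdeal 𝔬 ^ 0) := by
      rw [pow_zero]; exact Ideal.Quotient.subsingleton_iff.mpr Ideal.one_eq_top
    apply sl_ext <;> exact Subsingleton.elim _ _
  · intro g
    obtain ⟨f, hf⟩ : ∃ f, f = Ideal.Quotient.mk (maximalIdeal 𝔬 ^ r) := ⟨_, rfl⟩
    rw [← hf]
    have hfs : Function.Surjective f := by rw [hf]; exact Ideal.Quotient.mk_surjective
    obtain ⟨a, ha⟩ := hfs (g 0 0)
    obtain ⟨b, hb⟩ := hfs (g 0 1)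
    obtain ⟨c, hc⟩ := hfs (g 1 0)
    obtain ⟨d, hd⟩ := hfs (g 1 1)
    have hdet := sl_det g
    rw [← ha, ← hb, ← hc, ← hd] at hdet
    have hmap : ∀ (x : SL2 𝔬) (i j : Fin 2),
        (Matrix.SpecialLinearGroup.map (n := Fin 2) f x) i j = f (x i j) := fun _ _ _ => rfl
    by_cases hau : IsUnit a
    · obtain ⟨u, rfl⟩ := hau
      refine ⟨slMk u b c ((u⁻¹ : 𝔬ˣ) * (1 + b * c)) (by rw [← mul_assoc, Units.mul_inv]; ring), ?_⟩
      have hu : f u * f (u⁻¹ : 𝔬ˣ) = 1 := by rw [← map_mul, Units.mul_inv, map_one]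
      apply sl_ext <;> simp only [hmap, slMk_00, slMk_01, slMk_10, slMk_11, ← ha, ← hb, ← hc, ← hd,
        map_mul, map_add, map_one]
      linear_combination f d * hu - f (u⁻¹ : 𝔬ˣ) * hdet
    · have hcu : IsUnit c := by
        by_contra hcu
        have h1 : a * d - b * c - 1 ∈ maximalIdeal 𝔬 ^ r := by
          rw [← Ideal.Quotient.eq_zero_iff_mem, ← hf, map_sub, map_sub, map_mul, map_mul, map_one,
            hdet, sub_self]
        have h2 := Ideal.pow_le_self hr.ne' h1
        have h3 : a * d - b * c ∈ maximalIdeal 𝔬 := by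
          refine Ideal.sub_mem _ (Ideal.mul_mem_right _ _ ?_) (Ideal.mul_mem_left _ _ ?_)
          · exact (mem_maximalIdeal a).mpr hau
          · exact (mem_maximalIdeal c).mpr hcu
        have h4 := Ideal.sub_mem _ h3 h2
        rw [sub_sub_cancel] at h4
        exact (Ideal.ne_top_iff_one _).mp (maximalIdeal.isMaximal 𝔬).ne_top h4
      obtain ⟨u, rfl⟩ := hcu
      refine ⟨slMk a ((u⁻¹ : 𝔬ˣ) * (a * d - 1)) u d (by
        have := u.mul_inv
        linear_combination (1 - a * d) * this), ?_⟩
      have hu : f u * f (u⁻¹ : 𝔬ˣ) = 1 := by rw [← map_mul, Units.mul_inv, map_one]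
      apply sl_ext <;> simp only [hmap, slMk_00, slMk_01, slMk_10, slMk_11, ← ha, ← hb, ← hc, ← hd,
        map_mul, map_sub, map_one]
      linear_combination f b * hu + f (u⁻¹ : 𝔬ˣ) * hdet

/-- The transition maps `SL₂(𝔬 / 𝔪 ^ (r + 1)) → SL₂(𝔬 / 𝔪 ^ r)`. -/
abbrev levelTransition (r : ℕ) : LevelRing 𝔬 (r + 1) →+* LevelRing 𝔬 r :=
  Ideal.Quotient.factor (Ideal.pow_le_pow_right (Nat.le_succ r))

omit [Finite (ResidueField 𝔬)] in
lemma map_levelTransition_map_mk (r : ℕ) (g : SL2 𝔬) :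
    Matrix.SpecialLinearGroup.map (n := Fin 2) (levelTransition 𝔬 r)
      (Matrix.SpecialLinearGroup.map (n := Fin 2) (Ideal.Quotient.mk (maximalIdeal 𝔬 ^ (r + 1))) g) =
    Matrix.SpecialLinearGroup.map (n := Fin 2) (Ideal.Quotient.mk (maximalIdeal 𝔬 ^ r)) g := by
  apply sl_ext <;> rfl

omit [Finite (ResidueField 𝔬)] in
lemma map_levelTransition_surjective (r : ℕ) : Function.Surjective
    (Matrix.SpecialLinearGroup.map (n := Fin 2) (levelTransition 𝔬 r)) := by
  intro g
  obtain ⟨x, rfl⟩ := map_mk_surjective 𝔬 r g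
  exact ⟨_, map_levelTransition_map_mk 𝔬 r x⟩

variable {𝔬} in
/-- A representation of level exactly `r + 1` is nontrivial on a unipotent element that is close
to `1`. -/
lemma exists_slUpper_ne_one {ϖ : 𝔬} (hϖ : Irreducible ϖ) (r : ℕ) {n : ℕ}
    (ρ : SL2 (LevelRing 𝔬 (r + 1)) →* Matrix (Fin n) (Fin n) ℂ)
    (hker : ¬ (Matrix.SpecialLinearGroup.map (n := Fin 2) (levelTransition 𝔬 r)).ker ≤ ρ.ker) :
    ∃ x, r + 1 ≤ (isChainRing_levelRing hϖ (r + 1)).val x + 1 ∧ ρ (slUpper (.ofAdd x)) ≠ 1 := by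
  by_contra! hcon
  apply hker
  have h := isChainRing_levelRing hϖ (r + 1)
  have hval : ∀ x, levelTransition 𝔬 r x = 0 → r ≤ h.val x := by
    intro x hx
    rw [← h.pow_dvd_iff (Nat.le_succ r)]
    obtain ⟨y, rfl⟩ := Ideal.Quotient.mk_surjective x
    have h1 : Ideal.Quotient.mk (maximalIdeal 𝔬 ^ r) y = 0 := hx
    rw [mk_eq_zero_iff_pow_dvd hϖ] at h1
    rw [← map_pow]
    exact map_dvd _ h1
  intro g hg
  rw [MonoidHom.mem_ker] at hg
  have e (i j : Fin 2) : levelTransition 𝔬 r (g i j) = (1 : SL2 (LevelRing 𝔬 r)) i j := by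
    rw [← hg]; rfl
  refine mem_of_slUpper_mem h ρ.ker (j := r) (fun x hx => ?_) g (hval _ ?_) (hval _ ?_) (hval _ ?_)
  · exact hcon x (by omega)
  · rw [map_sub, e, map_one, sl_one_00, sub_self]
  · rw [e, sl_one_01]
  · rw [e, sl_one_10]

noncomputable instance fintype_slLevel (r : ℕ) : Fintype (SL2 (LevelRing 𝔬 r)) :=
  Fintype.ofFinite _

noncomputable instance fintype_levelRing (r : ℕ) : Fintype (LevelRing 𝔬 r) := Fintype.ofFinite _

/-- All irreducible representations of the groups `SL₂(𝔬 / 𝔪 ^ r)` have twisted Frobenius–Schur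
indicator `1`. -/
theorem hasTrivialTwistedIndicators_levelRing (r : ℕ) :
    HasTrivialTwistedIndicators (LevelRing 𝔬 r) := by
  obtain ⟨ϖ, hϖ⟩ := IsDiscreteValuationRing.exists_irreducible 𝔬
  induction r with
  | zero =>
    intro n ρ hn hρ
    have hsub : Subsingleton (LevelRing 𝔬 0) := by
      have : maximalIdeal 𝔬 ^ 0 = ⊤ := by rw [pow_zero]; exact Ideal.one_eq_top
      exact Ideal.Quotient.subsingleton_iff.mpr this
    have : Subsingleton (SL2 (LevelRing 𝔬 0)) :=
      ⟨fun g g' => by apply sl_ext <;> exact Subsingleton.elim _ _⟩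
    have hne : (1 : Matrix (Fin n) (Fin n) ℂ) ≠ 0 := by
      have : Nonempty (Fin n) := ⟨⟨0, Nat.pos_of_ne_zero hn⟩⟩
      exact one_ne_zero
    exact sum_map_mul_twist hn ρ hρ slTwist slTwist_slTwist 1 (one_mul 1) hne
      (fun g => by rw [Subsingleton.elim (slTwist g)⁻¹ g])
  | succ r ih =>
    intro n ρ hn hρ
    by_cases hker : (Matrix.SpecialLinearGroup.map (n := Fin 2) (levelTransition 𝔬 r)).ker ≤ ρ.ker
    · exact sum_map_mul_slTwist_of_factor _ (map_levelTransition_surjective 𝔬 r) ih hn ρ hρ hker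
    · obtain ⟨x, hx, hne⟩ := exists_slUpper_ne_one hϖ r ρ hker
      exact sum_map_mul_slTwist_of_ne_one ρ hn hρ (isChainRing_levelRing hϖ (r + 1)) hx hne

end Level

/-! ### Continuous representations factor through finite quotients -/

section NoSmallSubgroups

/-- The ball of radius `1 / 2` around `1` contains no nontrivial cyclic submonoid: squaring
increases the distance from `1` by a factor of at least `3 / 2`. -/
lemma eq_one_of_norm_pow_sub_one_le {A : Type*} [NormedRing A] [NormedAlgebra ℝ A] {a : A}
    (h : ∀ k : ℕ, ‖a ^ k - 1‖ ≤ 1 / 2) : a = 1 := by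
  have hstep : ∀ k : ℕ, 3 / 2 * ‖a ^ k - 1‖ ≤ ‖a ^ (2 * k) - 1‖ := by
    intro k
    obtain ⟨y, hy⟩ : ∃ y, y = a ^ k - 1 := ⟨_, rfl⟩
    have h1 : (2 : ℝ) • y = (a ^ (2 * k) - 1) - y * y := by
      rw [two_smul, hy, mul_comm 2 k, pow_mul]
      noncomm_ring
    have h2 : 2 * ‖y‖ ≤ ‖a ^ (2 * k) - 1‖ + ‖y‖ * ‖y‖ := by
      calc 2 * ‖y‖ = ‖(2 : ℝ) • y‖ := by rw [norm_smul]; norm_num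
        _ ≤ ‖a ^ (2 * k) - 1‖ + ‖y * y‖ := by rw [h1]; exact norm_sub_le _ _
        _ ≤ _ := by gcongr; exact norm_mul_le _ _
    have h3 : ‖y‖ ≤ 1 / 2 := by rw [hy]; exact h k
    rw [← hy]
    nlinarith [norm_nonneg y]
  have hiter : ∀ k : ℕ, (3 / 2 : ℝ) ^ k * ‖a - 1‖ ≤ ‖a ^ (2 ^ k) - 1‖ := by
    intro k
    induction k with
    | zero => simp
    | succ k ih =>
      calc (3 / 2 : ℝ) ^ (k + 1) * ‖a - 1‖ = 3 / 2 * ((3 / 2 : ℝ) ^ k * ‖a - 1‖) := by ring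
        _ ≤ 3 / 2 * ‖a ^ (2 ^ k) - 1‖ := by gcongr
        _ ≤ ‖a ^ (2 * 2 ^ k) - 1‖ := hstep _
        _ = _ := by rw [pow_succ' 2 k]
  by_contra hne
  have hpos : 0 < ‖a - 1‖ := norm_pos_iff.mpr (sub_ne_zero.mpr hne)
  obtain ⟨k, hk⟩ := pow_unbounded_of_one_lt (1 / ‖a - 1‖) (by norm_num : (1 : ℝ) < 3 / 2)
  have h1 := (hiter k).trans (h _)
  rw [div_lt_iff₀ hpos] at hk
  linarith

end NoSmallSubgroups

section Factor
open IsLocalRing Topology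

variable {𝔬 : Type*} [CommRing 𝔬] [IsLocalRing 𝔬] [TopologicalSpace 𝔬]
  (h𝔬 : IsAdic (maximalIdeal 𝔬))
include h𝔬

/-- The congruence subgroups form a basis of neighbourhoods of `1`. -/
lemma exists_congruence_subset {U : Set (SL2 𝔬)} (hU : U ∈ 𝓝 1) :
    ∃ r : ℕ, ∀ g : SL2 𝔬, Matrix.SpecialLinearGroup.map (n := Fin 2)
      (Ideal.Quotient.mk (maximalIdeal 𝔬 ^ r)) g = 1 → g ∈ U := by
  obtain ⟨V, hV, hVU⟩ := (mem_nhds_induced Subtype.val _ _).mp hU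
  have hV' : ∃ V' : Set (Fin 2 → Fin 2 → 𝔬), V' = V ∧
      V' ∈ 𝓝 (fun i j => (1 : Matrix (Fin 2) (Fin 2) 𝔬) i j) := ⟨V, rfl, hV⟩
  obtain ⟨V', rfl, hV'⟩ := hV'
  rw [nhds_pi, Filter.mem_pi'] at hV'
  obtain ⟨I, t, ht, htV⟩ := hV'
  have hrow : ∀ i, ∃ r : ℕ, ∀ x : Fin 2 → 𝔬,
      (∀ j, x j - (1 : Matrix (Fin 2) (Fin 2) 𝔬) i j ∈ maximalIdeal 𝔬 ^ r) → x ∈ t i := by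
    intro i
    have h1 := ht i
    rw [nhds_pi, Filter.mem_pi'] at h1
    obtain ⟨J, s, hs, hst⟩ := h1
    have h2 : ∀ j, ∃ r : ℕ, ∀ x : 𝔬,
        x - (1 : Matrix (Fin 2) (Fin 2) 𝔬) i j ∈ maximalIdeal 𝔬 ^ r → x ∈ s j := by
      intro j
      obtain ⟨r, -, hr⟩ := ((h𝔬.hasBasis_nhds _).mem_iff).mp (hs j)
      exact ⟨r, fun x hx => hr ⟨_, hx, add_sub_cancel _ _⟩⟩
    choose r hr using h2
    refine ⟨max (r 0) (r 1), fun x hx => hst fun j _ => hr j _ ?_⟩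
    refine Ideal.pow_le_pow_right ?_ (hx j)
    fin_cases j
    · exact le_max_left _ _
    · exact le_max_right _ _
  choose r hr using hrow
  refine ⟨max (r 0) (r 1), fun g hg => hVU (htV fun i _ => hr i _ fun j => ?_)⟩
  have h1 : g i j - (1 : Matrix (Fin 2) (Fin 2) 𝔬) i j ∈ maximalIdeal 𝔬 ^ max (r 0) (r 1) := by
    rw [← Ideal.Quotient.eq_zero_iff_mem, map_sub, sub_eq_zero]
    have h2 : Ideal.Quotient.mk (maximalIdeal 𝔬 ^ max (r 0) (r 1)) (g i j) =
        (1 : SL2 (𝔬 ⧸ maximalIdeal 𝔬 ^ max (r 0) (r 1))) i j := by rw [← hg]; rfl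
    have h3 : Ideal.Quotient.mk (maximalIdeal 𝔬 ^ max (r 0) (r 1)) ((1 : SL2 𝔬) i j) =
        (1 : SL2 (𝔬 ⧸ maximalIdeal 𝔬 ^ max (r 0) (r 1))) i j := by
      rw [← map_one (Matrix.SpecialLinearGroup.map (n := Fin 2)
        (Ideal.Quotient.mk (maximalIdeal 𝔬 ^ max (r 0) (r 1))))]
      rfl
    rw [h2, ← h3]
    rfl
  refine Ideal.pow_le_pow_right ?_ h1
  fin_cases i
  · exact le_max_left _ _
  · exact le_max_right _ _

/-- The reduction maps are locally constant. -/
lemma isLocallyConstant_map_mk (r : ℕ) : IsLocallyConstant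
    (Matrix.SpecialLinearGroup.map (n := Fin 2) (Ideal.Quotient.mk (maximalIdeal 𝔬 ^ r))) := by
  rw [IsLocallyConstant.iff_eventually_eq]
  intro g
  have h1 : ∀ i j : Fin 2, ∀ᶠ g' : SL2 𝔬 in 𝓝 g, g' i j - g i j ∈ maximalIdeal 𝔬 ^ r := by
    intro i j
    have hcont : Continuous fun g' : SL2 𝔬 => g' i j :=
      (continuous_apply j).comp ((continuous_apply i).comp continuous_subtype_val)
    have h2 := (h𝔬.hasBasis_nhds (g i j)).mem_of_mem (i := r) trivial
    filter_upwards [hcont.continuousAt.preimage_mem_nhds h2] with g' hg'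
    obtain ⟨y, hy, hyg⟩ := hg'
    have hyg' : g i j + y = g' i j := hyg
    rw [← hyg', add_sub_cancel_left]
    exact hy
  filter_upwards [h1 0 0, h1 0 1, h1 1 0, h1 1 1] with g' h00 h01 h10 h11
  apply sl_ext
  · exact Ideal.Quotient.eq.mpr h00
  · exact Ideal.Quotient.eq.mpr h01
  · exact Ideal.Quotient.eq.mpr h10
  · exact Ideal.Quotient.eq.mpr h11

open scoped Matrix.Norms.Operator in
/-- A continuous representation is trivial on a congruence subgroup. -/
theorem ContIrrRep.exists_trivial_on_congruence (ρ : ContIrrRep (SL2 𝔬)) :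
    ∃ r : ℕ, ∀ g : SL2 𝔬, Matrix.SpecialLinearGroup.map (n := Fin 2)
      (Ideal.Quotient.mk (maximalIdeal 𝔬 ^ r)) g = 1 → ρ.rep g = 1 := by
  obtain ⟨M, hM⟩ : ∃ M : SL2 𝔬 → Matrix (Fin ρ.dim) (Fin ρ.dim) ℂ,
    ∀ g, M g = LinearMap.toMatrixAlgEquiv' (ρ.rep g) := ⟨_, fun _ => rfl⟩
  have hMc : Continuous M := by
    refine continuous_pi fun i => continuous_pi fun j => ?_
    have h1 : ∀ g, M g i j = ρ.rep g (Pi.single j 1) i := by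
      intro g
      rw [hM]
      exact LinearMap.toMatrix'_apply _ _ _
    simp only [h1]
    exact (continuous_apply i).comp
      (ρ.continuous_action.comp (continuous_id.prodMk continuous_const))
  have hM1 : M 1 = 1 := by rw [hM, map_one, map_one]
  have hU : {g | ‖M g - 1‖ < 1 / 2} ∈ 𝓝 (1 : SL2 𝔬) := by
    have hc : Continuous fun g => ‖M g - 1‖ := (hMc.sub continuous_const).norm
    have h1 := hc.continuousAt (x := 1)
    apply h1.eventually_lt continuousAt_const
    rw [hM1, sub_self, norm_zero]
    norm_num
  obtain ⟨r, hr⟩ := exists_congruence_subset h𝔬 hU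
  refine ⟨r, fun g hg => ?_⟩
  have h1 : M g = 1 := by
    apply eq_one_of_norm_pow_sub_one_le
    intro k
    have h2 : M g ^ k = M (g ^ k) := by rw [hM, hM, map_pow, map_pow]
    rw [h2]
    exact (hr (g ^ k) (by rw [map_pow, hg, one_pow])).le
  rw [hM] at h1
  exact LinearMap.toMatrixAlgEquiv'.injective (h1.trans (map_one _).symm)

end Factor

section Pullback

variable {G Γ : Type*} [Group G] [Group Γ] {V V' : Type*} [AddCommGroup V] [Module ℂ V]
  [AddCommGroup V'] [Module ℂ V'] {π : G →* Γ} (hπ : Function.Surjective π)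

/-- The subrepresentations of a representation do not change under pullback along a surjective
homomorphism. -/
def Subrepresentation.compOrderIso (σ : Representation ℂ Γ V) :
    Subrepresentation (σ.comp π) ≃o Subrepresentation σ where
  toFun U := ⟨U.toSubmodule, fun g v hv => by
    obtain ⟨x, rfl⟩ := hπ g
    exact U.apply_mem_toSubmodule x hv⟩
  invFun U := ⟨U.toSubmodule, fun g _ hv => U.apply_mem_toSubmodule (π g) hv⟩
  left_inv _ := rfl
  right_inv _ := rfl
  map_rel_iff' := Iff.rfl

include hπ in
lemma Representation.isIrreducible_comp_iff (σ : Representation ℂ Γ V) :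
    Representation.IsIrreducible (σ.comp π) ↔ σ.IsIrreducible :=
  OrderIso.isSimpleOrder_iff (Subrepresentation.compOrderIso hπ σ)

include hπ in
lemma Representation.nonempty_equiv_of_comp {σ : Representation ℂ Γ V}
    {σ' : Representation ℂ Γ V'}
    (h : Nonempty (Representation.Equiv (σ.comp π) (σ'.comp π))) : Nonempty (σ.Equiv σ') := by
  obtain ⟨e⟩ := h
  refine ⟨Representation.Equiv.mk e.toLinearEquiv fun g => ?_⟩
  obtain ⟨x, rfl⟩ := hπ g
  exact e.toIntertwiningMap.isIntertwining' x

lemma Representation.Equiv.nonempty_comp (π : G →* Γ) {σ : Representation ℂ Γ V}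
    {σ' : Representation ℂ Γ V'} (e : σ.Equiv σ') :
    Nonempty (Representation.Equiv (σ.comp π) (σ'.comp π)) :=
  ⟨Representation.Equiv.mk e.toLinearEquiv fun g => e.toIntertwiningMap.isIntertwining' (π g)⟩

end Pullback

section Blocks
open IsLocalRing Topology

variable {𝔬 : Type*} [CommRing 𝔬] [IsLocalRing 𝔬] [TopologicalSpace 𝔬]
  (h𝔬 : IsAdic (maximalIdeal 𝔬))

/-- The continuous irreducible representation of `SL₂(𝔬)` obtained from a block of the group
algebra of a finite quotient. -/
noncomputable def blockContIrrRep (r : ℕ)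
    (W : WedderburnDecomposition (SL2 (LevelRing 𝔬 r))) (i : Fin W.numBlocks) :
    ContIrrRep (SL2 𝔬) where
  dim := W.size i
  rep := (W.rep i).toMatrixRep.comp
    (Matrix.SpecialLinearGroup.map (n := Fin 2) (Ideal.Quotient.mk (maximalIdeal 𝔬 ^ r)))
  irreducible := (Representation.isIrreducible_comp_iff (map_mk_surjective 𝔬 r) _).mpr
    (W.rep_isIrreducible i)
  continuous_action := by
    refine continuous_pi fun k => ?_
    change Continuous fun p : SL2 𝔬 × (Fin (W.size i) → ℂ) =>
      ∑ l, W.rep i (Matrix.SpecialLinearGroup.map (n := Fin 2)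
        (Ideal.Quotient.mk (maximalIdeal 𝔬 ^ r)) p.1) k l * p.2 l
    refine continuous_finsetSum _ fun l _ => Continuous.mul ?_
      ((continuous_apply l).comp continuous_snd)
    exact (((isLocallyConstant_map_mk h𝔬 r).comp (fun g => W.rep i g k l)).continuous).comp
      continuous_fst

/-- The isomorphism class of `blockContIrrRep`. -/
noncomputable def blockIrr (r : ℕ)
    (W : WedderburnDecomposition (SL2 (LevelRing 𝔬 r))) (i : Fin W.numBlocks) : Irr (SL2 𝔬) :=
  Quotient.mk (ContIrrRep.instSetoid _) (blockContIrrRep h𝔬 r W i)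

lemma dim_blockIrr (r : ℕ) (W : WedderburnDecomposition (SL2 (LevelRing 𝔬 r)))
    (i : Fin W.numBlocks) : (blockIrr h𝔬 r W i).dim = W.size i := rfl

lemma blockIrr_injective (r : ℕ) (W : WedderburnDecomposition (SL2 (LevelRing 𝔬 r))) :
    Function.Injective (blockIrr h𝔬 r W) := by
  intro i j hij
  obtain ⟨e⟩ := Representation.nonempty_equiv_of_comp (map_mk_surjective 𝔬 r)
    (Quotient.exact (s := ContIrrRep.instSetoid _) hij)
  exact W.eq_of_equiv e

/-- The blocks at level `r` give all representations that are trivial on the `r`-th congruence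
subgroup. -/
lemma exists_blockIrr_eq (r : ℕ) (W : WedderburnDecomposition (SL2 (LevelRing 𝔬 r)))
    (ρ : ContIrrRep (SL2 𝔬)) (hρ : ∀ g : SL2 𝔬, Matrix.SpecialLinearGroup.map (n := Fin 2)
      (Ideal.Quotient.mk (maximalIdeal 𝔬 ^ r)) g = 1 → ρ.rep g = 1) :
    ∃ i, blockIrr h𝔬 r W i = Quotient.mk (ContIrrRep.instSetoid _) ρ := by
  have hπ := map_mk_surjective 𝔬 r
  obtain ⟨π, hπe⟩ : ∃ π, π = Matrix.SpecialLinearGroup.map (n := Fin 2)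
      (Ideal.Quotient.mk (maximalIdeal 𝔬 ^ r)) := ⟨_, rfl⟩
  obtain ⟨σ, hσ⟩ : ∃ σ : Representation ℂ (SL2 (LevelRing 𝔬 r)) (Fin ρ.dim → ℂ),
      σ.comp π = ρ.rep := by
    rw [← hπe] at hπ
    refine ⟨(Units.coeHom _).comp (π.liftOfSurjective hπ
      ⟨MonoidHom.toHomUnits ρ.rep, fun g hg => Units.ext (hρ g ?_)⟩), ?_⟩
    · rw [← hπe]
      exact hg
    · ext1 g
      exact congrArg Units.val
        (MonoidHom.liftOfRightInverse_comp_apply π _ (Function.rightInverse_surjInv hπ) _ g)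
  have hirr : σ.IsIrreducible := by
    rw [← Representation.isIrreducible_comp_iff (hπe ▸ hπ), hσ]
    exact ρ.irreducible
  obtain ⟨i, ⟨e⟩⟩ := W.exists_equiv σ hirr
  refine ⟨i, Quotient.sound (s := ContIrrRep.instSetoid _) ?_⟩
  change Nonempty (Representation.Equiv ((W.rep i).toMatrixRep.comp _) ρ.rep)
  rw [← hσ, ← hπe]
  exact e.nonempty_comp π

lemma exists_blockIrr (ρ : Irr (SL2 𝔬)) :
    ∃ r, ∀ W : WedderburnDecomposition (SL2 (LevelRing 𝔬 r)), ∃ i, blockIrr h𝔬 r W i = ρ := by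
  induction ρ using Quotient.inductionOn with
  | h ρ =>
    obtain ⟨r, hr⟩ := ρ.exists_trivial_on_congruence h𝔬
    exact ⟨r, fun W => exists_blockIrr_eq h𝔬 r W ρ hr⟩

end Blocks

section NewBlocks
open IsLocalRing

variable {𝔬 : Type*} [CommRing 𝔬] [IsDomain 𝔬] [IsDiscreteValuationRing 𝔬]
  [Finite (ResidueField 𝔬)] [TopologicalSpace 𝔬] (h𝔬 : IsAdic (maximalIdeal 𝔬))

/-- A block at level `r + 1` that does not come from level `r` is large. -/
lemma exists_blockIrr_or_card_le (r : ℕ)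
    (W : WedderburnDecomposition (SL2 (LevelRing 𝔬 r)))
    (W' : WedderburnDecomposition (SL2 (LevelRing 𝔬 (r + 1)))) (i : Fin W'.numBlocks) :
    (∃ j, blockIrr h𝔬 r W j = blockIrr h𝔬 (r + 1) W' i) ∨
      Nat.card (ResidueField 𝔬) ^ (r + 1) ≤
        4 * W'.size i * Nat.card (ResidueField 𝔬) ^ (r + 1 - (r + 1 + 1) / 2) := by
  obtain ⟨ϖ, hϖ⟩ := IsDiscreteValuationRing.exists_irreducible 𝔬
  by_cases hker : (Matrix.SpecialLinearGroup.map (n := Fin 2) (levelTransition 𝔬 r)).ker ≤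
      (W'.rep i).ker
  · left
    refine exists_blockIrr_eq h𝔬 r W _ fun g hg => ?_
    have h1 : W'.rep i (Matrix.SpecialLinearGroup.map (n := Fin 2)
        (Ideal.Quotient.mk (maximalIdeal 𝔬 ^ (r + 1))) g) = 1 := by
      apply hker
      rw [MonoidHom.mem_ker, map_levelTransition_map_mk, hg]
    refine LinearMap.ext fun x => ?_
    change W'.rep i _ *ᵥ x = x
    rw [h1]
    exact Matrix.one_mulVec x
  · right
    obtain ⟨x, hx, hne⟩ := exists_slUpper_ne_one hϖ r (W'.rep i) hker
    exact card_le_mul_dim_of_ne_one _ (isChainRing_levelRing hϖ (r + 1)) hx hne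

end NewBlocks

/-! ### Dirichlet series of dimensions -/

section Dirichlet

variable {X : Type*} (d : X → ℕ) (S : ℕ → Finset X)

/-- A Dirichlet series converges at `σ > 1` if its terms are arranged in layers whose sums of
inverses grow polynomially while the numbers themselves grow exponentially with the layer. -/
theorem summable_rpow_neg_of_layers (hd : ∀ x, d x ≠ 0) {b A : ℝ} {k : ℕ} (hb : 1 < b)
    (hinv : ∀ r, ∑ x ∈ S r, (d x : ℝ)⁻¹ ≤ A * ((r + 1 : ℕ) : ℝ) ^ k)
    (hlayer : ∀ x, ∃ r, x ∈ S r ∧ b ^ r ≤ 4 * d x) {σ : ℝ} (hσ : 1 < σ) :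
    Summable fun x => (d x : ℝ) ^ (-σ) := by
  classical
  choose ℓ hℓS hℓ using hlayer
  have hdpos : ∀ x, (0 : ℝ) < d x := fun x => by exact_mod_cast Nat.pos_of_ne_zero (hd x)
  obtain ⟨θ, hθ⟩ : ∃ θ : ℝ, θ = b ^ (-(σ - 1)) := ⟨_, rfl⟩
  have hb0 : 0 < b := by linarith
  have hθ0 : 0 < θ := by rw [hθ]; positivity
  have hθ1 : θ < 1 := by rw [hθ]; exact Real.rpow_lt_one_of_one_lt_of_neg hb (by linarith)
  obtain ⟨c, hc⟩ : ∃ c : ℝ, c = (1 / 4 : ℝ) ^ (-(σ - 1)) := ⟨_, rfl⟩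
  have hc0 : 0 < c := by rw [hc]; positivity
  have hterm : ∀ x, (d x : ℝ) ^ (-σ) ≤ (d x : ℝ)⁻¹ * (c * θ ^ ℓ x) := by
    intro x
    have h1 : (d x : ℝ) ^ (-σ) = (d x : ℝ)⁻¹ * (d x : ℝ) ^ (-(σ - 1)) := by
      rw [← Real.rpow_neg_one, ← Real.rpow_add (hdpos x)]
      congr 1
      ring
    have h2 : c * θ ^ ℓ x = (1 / 4 * b ^ ℓ x) ^ (-(σ - 1)) := by
      rw [Real.mul_rpow (by norm_num) (by positivity), hc, hθ, ← Real.rpow_natCast,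
        ← Real.rpow_natCast, ← Real.rpow_mul hb0.le, ← Real.rpow_mul hb0.le, mul_comm (-(σ - 1))]
    rw [h1, h2]
    refine mul_le_mul_of_nonneg_left ?_ (by positivity)
    exact Real.rpow_le_rpow_of_nonpos (by positivity) (by linarith [hℓ x]) (by linarith)
  have hsum : Summable fun r : ℕ => A * ((r + 1 : ℕ) : ℝ) ^ k * (c * θ ^ r) := by
    have h1 := summable_pow_mul_geometric_of_norm_lt_one k (r := θ)
      (by rw [Real.norm_of_nonneg hθ0.le]; exact hθ1)
    refine (((summable_nat_add_iff 1).mpr h1).mul_left (A * c * θ⁻¹)).congr fun r => ?_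
    rw [pow_succ θ]
    field_simp
  have hlayer_nonneg : ∀ r, 0 ≤ A * ((r + 1 : ℕ) : ℝ) ^ k * (c * θ ^ r) := fun r =>
    mul_nonneg ((Finset.sum_nonneg fun x _ => by positivity).trans (hinv r)) (by positivity)
  refine summable_of_sum_le (c := ∑' r, A * ((r + 1 : ℕ) : ℝ) ^ k * (c * θ ^ r))
    (fun x => by positivity) fun F => ?_
  calc ∑ x ∈ F, (d x : ℝ) ^ (-σ) ≤ ∑ x ∈ F, (d x : ℝ)⁻¹ * (c * θ ^ ℓ x) :=
        Finset.sum_le_sum fun x _ => hterm x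
    _ = ∑ r ∈ F.image ℓ, ∑ x ∈ F with ℓ x = r, (d x : ℝ)⁻¹ * (c * θ ^ ℓ x) :=
        (Finset.sum_fiberwise_of_maps_to (fun x hx => Finset.mem_image_of_mem _ hx) _).symm
    _ ≤ ∑ r ∈ F.image ℓ, A * ((r + 1 : ℕ) : ℝ) ^ k * (c * θ ^ r) := by
        refine Finset.sum_le_sum fun r _ => ?_
        calc ∑ x ∈ F with ℓ x = r, (d x : ℝ)⁻¹ * (c * θ ^ ℓ x)
            = (∑ x ∈ F with ℓ x = r, (d x : ℝ)⁻¹) * (c * θ ^ r) := by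
              rw [Finset.sum_mul]
              refine Finset.sum_congr rfl fun x hx => ?_
              rw [(Finset.mem_filter.mp hx).2]
          _ ≤ (∑ x ∈ S r, (d x : ℝ)⁻¹) * (c * θ ^ r) := by
              refine mul_le_mul_of_nonneg_right (Finset.sum_le_sum_of_subset_of_nonneg ?_
                fun x _ _ => by positivity) (by positivity)
              intro x hx
              rw [← (Finset.mem_filter.mp hx).2]
              exact hℓS x
          _ ≤ _ := mul_le_mul_of_nonneg_right (hinv r) (by positivity)
    _ ≤ _ := hsum.sum_le_tsum _ fun r _ => hlayer_nonneg r

/-- A Dirichlet series diverges at `s < 1` if over suitable finite sets its sum of first moments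
is at least of order `Q ^ (2 * r)` while its sum of second moments is at most of order
`Q ^ (3 * r)`: the numbers far above `Q ^ r` then contribute little to the first moment. -/
theorem not_summable_rpow_neg_of_moments (hd : ∀ x, d x ≠ 0) {Q : ℝ} (hQ : 1 < Q)
    (h1 : ∀ r, Q ^ (2 * r) ≤ 2 * ∑ x ∈ S r, (d x : ℝ))
    (h2 : ∀ r, ∑ x ∈ S r, (d x : ℝ) ^ 2 ≤ 2 * Q ^ (3 * r)) {s : ℝ} (hs0 : 0 < s) (hs1 : s < 1) :
    ¬ Summable fun x => (d x : ℝ) ^ (-s) := by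
  intro hsum
  have hQ0 : 0 < Q := by linarith
  have hdpos : ∀ x, (0 : ℝ) < d x := fun x => by exact_mod_cast Nat.pos_of_ne_zero (hd x)
  obtain ⟨B, hB⟩ : ∃ B, B = ∑' x, (d x : ℝ) ^ (-s) := ⟨_, rfl⟩
  have hterm : ∀ {D : ℝ}, 0 < D → ∀ x,
      (d x : ℝ) ≤ D ^ (1 + s) * (d x : ℝ) ^ (-s) + (d x : ℝ) ^ 2 * D⁻¹ := by
    intro D hD x
    rcases le_total (d x : ℝ) D with hle | hle
    · have h3 : (d x : ℝ) = (d x : ℝ) ^ (1 + s) * (d x : ℝ) ^ (-s) := by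
        rw [← Real.rpow_add (hdpos x), add_neg_cancel_right, Real.rpow_one]
      have h4 : (d x : ℝ) ^ (1 + s) * (d x : ℝ) ^ (-s) ≤ D ^ (1 + s) * (d x : ℝ) ^ (-s) := by
        gcongr
      have h5 : 0 ≤ (d x : ℝ) ^ 2 * D⁻¹ := by positivity
      linarith
    · have h3 : (d x : ℝ) ≤ (d x : ℝ) ^ 2 * D⁻¹ := by
        rw [← div_eq_mul_inv, le_div_iff₀ hD, sq]
        gcongr
      have h4 : 0 ≤ D ^ (1 + s) * (d x : ℝ) ^ (-s) := by positivity
      linarith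
  -- With the threshold `8 * Q ^ r` the terms above it make up at most half of the first moment.
  have hbound : ∀ r : ℕ, (Q ^ (1 - s)) ^ r ≤ 4 * 8 ^ (1 + s) * B := by
    intro r
    have hQr : 0 < Q ^ r := by positivity
    have h3 : ∑ x ∈ S r, (d x : ℝ) ≤ (8 * Q ^ r) ^ (1 + s) * B + 2 * Q ^ (3 * r) * (8 * Q ^ r)⁻¹ :=
      calc ∑ x ∈ S r, (d x : ℝ)
          ≤ ∑ x ∈ S r, ((8 * Q ^ r) ^ (1 + s) * (d x : ℝ) ^ (-s) + (d x : ℝ) ^ 2 * (8 * Q ^ r)⁻¹) :=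
            Finset.sum_le_sum fun x _ => hterm (by positivity) x
        _ = (8 * Q ^ r) ^ (1 + s) * ∑ x ∈ S r, (d x : ℝ) ^ (-s) +
            (∑ x ∈ S r, (d x : ℝ) ^ 2) * (8 * Q ^ r)⁻¹ := by
            rw [Finset.sum_add_distrib, Finset.mul_sum, Finset.sum_mul]
        _ ≤ _ := by
            gcongr
            · rw [hB]; exact hsum.sum_le_tsum _ fun x _ => by positivity
            · exact h2 r
    have h4 : 2 * Q ^ (3 * r) * (8 * Q ^ r)⁻¹ = Q ^ (2 * r) / 4 := by
      rw [show 3 * r = 2 * r + r by ring, pow_add]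
      field_simp
      norm_num
    have h5 : Q ^ (2 * r) = (Q ^ r) ^ (1 + s) * (Q ^ (1 - s)) ^ r := by
      have e1 : (Q ^ (1 - s)) ^ r = (Q ^ r) ^ (1 - s) := by
        rw [← Real.rpow_natCast, ← Real.rpow_natCast, ← Real.rpow_mul hQ0.le,
          ← Real.rpow_mul hQ0.le, mul_comm]
      rw [e1, ← Real.rpow_add hQr, show 1 + s + (1 - s) = ((2 : ℕ) : ℝ) by push_cast; ring,
        Real.rpow_natCast, ← pow_mul, mul_comm]
    have h6 := h1 r
    rw [h4, Real.mul_rpow (by norm_num) hQr.le] at h3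
    have h7 : (Q ^ r) ^ (1 + s) * (Q ^ (1 - s)) ^ r ≤ (Q ^ r) ^ (1 + s) * (4 * 8 ^ (1 + s) * B) := by
      rw [← h5]
      linarith
    exact le_of_mul_le_mul_left h7 (by positivity)
  obtain ⟨r, hr⟩ := pow_unbounded_of_one_lt (4 * 8 ^ (1 + s) * B)
    (Real.one_lt_rpow hQ (by linarith : 0 < 1 - s))
  exact absurd (hbound r) (not_le.mpr hr)

end Dirichlet

/-! ### The zeta function of `SL₂(𝔬)` -/

section Zeta
open IsLocalRing

lemma Irr.dim_ne_zero {G : Type*} [Group G] [TopologicalSpace G] (ρ : Irr G) : ρ.dim ≠ 0 := by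
  induction ρ using Quotient.inductionOn with
  | h ρ =>
    intro h0
    have h0 : ρ.dim = 0 := h0
    have hempty : IsEmpty (Fin ρ.dim) := by rw [h0]; infer_instance
    obtain ⟨U, U', hUU⟩ := ρ.irreducible.toNontrivial
    apply hUU
    apply Subrepresentation.toSubmodule_injective
    ext x
    rw [Subsingleton.elim x 0]
    simp

lemma repZetaConvergesAt_iff {G : Type*} [Group G] [TopologicalSpace G] (s : ℂ) :
    RepZetaConvergesAt G s ↔ Summable fun ρ : Irr G => (ρ.dim : ℝ) ^ (-s.re) := by
  rw [RepZetaConvergesAt, ← summable_norm_iff]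
  refine summable_congr fun ρ => ?_
  rw [norm_div, norm_one, Complex.norm_natCast_cpow_of_pos (Nat.pos_of_ne_zero ρ.dim_ne_zero),
    Real.rpow_neg (Nat.cast_nonneg _), one_div]

lemma isRigid_of_summable {G : Type*} [Group G] [TopologicalSpace G] {σ : ℝ}
    (h : Summable fun ρ : Irr G => (ρ.dim : ℝ) ^ (-σ)) : IsRigid G := by
  intro n
  rcases Nat.eq_zero_or_pos n with rfl | hn
  · convert Set.finite_empty
    exact Set.eq_empty_of_forall_notMem fun ρ hρ => ρ.dim_ne_zero hρ
  · have hpos : (0 : ℝ) < (n : ℝ) ^ (-σ) := Real.rpow_pos_of_pos (by exact_mod_cast hn) _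
    have h1 := h.tendsto_cofinite_zero.eventually (gt_mem_nhds hpos)
    refine Set.Finite.subset (Filter.eventually_cofinite.mp h1) fun ρ hρ => ?_
    have hρ : ρ.dim = n := hρ
    simp [hρ]

lemma repZetaAbscissa_eq_one {G : Type*} [Group G] [TopologicalSpace G]
    (hconv : ∀ σ : ℝ, 1 < σ → Summable fun ρ : Irr G => (ρ.dim : ℝ) ^ (-σ))
    (hdiv : ∀ σ : ℝ, 0 < σ → σ < 1 → ¬ Summable fun ρ : Irr G => (ρ.dim : ℝ) ^ (-σ)) :
    repZetaAbscissa G = 1 := by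
  apply le_antisymm
  · refine sInf_le ⟨1, fun s hs => ?_, EReal.coe_one⟩
    exact (repZetaConvergesAt_iff s).mpr (hconv _ hs)
  · refine le_sInf ?_
    rintro _ ⟨a, ha, rfl⟩
    rw [← EReal.coe_one, EReal.coe_le_coe_iff]
    by_contra! ha1
    obtain ⟨σ, hσ, hσ1⟩ := exists_between (max_lt ha1 (zero_lt_one' ℝ))
    have h1 := (repZetaConvergesAt_iff (σ : ℂ)).mp
      (ha σ (by rw [Complex.ofReal_re]; exact (le_max_left _ _).trans_lt hσ))
    rw [Complex.ofReal_re] at h1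
    exact hdiv σ ((le_max_right _ _).trans_lt hσ) hσ1 h1

variable {𝔬 : Type*} [CommRing 𝔬] [IsDomain 𝔬] [IsDiscreteValuationRing 𝔬]
  [Finite (ResidueField 𝔬)] [TopologicalSpace 𝔬] (h𝔬 : IsAdic (maximalIdeal 𝔬))

/-- The finite set of classes of representations of level at most `r`. -/
noncomputable def levelIrr (W : ∀ r, WedderburnDecomposition (SL2 (LevelRing 𝔬 r))) (r : ℕ) :
    Finset (Irr (SL2 𝔬)) :=
  Finset.univ.map ⟨blockIrr h𝔬 r (W r), blockIrr_injective h𝔬 r (W r)⟩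

variable (W : ∀ r, WedderburnDecomposition (SL2 (LevelRing 𝔬 r)))

omit [Finite (ResidueField 𝔬)] in
lemma sum_levelIrr (f : ℕ → ℝ) (r : ℕ) :
    ∑ ρ ∈ levelIrr h𝔬 W r, f ρ.dim = ∑ i, f ((W r).size i) := by
  rw [levelIrr, Finset.sum_map]
  rfl

/-- A class occurring first at level `r` has dimension at least `√q ^ r / 4`. -/
lemma exists_mem_levelIrr (ρ : Irr (SL2 𝔬)) : ∃ r, ρ ∈ levelIrr h𝔬 W r ∧
    √(Nat.card (ResidueField 𝔬)) ^ r ≤ 4 * ρ.dim := by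
  classical
  have hmem : ∀ r, ρ ∈ levelIrr h𝔬 W r ↔ ∃ i, blockIrr h𝔬 r (W r) i = ρ := fun r => by
    simp [levelIrr]
  have hex : ∃ r, ρ ∈ levelIrr h𝔬 W r := by
    obtain ⟨r, hr⟩ := exists_blockIrr h𝔬 ρ
    exact ⟨r, (hmem r).mpr (hr _)⟩
  obtain ⟨r, hr, hmin⟩ : ∃ r, ρ ∈ levelIrr h𝔬 W r ∧ ∀ m < r, ρ ∉ levelIrr h𝔬 W m :=
    ⟨Nat.find hex, Nat.find_spec hex, fun m hm => Nat.find_min hex hm⟩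
  refine ⟨r, hr, ?_⟩
  have hq0 : 0 < Nat.card (ResidueField 𝔬) := Nat.card_pos
  obtain ⟨q, hq⟩ : ∃ q, q = Nat.card (ResidueField 𝔬) := ⟨_, rfl⟩
  rw [← hq] at hq0 ⊢
  rcases r with _ | r
  · have : (1 : ℝ) ≤ ρ.dim := by exact_mod_cast Nat.pos_of_ne_zero ρ.dim_ne_zero
    rw [pow_zero]
    linarith
  · obtain ⟨i, rfl⟩ := (hmem _).mp hr
    rcases exists_blockIrr_or_card_le h𝔬 r (W r) (W (r + 1)) i with h1 | h1
    · exact absurd ((hmem r).mpr h1) (hmin r (Nat.lt_succ_self r))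
    · rw [← hq] at h1
      rw [dim_blockIrr]
      have h2 : q ^ ((r + 1 + 1) / 2) ≤ 4 * (W (r + 1)).size i := by
        refine Nat.le_of_mul_le_mul_right (c := q ^ (r + 1 - (r + 1 + 1) / 2)) ?_ (by positivity)
        rw [← pow_add]
        refine le_trans (le_of_eq ?_) h1
        congr 1
        omega
      have h3 : (q : ℝ) ^ ((r + 1 + 1) / 2) ≤ 4 * (W (r + 1)).size i := by exact_mod_cast h2
      refine le_trans ?_ h3
      have hsq : (q : ℝ) = √q ^ 2 := (Real.sq_sqrt (Nat.cast_nonneg q)).symm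
      have h4 : (q : ℝ) ^ ((r + 1 + 1) / 2) = √q ^ (2 * ((r + 1 + 1) / 2)) := by
        conv_lhs => rw [hsq]
        rw [← pow_mul]
      rw [h4]
      exact pow_le_pow_right₀ (Real.one_le_sqrt.mpr (by exact_mod_cast hq0)) (by omega)

omit [TopologicalSpace 𝔬] in
lemma one_lt_natCard_residueField : 1 < Nat.card (ResidueField 𝔬) := Finite.one_lt_card

include h𝔬 in
theorem summable_dim_rpow_neg {σ : ℝ} (hσ : 1 < σ) :
    Summable fun ρ : Irr (SL2 𝔬) => (ρ.dim : ℝ) ^ (-σ) := by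
  obtain ⟨ϖ, hϖ⟩ := IsDiscreteValuationRing.exists_irreducible 𝔬
  obtain ⟨e0, he0⟩ := exists_val_two_le 𝔬 hϖ
  have W : ∀ r, WedderburnDecomposition (SL2 (LevelRing 𝔬 r)) :=
    fun r => (WedderburnDecomposition.nonempty _).some
  refine summable_rpow_neg_of_layers Irr.dim (levelIrr h𝔬 W) Irr.dim_ne_zero
    (b := √(Nat.card (ResidueField 𝔬))) (k := 9)
    (A := 256 * (Nat.card (ResidueField 𝔬) : ℝ) ^ (2 * e0)) ?_ (fun r => ?_)
    (exists_mem_levelIrr h𝔬 W) hσ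
  · rw [Real.lt_sqrt zero_le_one, one_pow]
    exact_mod_cast one_lt_natCard_residueField (𝔬 := 𝔬)
  · rw [sum_levelIrr h𝔬 W fun n => (n : ℝ)⁻¹]
    refine (sum_inv_size_le (isChainRing_levelRing hϖ r) (he0 r)
      (hasTrivialTwistedIndicators_levelRing 𝔬 r) (W r)).trans (le_of_eq ?_)
    push_cast
    ring

include h𝔬 in
theorem not_summable_dim_rpow_neg {s : ℝ} (hs0 : 0 < s) (hs1 : s < 1) :
    ¬ Summable fun ρ : Irr (SL2 𝔬) => (ρ.dim : ℝ) ^ (-s) := by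
  obtain ⟨ϖ, hϖ⟩ := IsDiscreteValuationRing.exists_irreducible 𝔬
  have W : ∀ r, WedderburnDecomposition (SL2 (LevelRing 𝔬 r)) :=
    fun r => (WedderburnDecomposition.nonempty _).some
  refine not_summable_rpow_neg_of_moments Irr.dim (levelIrr h𝔬 W) Irr.dim_ne_zero
    (Q := Nat.card (ResidueField 𝔬)) (by exact_mod_cast one_lt_natCard_residueField (𝔬 := 𝔬))
    (fun r => ?_) (fun r => ?_) hs0 hs1
  · rw [sum_levelIrr h𝔬 W fun n => (n : ℝ)]
    exact le_sum_size (isChainRing_levelRing hϖ r) (hasTrivialTwistedIndicators_levelRing 𝔬 r) (W r)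
  · rw [sum_levelIrr h𝔬 W fun n => (n : ℝ) ^ 2]
    exact sum_size_sq_le (isChainRing_levelRing hϖ r) (W r)

end Zeta

end

theorem mainTheorem1 (𝔬 : Type*) [CommRing 𝔬] [IsDomain 𝔬] [IsDiscreteValuationRing 𝔬]
    [IsAdicComplete (IsLocalRing.maximalIdeal 𝔬) 𝔬] [Finite (IsLocalRing.ResidueField 𝔬)]
    [TopologicalSpace 𝔬] (h𝔬 : IsAdic (IsLocalRing.maximalIdeal 𝔬)) :
    IsRigid (Matrix.SpecialLinearGroup (Fin 2) 𝔬) ∧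
      repZetaAbscissa (Matrix.SpecialLinearGroup (Fin 2) 𝔬) = 1 :=
  ⟨isRigid_of_summable (summable_dim_rpow_neg h𝔬 one_lt_two),
    repZetaAbscissa_eq_one (fun _ hσ => summable_dim_rpow_neg h𝔬 hσ)
      fun _ hs0 hs1 => not_summable_dim_rpow_neg h𝔬 hs0 hs1⟩
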